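/- Let $\alpha\in(0,1)$, $T>0$, $\mathbb T=\mathbb R/\mathbb Z$, $(a,b)^\perp=(-b,a)$, and consider $\partial_t\theta+u\cdot\nabla\theta=0$ on $\mathbb R^2\times(0,T)$, where $u=\nabla^\perp\Lambda^{-1+\alpha}\theta$ and $\Lambda^{-1+\alpha}f(x)=\int_{\mathbb R^2}|x-y|^{-1-\alpha}f(y)\,dy$. Let $(\theta_\delta)_{0<\delta<\delta_0}$ be an almost-sharp front with compatible curves $z=z_\delta(s,t)$. That is, there is $C$ independent of $\delta$ such that for each $\delta$ the following hold. The function $\theta=\theta_\delta$ is a classical ($C^1$ in $(x,t)$) solution, $C^2$ in $x$. For each $t\in(0,T)$, $z(\cdot,t):\mathbb T\to\mathbb R^2$ is a simple closed positively oriented $C^2$ curve of constant speed $|z_s|=L(t)$ bounding a bounded simply connected region $A(t)$. For some $C^z\in(0,C)$ we have $\theta=1$ on $\{x\in A:\operatorname{dist}(x,\partial A)>C^z\delta\}$ and $\theta=0$ on $\{x\notin A:\operatorname{dist}(x,\partial A)>C^z\delta\}$. Finally, $\|\nabla\theta\|_{L^\infty}\le C/\delta$. The transition region is parameterised by $\xi\in[-1,1]$,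 i.e. $C^z\le1$. Let $\mathbf T=z_s/L$, $N=\mathbf T^\perp$, $\kappa=L^{-3}z_{ss}\cdot z_s^\perp$, $x(s,\xi,\tau)=z(s,\tau)+\delta\xi N(s,\tau)$, and $\Omega(s,\xi,\tau)=\theta(x(s,\xi,\tau),\tau)$. Assume, uniformly in $\delta$ and in time: (a) $z$ is $C^3$ in $s$, $z$ and $z_s$ are $C^1$ in $(s,\tau)$, and $z_s,z_{ss},z_{sss},z_\tau,z_{s\tau}$ are bounded. Also $|z(s)-z(s')|\ge c\,|\sin(\pi(s-s'))|/\pi$ with $c>0$. The first and second derivatives of $\Omega$ in $(s,\xi)\in\mathbb T\times[-1,1]$ are bounded. (b) $z$ evolves by the sharp front equation up to an error $o(\delta)$ (for instance exactly): $$z_\tau\cdot N=-\Big(\int_{\mathbb T}\frac{\partial_sz_*-\partial_sz}{|z-z_*|^{1+\alpha}}\,ds_*\Big)\cdot N+o(\delta)$$ uniformly in $s$ and in time. A subscript $*$ means evaluation at $s_*$, or at $(s_*,\xi_*)$; otherwise functions are evaluated at $s$, or at $(s,\xi)$. Write $\nabla=(\partial_s,\partial_\xi)$ and $\nabla^\perp=(-\partial_\xi,\partial_s)$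 for functions of $(s,\xi)$. Then, as $\delta\to0$, uniformly in $s\in\mathbb T$, $\xi\in[-1,1]$ and $\tau\in(0,T)$, $$\begin{aligned} o(1)={}&\partial_\tau\Omega-\frac{z_\tau\cdot\mathbf T}{L}\,\partial_s\Omega +(1+\alpha)L\int_{-1}^1\!\int_{\mathbb T}\frac{\mathbf T_*\cdot N}{|z-z_*|^{3+\alpha}}\,(z-z_*)\cdot(\xi N-\xi_*N_*)\,\partial_\xi\Omega_*\,ds_*\,d\xi_*\;\partial_\xi\Omega\\ &+\int_{-1}^1\!\int_{\mathbb T}\frac{L\kappa_*\,\mathbf T_*\cdot N}{|z-z_*|^{1+\alpha}}\,\xi_*\,\partial_\xi\Omega_*\,ds_*\,d\xi_*\;\partial_\xi\Omega\\ &+\frac{C_{1,\alpha}\,\delta^{-\alpha}}{L}\int_{-1}^1\frac{\nabla^\perp\Omega_*|_{s_*=s}\cdot\nabla\Omega}{|\xi-\xi_*|^{\alpha}}\,d\xi_* +\frac{C_{2,\alpha}}{L^{1+\alpha}}\int_{-1}^1\nabla^\perp\Omega_*|_{s_*=s}\cdot\nabla\Omega\,d\xi_*\\ &+\int_{-1}^1\!\int_{\mathbb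 T}\left(\frac{\mathbf T_*\cdot\mathbf T\;\nabla^\perp\Omega_*\cdot\nabla\Omega}{|z-z_*|^{1+\alpha}}-\frac{\nabla^\perp\Omega_*|_{s_*=s}\cdot\nabla\Omega}{L^{1+\alpha}\,|\sin(\pi(s-s_*))/\pi|^{1+\alpha}}\right)ds_*\,d\xi_*, \end{aligned}$$ where $$C_{1,\alpha}=\frac{\sqrt\pi\,\Gamma(\alpha/2)}{\Gamma((1+\alpha)/2)},\qquad C_{2,\alpha}=-\frac{2^{1+\alpha}}{\alpha}-\int_{-1/2}^{1/2}\Big(\frac1{|s|^{1+\alpha}}-\frac{\pi^{1+\alpha}}{|\sin(\pi s)|^{1+\alpha}}\Big)ds .$$ -/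

import Mathlib

open Set Filter Topology MeasureTheory
open scoped RealInnerProductSpace

namespace SingularSQG

/-- The Euclidean plane. -/
abbrev Plane : Type := EuclideanSpace ℝ (Fin 2)

/-- Counter-clockwise rotation by a right angle. -/
noncomputable def perp (v : Plane) : Plane := !₂[-v 1, v 0]

/-! ### The equation -/

/-- `Λ^{-1+α} f = K * f` with the kernel `K(x) = |x|^{-1-α}`. -/
noncomputable def rieszPotential (α : ℝ) (f : Plane → ℝ) (x : Plane) : ℝ :=
  ∫ y, f y / ‖x - y‖ ^ (1 + α)

/-- The velocity `u = ∇^⊥ Λ^{-1+α} f`. -/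
noncomputable def velocity (α : ℝ) (f : Plane → ℝ) (x : Plane) : Plane :=
  perp (gradient (rieszPotential α f) x)

/-- `θ = θ(x, t)` is a (classical) solution of `∂ₜθ + u · ∇θ = 0`, `u = ∇^⊥ Λ^{-1+α} θ`, on
`ℝ² × (0, T)`. -/
structure IsSolution (α T : ℝ) (θ : Plane → ℝ → ℝ) : Prop where
  contDiffOn : ContDiffOn ℝ 1 (fun p : Plane × ℝ => θ p.1 p.2) (univ ×ˢ Ioo 0 T)
  equation : ∀ t ∈ Ioo 0 T, ∀ x : Plane,
    deriv (fun t' => θ x t') t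
      + ⟪velocity α (fun y => θ y t) x, gradient (fun y => θ y t) x⟫ = 0

/-! ### Closed curves in uniform speed parameterisation -/

/-- Length of a closed curve; functions on `𝕋 = ℝ/ℤ` are `1`-periodic functions on `ℝ`. -/
noncomputable def length (z : ℝ → Plane) : ℝ := ∫ s in (0 : ℝ)..1, ‖deriv z s‖

/-- Unit tangent `T = z_s / L` of a uniform speed curve. -/
noncomputable def tangent (z : ℝ → Plane) (s : ℝ) : Plane := (length z)⁻¹ • deriv z s

/-- Unit normal `N = T^⊥`. -/
noncomputable def normal (z : ℝ → Plane) (s : ℝ) : Plane := perp (tangent z s)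

/-- Curvature `κ = L⁻³ z_ss · z_s^⊥`. -/
noncomputable def curvature (z : ℝ → Plane) (s : ℝ) : ℝ :=
  (length z ^ 3)⁻¹ * ⟪iteratedDeriv 2 z s, perp (deriv z s)⟫

/-- `z` is a simple closed `C²` curve in uniform speed parameterisation which bounds the bounded
simply connected region `A` and is positively oriented (`A` lies to its left, that is, `N` points
into `A`). -/
structure IsBoundaryCurve (z : ℝ → Plane) (A : Set Plane) : Prop where
  contDiff : ContDiff ℝ 2 z
  periodic : Function.Periodic z 1
  injOn : InjOn z (Ico 0 1)
  uniformSpeed : ∀ s, ‖deriv z s‖ = length z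
  isOpen : IsOpen A
  isBounded : Bornology.IsBounded A
  simplyConnected : SimplyConnectedSpace A
  frontier_eq : frontier A = range z
  oriented : ∀ s, ∀ᶠ r in 𝓝[>] (0 : ℝ), z s + r • normal z s ∈ A

/-! ### Almost-sharp fronts -/

/-- The transition region of half-width `w` around `∂A`. -/
def midRegion (A : Set Plane) (w : ℝ) : Set Plane := {x | Metric.infDist x (frontier A) ≤ w}

/-- The inner region. -/
def inRegion (A : Set Plane) (w : ℝ) : Set Plane := {x ∈ A | w < Metric.infDist x (frontier A)}

/-- The outer region. -/
def outRegion (A : Set Plane) (w : ℝ) : Set Plane := (inRegion A w ∪ midRegion A w)ᶜ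

/-- `θ` is the member of size `δ` of an almost-sharp front on the time interval `(0, T)`, and
`z(·, t)`, which bounds `A(t)`, is a compatible curve for it; `Cz` is the width constant of the
compatible curve and `C` the constant that has to be independent of `δ`. -/
structure IsAlmostSharpFront (α T C δ Cz : ℝ) (θ : Plane → ℝ → ℝ) (A : ℝ → Set Plane)
    (z : ℝ → ℝ → Plane) : Prop where
  solution : IsSolution α T θ
  curve : ∀ t ∈ Ioo 0 T, IsBoundaryCurve (fun s => z s t) (A t)
  width_pos : 0 < Cz
  width_lt : Cz < C
  contDiff : ∀ t ∈ Ioo 0 T, ContDiff ℝ 2 (fun x => θ x t)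
  eq_one : ∀ t ∈ Ioo 0 T, ∀ x ∈ inRegion (A t) (Cz * δ), θ x t = 1
  eq_zero : ∀ t ∈ Ioo 0 T, ∀ x ∈ outRegion (A t) (Cz * δ), θ x t = 0
  growth : ∀ t ∈ Ioo 0 T, ∀ x, ‖gradient (fun y => θ y t) x‖ ≤ C / δ

/-! ### Tubular neighbourhood coordinates -/

/-- `x(s, ξ) = z(s) + δ ξ N(s)`. -/
noncomputable def tubular (δ : ℝ) (z : ℝ → Plane) (s ξ : ℝ) : Plane :=
  z s + (δ * ξ) • normal z s

/-- `Ω(s, ξ, τ) = θ(x(s, ξ, τ), τ)`. -/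
noncomputable def inTubular (δ : ℝ) (θ : Plane → ℝ → ℝ) (z : ℝ → ℝ → Plane) (s ξ τ : ℝ) : ℝ :=
  θ (tubular δ (fun s' => z s' τ) s ξ) τ

/-- The rescaled sine `sin(π s) / π`. -/
noncomputable def rsin (s : ℝ) : ℝ := Real.sin (Real.pi * s) / Real.pi

/-- Regularity of the curve `z` and of the profile `Ω`, with explicit bounds: derivatives of `z` in
`s` up to order three, of `z` and `z_s` in time, and of `Ω` in `(s, ξ)` up to order two are bounded
by `M`, and `z` satisfies the chord-arc condition with constant `c`. -/
structure IsRegularFront (T M c : ℝ) (z : ℝ → ℝ → Plane) (Ω : ℝ → ℝ → ℝ → ℝ) : Prop where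
  curve_contDiff : ∀ t ∈ Ioo 0 T, ContDiff ℝ 3 (fun s => z s t)
  curve_bound : ∀ t ∈ Ioo 0 T, ∀ s, ∀ k ∈ Finset.Icc 1 3,
    ‖iteratedDeriv k (fun s' => z s' t) s‖ ≤ M
  chord_arc : ∀ t ∈ Ioo 0 T, ∀ s s', c * |rsin (s - s')| ≤ ‖z s t - z s' t‖
  curve_time : ContDiffOn ℝ 1 (fun p : ℝ × ℝ => z p.1 p.2) (univ ×ˢ Ioo 0 T)
  tangent_time :
    ContDiffOn ℝ 1 (fun p : ℝ × ℝ => deriv (fun s' => z s' p.2) p.1) (univ ×ˢ Ioo 0 T)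
  curve_time_bound : ∀ t ∈ Ioo 0 T, ∀ s, ‖deriv (fun t' => z s t') t‖ ≤ M
  tangent_time_bound : ∀ t ∈ Ioo 0 T, ∀ s,
    ‖deriv (fun t' => deriv (fun s' => z s' t') s) t‖ ≤ M
  profile_bound : ∀ t ∈ Ioo 0 T, ∀ s, ∀ ξ ∈ Icc (-1 : ℝ) 1, ∀ k ∈ Finset.Icc 1 2,
    ‖iteratedFDeriv ℝ k (fun p : ℝ × ℝ => Ω p.1 p.2 t) (s, ξ)‖ ≤ M

/-! ### The sharp front equation and the approximate equation -/

/-- `𝓘(z)(s) = ∫_𝕋 K(z - z_*) (∂ₛz_* - ∂ₛz) ds_*`; the sharp front equation is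
`∂ₜz · N = -𝓘(z) · N`. -/
noncomputable def frontOperator (α : ℝ) (z : ℝ → Plane) (s : ℝ) : Plane :=
  ∫ s' in (-(1 / 2) : ℝ)..(1 / 2), (‖z s - z s'‖ ^ (1 + α))⁻¹ • (deriv z s' - deriv z s)

/-- `C_{1,α} = √π Γ(α/2) / Γ((α+1)/2)`. -/
noncomputable def constOne (α : ℝ) : ℝ :=
  Real.sqrt Real.pi * Real.Gamma (α / 2) / Real.Gamma ((α + 1) / 2)

/-- `b_α = ∫_{-1/2}^{1/2} (|s|^{-1-α} - |sin(πs)/π|^{-1-α}) ds`. -/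
noncomputable def constB (α : ℝ) : ℝ :=
  ∫ s in (-(1 / 2) : ℝ)..(1 / 2), (1 / |s| ^ (1 + α) - 1 / |rsin s| ^ (1 + α))

/-- `C_{2,α} = -(2^{1+α}/α + b_α)`. -/
noncomputable def constTwo (α : ℝ) : ℝ := -(α⁻¹ * 2 ^ (1 + α) + constB α)

/-- `∂ₛ f` for `f = f(s, ξ)`. -/
noncomputable def dS (f : ℝ → ℝ → ℝ) (s ξ : ℝ) : ℝ := deriv (fun s' => f s' ξ) s

/-- `∂_ξ f` for `f = f(s, ξ)`. -/
noncomputable def dXi (f : ℝ → ℝ → ℝ) (s ξ : ℝ) : ℝ := deriv (fun ξ' => f s ξ') ξ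

/-- `∇^⊥ f(s', ξ') · ∇ f(s, ξ)` with `∇ = (∂ₛ, ∂_ξ)`, `∇^⊥ = (-∂_ξ, ∂ₛ)`. -/
noncomputable def gradPerpDotGrad (f : ℝ → ℝ → ℝ) (s' ξ' s ξ : ℝ) : ℝ :=
  -dXi f s' ξ' * dS f s ξ + dS f s' ξ' * dXi f s ξ

/-- The spatial part of the approximate equation, at a fixed time, for the curve `z`, its velocity
`v = ∂_τ z` and the profile `f = Ω(·, ·, τ)`. -/
noncomputable def approxOperator (α δ : ℝ) (z v : ℝ → Plane) (f : ℝ → ℝ → ℝ) (s ξ : ℝ) : ℝ :=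
  - ⟪v s, tangent z s⟫ / length z * dS f s ξ
  + (1 + α) * length z *
      (∫ ξ' in (-1 : ℝ)..1, ∫ s' in (-(1 / 2) : ℝ)..(1 / 2),
        ⟪tangent z s', normal z s⟫ / ‖z s - z s'‖ ^ (3 + α)
          * ⟪z s - z s', ξ • normal z s - ξ' • normal z s'⟫ * dXi f s' ξ') * dXi f s ξ
  + (∫ ξ' in (-1 : ℝ)..1, ∫ s' in (-(1 / 2) : ℝ)..(1 / 2),
        length z * curvature z s' * ⟪tangent z s', normal z s⟫ / ‖z s - z s'‖ ^ (1 + α)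
          * ξ' * dXi f s' ξ') * dXi f s ξ
  + constOne α * δ ^ (-α) / length z *
      (∫ ξ' in (-1 : ℝ)..1, gradPerpDotGrad f s ξ' s ξ / |ξ - ξ'| ^ α)
  + constTwo α / length z ^ (1 + α) * (∫ ξ' in (-1 : ℝ)..1, gradPerpDotGrad f s ξ' s ξ)
  + ∫ ξ' in (-1 : ℝ)..1, ∫ s' in (-(1 / 2) : ℝ)..(1 / 2),
      (⟪tangent z s', tangent z s⟫ * gradPerpDotGrad f s' ξ' s ξ / ‖z s - z s'‖ ^ (1 + α)
        - gradPerpDotGrad f s ξ' s ξ / (length z ^ (1 + α) * |rsin (s - s')| ^ (1 + α)))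

end SingularSQG

open SingularSQG

namespace SingularSQG

/-! ### Rotation in the plane -/

/-! Write `a = (1+α)/2`, `X = ∂_ξ Ω`, `S = ∂_s Ω`, `h = s_* - s`, `η = ξ - ξ_*`, `J = 1 - δξκ`, `G =
∇^⊥Ω_*·∇Ω`, and let a subscript 0 mean that `s_*` is frozen at `s`. Differentiating `Ω` in time
along the moving coordinates and using the equation (`exists_deriv_inTubular_eq`) gives `∂_τ Ω` as
the pairing of `∇θ` with the velocity of the coordinate point minus `u`. In the frame `(T, N)` the
components of `∇θ` are `S/(LJ)` and `X/δ`. The normal component carries `δ⁻¹`, so the normal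
velocity must be known up to `o(δ)`; this is exactly what the front equation supplies. Hence, up to
`o(1)`, `∂_τ Ω - (z_τ·T/L) S` equals `-(𝓘(z)·N + u·N) X/δ - (u·T) S/(LJ)`.

Both pieces are integrals over the box in `(ξ_*, h)`. For `u`, the derivative in the convolution is
put on `θ` (`inner_gradient_rieszPotential`); `∇θ` lives in the strip, and the change to tubular
coordinates has Jacobian `δLJ_*` (`integral_eq_integral_tubular`, `inner_velocity_normal`,
`inner_velocity_tangent`). For `𝓘(z)`, the identity `∫ ∂_ξ Ω dξ = 1` inserts an integral in `ξ_*`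
(`inner_frontOperator_normal`). Adding the three double integrals of the approximate equation yields
one integrand, `combined`.

With `K_x = |x-x_*|^{-2a}` and `K_z = |z-z_*|^{-2a}`, the terms of `combined` pair up. The term in
`δ⁻¹` contains `K_x - K_z`, whose expansion to first order in the mixed scalar product is cancelled
by the stretching integrand; the `δκ_*` part of the Jacobian is cancelled by the curvature
integrand; the terms in `G` form `K_z - K_x`. What remains is modelled on the straight line: `K_x -
K_z` is replaced by `D₀ = (L²h²+δ²η²)^{-a} - (L²h²)^{-a}`. This gives `leading`, namely `-G₀ D₀ - G₀
(L sin(πh)/π)^{-2a}` (with absolute value of the sine) plus a multiple of the odd function `h D₀`.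
The error is bounded pointwise by `weight`, that is `δ^{1-a}|h|^{-a}|η|^{-a}`, which is integrable
because `a < 1` and tends to zero with `δ` (`abs_combined_sub_leading_le`).

Finally `leading` is integrated in `h` for fixed `ξ_*` (`abs_slice_le`). The odd term vanishes. The
flat kernel integrates over the whole line to a Gamma quotient times `L⁻¹(δ|η|)^{-α}`, which is the
`C_{1,α}` term; the missing tails together with the difference between `|h|` and the rescaled sine
give `C_{2,α}`. So `combined` cancels the two local terms of the equation up to a constant times
`δ^{1-a}` (`abs_approxOperator_sub_le`). All constants depend only on `α` and on one bound `B` for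
the geometry and the profile, so the result is uniform. -/

theorem inner_plane (v w : Plane) : ⟪v, w⟫ = v 0 * w 0 + v 1 * w 1 := by
  simp [PiLp.inner_apply, Fin.sum_univ_two, mul_comm]

@[simp] theorem perp_apply_zero (v : Plane) : perp v 0 = -v 1 := by simp [perp]

@[simp] theorem perp_apply_one (v : Plane) : perp v 1 = v 0 := by simp [perp]

theorem plane_ext {v w : Plane} (h0 : v 0 = w 0) (h1 : v 1 = w 1) : v = w := by
  ext i; fin_cases i <;> assumption

/-- The rotation `perp` as a continuous linear map. -/
noncomputable def perpL : Plane →L[ℝ] Plane :=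
  LinearMap.toContinuousLinearMap
    { toFun := perp
      map_add' := fun v w => plane_ext (by simp; ring) (by simp)
      map_smul' := fun c v => plane_ext (by simp) (by simp) }

theorem perpL_apply (v : Plane) : perpL v = perp v := rfl

theorem perp_smul (r : ℝ) (v : Plane) : perp (r • v) = r • perp v := perpL.map_smul r v

theorem perp_sub (v w : Plane) : perp (v - w) = perp v - perp w := perpL.map_sub v w

theorem perp_perp (v : Plane) : perp (perp v) = -v := plane_ext (by simp) (by simp)

theorem inner_perp_perp (v w : Plane) : ⟪perp v, perp w⟫ = ⟪v, w⟫ := by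
  simp [inner_plane]; ring

theorem inner_perp_left (v w : Plane) : ⟪perp v, w⟫ = -⟪v, perp w⟫ := by
  simp [inner_plane]

theorem inner_perp_self (v : Plane) : ⟪v, perp v⟫ = 0 := by
  simp [inner_plane]; ring

theorem norm_perp (v : Plane) : ‖perp v‖ = ‖v‖ := by
  rw [@norm_eq_sqrt_real_inner _ _ _ (perp v), inner_perp_perp, ← norm_eq_sqrt_real_inner]

theorem eq_inner_smul_add_inner_smul {e : Plane} (he : ‖e‖ = 1) (v : Plane) :
    v = ⟪v, e⟫ • e + ⟪v, perp e⟫ • perp e := by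
  have h : e 0 * e 0 + e 1 * e 1 = 1 := by
    rw [← inner_plane, real_inner_self_eq_norm_sq, he]; norm_num
  apply plane_ext
  · simp [inner_plane]; linear_combination (-v 0) * h
  · simp [inner_plane]; linear_combination (-v 1) * h

theorem inner_eq_frame {e : Plane} (he : ‖e‖ = 1) (v w : Plane) :
    ⟪v, w⟫ = ⟪v, e⟫ * ⟪w, e⟫ + ⟪v, perp e⟫ * ⟪w, perp e⟫ := by
  conv_lhs => rw [eq_inner_smul_add_inner_smul he w]
  rw [inner_add_right, inner_smul_right, inner_smul_right]; ring

/-! ### Growth estimates by integration of derivatives -/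

/-- Mean value inequality on the segment from `0` to `h`. Each application gains one power of `|h|`;
iterating it yields the Taylor bounds for the curve below. -/
theorem norm_le_of_hasDerivAt_le {E : Type*} [NormedAddCommGroup E] [NormedSpace ℝ E]
    {g g' : ℝ → E} (hg : ∀ h, HasDerivAt g (g' h) h) (h0 : g 0 = 0) (n : ℕ) {C : ℝ}
    (hC : 0 ≤ C) (hb : ∀ h, ‖g' h‖ ≤ C * |h| ^ n) (h : ℝ) : ‖g h‖ ≤ C * |h| ^ (n + 1) := by
  have := (convex_uIcc (0 : ℝ) h).norm_image_sub_le_of_norm_hasDerivWithin_le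
    (f := g) (f' := g') (C := C * |h| ^ n) (fun x _ => (hg x).hasDerivWithinAt) (fun x hx => by
      refine (hb x).trans ?_
      have : |x| ≤ |h| := by
        have := abs_sub_left_of_mem_uIcc hx
        simpa using this
      gcongr) left_mem_uIcc right_mem_uIcc
  simpa [h0, pow_succ, mul_assoc] using this

/-! ### Curves with quantitative bounds -/

/-- A closed `C³` curve of constant speed all of whose geometric quantities are controlled by the
single constant `B`. -/
structure CurveBounds (B : ℝ) (z : ℝ → Plane) : Prop where
  one_le : 1 ≤ B
  contDiff : ContDiff ℝ 3 z
  periodic : Function.Periodic z 1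
  speed : ∀ s, ‖deriv z s‖ = length z
  le_length : B⁻¹ ≤ length z
  bound_one : ∀ s, ‖deriv z s‖ ≤ B
  bound_two : ∀ s, ‖iteratedDeriv 2 z s‖ ≤ B
  bound_three : ∀ s, ‖iteratedDeriv 3 z s‖ ≤ B
  chord : ∀ s h, |h| ≤ 1 / 2 → B⁻¹ * |h| ≤ ‖z s - z (s + h)‖

namespace CurveBounds

variable {B : ℝ} {z : ℝ → Plane} (hz : CurveBounds B z)
include hz

theorem pos : 0 < B := lt_of_lt_of_le one_pos hz.one_le

theorem length_pos : 0 < length z := lt_of_lt_of_le (inv_pos.2 hz.pos) hz.le_length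

theorem length_le : length z ≤ B := hz.speed 0 ▸ hz.bound_one 0

theorem inv_length_le : (length z)⁻¹ ≤ B := inv_le_of_inv_le₀ hz.pos hz.le_length

theorem hasDerivAt_one (s : ℝ) : HasDerivAt z (deriv z s) s :=
  ((hz.contDiff.differentiable (by norm_num)) s).hasDerivAt

theorem hasDerivAt_two (s : ℝ) : HasDerivAt (deriv z) (iteratedDeriv 2 z s) s := by
  have h := (hz.contDiff.differentiable_iteratedDeriv 1 (by norm_num)) s
  rw [iteratedDeriv_succ (n := 1)]
  simpa [iteratedDeriv_one] using h.hasDerivAt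

theorem hasDerivAt_three (s : ℝ) :
    HasDerivAt (iteratedDeriv 2 z) (iteratedDeriv 3 z s) s := by
  have h := (hz.contDiff.differentiable_iteratedDeriv 2 (by norm_num)) s
  rw [iteratedDeriv_succ (n := 2)]
  exact h.hasDerivAt

theorem contDiff_deriv : ContDiff ℝ 2 (deriv z) :=
  ((contDiff_succ_iff_deriv (n := 2)).1 (by have := hz.contDiff; norm_num; exact this)).2.2

theorem contDiff_tangent : ContDiff ℝ 2 (tangent z) :=
  (contDiff_const (c := (length z)⁻¹)).smul hz.contDiff_deriv

theorem contDiff_normal : ContDiff ℝ 2 (normal z) :=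
  perpL.contDiff.comp hz.contDiff_tangent

theorem continuous_tangent : Continuous (tangent z) := hz.contDiff_tangent.continuous

theorem continuous_normal : Continuous (normal z) := hz.contDiff_normal.continuous

theorem continuous_curve : Continuous z := hz.contDiff.continuous

theorem continuous_curvature : Continuous (curvature z) := by
  have h2 : Continuous (iteratedDeriv 2 z) :=
    hz.contDiff.continuous_iteratedDeriv 2 (by norm_num)
  have h1 : Continuous fun s => perp (deriv z s) :=
    perpL.continuous.comp hz.contDiff_deriv.continuous
  exact continuous_const.mul (h2.inner h1)

theorem periodic_deriv : Function.Periodic (deriv z) 1 := fun s => by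
  have : (fun x => z (x + 1)) = z := funext hz.periodic
  rw [← deriv_comp_add_const, this]

theorem periodic_tangent : Function.Periodic (tangent z) 1 := fun s => by
  rw [tangent, tangent, hz.periodic_deriv s]

theorem periodic_normal : Function.Periodic (normal z) 1 := fun s => by
  rw [normal, normal, hz.periodic_tangent s]

theorem periodic_curvature : Function.Periodic (curvature z) 1 := fun s => by
  have : (fun x => deriv z (x + 1)) = deriv z := funext hz.periodic_deriv
  have h2 : iteratedDeriv 2 z (s + 1) = iteratedDeriv 2 z s := by
    rw [iteratedDeriv_succ (n := 1), iteratedDeriv_one, ← deriv_comp_add_const, this]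
  rw [curvature, curvature, hz.periodic_deriv s, h2]

theorem deriv_eq (s : ℝ) : deriv z s = length z • tangent z s := by
  rw [tangent, smul_smul, mul_inv_cancel₀ hz.length_pos.ne', one_smul]

theorem norm_tangent (s : ℝ) : ‖tangent z s‖ = 1 := by
  rw [tangent, norm_smul, hz.speed, Real.norm_of_nonneg (inv_nonneg.2 hz.length_pos.le),
    inv_mul_cancel₀ hz.length_pos.ne']

theorem norm_normal (s : ℝ) : ‖normal z s‖ = 1 := by
  rw [normal, norm_perp, hz.norm_tangent]

omit hz in
theorem inner_tangent_normal (s : ℝ) : ⟪tangent z s, normal z s⟫ = 0 := inner_perp_self _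

theorem inner_deriv_iteratedDeriv_two (s : ℝ) : ⟪deriv z s, iteratedDeriv 2 z s⟫ = 0 := by
  have h : HasDerivAt (fun s => ⟪deriv z s, deriv z s⟫)
      (⟪deriv z s, iteratedDeriv 2 z s⟫ + ⟪iteratedDeriv 2 z s, deriv z s⟫) s :=
    (hz.hasDerivAt_two s).inner ℝ (hz.hasDerivAt_two s)
  have hc : (fun s => ⟪deriv z s, deriv z s⟫) = fun _ => length z ^ 2 := by
    funext s; rw [real_inner_self_eq_norm_sq, hz.speed]
  rw [hc] at h
  have := h.unique (hasDerivAt_const s _)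
  rw [real_inner_comm (deriv z s)] at this
  linarith

/-- Constant speed makes `z_ss` orthogonal to `z_s`, so only the normal component survives. This is
the source of the Frenet formulas. -/
theorem iteratedDeriv_two_eq (s : ℝ) :
    iteratedDeriv 2 z s = (length z ^ 2 * curvature z s) • normal z s := by
  have hL := hz.length_pos.ne'
  have h0 := hz.inner_deriv_iteratedDeriv_two s
  have hp : perp (deriv z s) = length z • normal z s := by
    rw [hz.deriv_eq, perp_smul, normal]
  rw [hz.deriv_eq, inner_smul_left] at h0
  have h1 : ⟪iteratedDeriv 2 z s, tangent z s⟫ = 0 := by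
    rw [real_inner_comm]; simpa [hL] using h0
  have h2 : ⟪iteratedDeriv 2 z s, normal z s⟫ = length z ^ 2 * curvature z s := by
    rw [curvature, hp, inner_smul_right]; field_simp
  conv_lhs => rw [eq_inner_smul_add_inner_smul (hz.norm_tangent s) (iteratedDeriv 2 z s)]
  rw [h1, zero_smul, zero_add, ← normal, h2]

theorem hasDerivAt_tangent' (s : ℝ) :
    HasDerivAt (tangent z) ((length z)⁻¹ • iteratedDeriv 2 z s) s :=
  (hz.hasDerivAt_two s).const_smul (length z)⁻¹

theorem hasDerivAt_tangent (s : ℝ) :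
    HasDerivAt (tangent z) ((length z * curvature z s) • normal z s) s := by
  convert hz.hasDerivAt_tangent' s using 1
  rw [hz.iteratedDeriv_two_eq, smul_smul]
  congr 1
  field_simp [hz.length_pos.ne']

theorem hasDerivAt_normal (s : ℝ) :
    HasDerivAt (normal z) (-(length z * curvature z s) • tangent z s) s := by
  have h := perpL.hasFDerivAt.comp_hasDerivAt s (hz.hasDerivAt_tangent s)
  refine h.congr_deriv ?_
  rw [perpL_apply, perp_smul, normal, perp_perp, smul_neg, neg_smul]

theorem abs_length_mul_curvature_le (s : ℝ) : |length z * curvature z s| ≤ B ^ 2 := by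
  have h : ‖(length z)⁻¹ • iteratedDeriv 2 z s‖ = |length z * curvature z s| := by
    rw [(hz.hasDerivAt_tangent' s).unique (hz.hasDerivAt_tangent s), norm_smul, hz.norm_normal,
      mul_one, Real.norm_eq_abs]
  rw [← h, norm_smul, norm_inv, Real.norm_of_nonneg hz.length_pos.le, sq]
  exact mul_le_mul hz.inv_length_le (hz.bound_two s) (norm_nonneg _) hz.pos.le

theorem abs_curvature_le (s : ℝ) : |curvature z s| ≤ B ^ 3 := by
  have h := hz.abs_length_mul_curvature_le s
  rw [abs_mul, abs_of_pos hz.length_pos] at h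
  have h2 : |curvature z s| = (length z)⁻¹ * (length z * |curvature z s|) := by
    field_simp [hz.length_pos.ne']
  rw [h2, pow_succ, mul_comm (B ^ 2)]
  exact mul_le_mul hz.inv_length_le h (by positivity [hz.length_pos]) hz.pos.le

omit hz in
theorem hasDerivAt_comp_const_add {E : Type*} [NormedAddCommGroup E] [NormedSpace ℝ E]
    {g : ℝ → E} {g' : E} {s h : ℝ} (hg : HasDerivAt g g' (s + h)) :
    HasDerivAt (fun h => g (s + h)) g' h := by
  simpa using hg.comp_const_add s h

theorem norm_tangent_sub_le (s h : ℝ) : ‖tangent z (s + h) - tangent z s‖ ≤ B ^ 2 * |h| := by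
  have := norm_le_of_hasDerivAt_le (g := fun h => tangent z (s + h) - tangent z s)
    (fun h => (hasDerivAt_comp_const_add (hz.hasDerivAt_tangent (s + h))).sub_const _)
    (by simp) 0 (sq_nonneg B) (fun h => by
      rw [norm_smul, hz.norm_normal, mul_one, Real.norm_eq_abs, pow_zero, mul_one]
      exact hz.abs_length_mul_curvature_le _) h
  simpa using this

theorem norm_normal_sub_le (s h : ℝ) : ‖normal z (s + h) - normal z s‖ ≤ B ^ 2 * |h| := by
  rw [normal, normal, ← perp_sub, norm_perp]
  exact hz.norm_tangent_sub_le s h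

theorem abs_inner_tangent_normal_le (s h : ℝ) :
    |⟪tangent z (s + h), normal z s⟫| ≤ B ^ 2 * |h| := by
  have : ⟪tangent z (s + h), normal z s⟫ = ⟪tangent z (s + h) - tangent z s, normal z s⟫ := by
    rw [inner_sub_left, inner_tangent_normal, sub_zero]
  rw [this]
  refine (abs_real_inner_le_norm _ _).trans ?_
  rw [hz.norm_normal, mul_one]
  exact hz.norm_tangent_sub_le s h

/-- The derivative in `h` is `L⁻¹ z_ss(s+h)·N(s)`, which differs from its value `Lκ(s)` at `h = 0`
by `O(h)`. This is where the bound on `z_sss` enters. The linear part found here produces the odd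
term of `leading`. -/
theorem abs_inner_tangent_normal_sub_le (s h : ℝ) :
    |⟪tangent z (s + h), normal z s⟫ - length z * curvature z s * h| ≤ B ^ 2 * |h| ^ 2 := by
  have h2 (h : ℝ) : ‖iteratedDeriv 2 z (s + h) - iteratedDeriv 2 z s‖ ≤ B * |h| := by
    have := norm_le_of_hasDerivAt_le (g := fun h => iteratedDeriv 2 z (s + h) - iteratedDeriv 2 z s)
      (fun h => (hasDerivAt_comp_const_add (hz.hasDerivAt_three (s + h))).sub_const _)
      (by simp) 0 hz.pos.le (fun h => by simpa using hz.bound_three (s + h)) h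
    simpa using this
  have hk : length z * curvature z s = ⟪(length z)⁻¹ • iteratedDeriv 2 z s, normal z s⟫ := by
    rw [(hz.hasDerivAt_tangent' s).unique (hz.hasDerivAt_tangent s), inner_smul_left,
      real_inner_self_eq_norm_sq, hz.norm_normal]
    simp
  have key := norm_le_of_hasDerivAt_le
    (g := fun h => ⟪tangent z (s + h), normal z s⟫ - length z * curvature z s * h)
    (g' := fun h => ⟪(length z)⁻¹ • (iteratedDeriv 2 z (s + h) - iteratedDeriv 2 z s), normal z s⟫)
    (fun h => by
      have h1 := (hasDerivAt_comp_const_add (hz.hasDerivAt_tangent' (s + h))).inner ℝ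
        (hasDerivAt_const h (normal z s))
      have h3 := h1.sub ((hasDerivAt_id h).const_mul (length z * curvature z s))
      refine h3.congr_deriv ?_
      rw [hk, smul_sub, inner_sub_left]
      simp)
    (by simp [inner_tangent_normal]) 1 (sq_nonneg B) (fun h => by
      refine (abs_real_inner_le_norm _ _).trans ?_
      rw [hz.norm_normal, mul_one, norm_smul, norm_inv, Real.norm_of_nonneg hz.length_pos.le,
        pow_one, sq, mul_assoc]
      exact mul_le_mul hz.inv_length_le (h2 h) (norm_nonneg _) hz.pos.le) h
  simpa using key

theorem abs_inner_sub_normal_le (s h : ℝ) :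
    |⟪z (s + h) - z s, normal z s⟫| ≤ B ^ 3 * |h| ^ 2 := by
  have key := norm_le_of_hasDerivAt_le
    (g := fun h => ⟪z (s + h) - z s, normal z s⟫)
    (g' := fun h => length z * ⟪tangent z (s + h), normal z s⟫)
    (fun h => by
      have h1 := ((hasDerivAt_comp_const_add (hz.hasDerivAt_one (s + h))).sub_const (z s)).inner ℝ
        (hasDerivAt_const h (normal z s))
      refine h1.congr_deriv ?_
      rw [hz.deriv_eq, inner_smul_left]; simp)
    (by simp) 1 (pow_nonneg hz.pos.le 3) (fun h => by
      rw [norm_mul, Real.norm_of_nonneg hz.length_pos.le, pow_one, pow_succ', mul_assoc]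
      exact mul_le_mul hz.length_le (hz.abs_inner_tangent_normal_le s h) (norm_nonneg _)
        hz.pos.le) h
  simpa using key

theorem abs_inner_sub_normal_le' (s h : ℝ) :
    |⟪z (s + h) - z s, normal z (s + h)⟫| ≤ B ^ 3 * |h| ^ 2 := by
  have := hz.abs_inner_sub_normal_le (s + h) (-h)
  rw [add_neg_cancel_right, abs_neg, ← neg_sub, inner_neg_left, abs_neg] at this
  exact this

/-- The error is of fourth order because the arc has constant speed. Half of the derivative is
`(z(s+h)-z(s))·z_s(s+h) - L²h`. Its derivative is `(z(s+h)-z(s))·z_ss(s+h)`, which is `O(h²)` since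
`z_ss` is normal and the chord is almost tangential. -/
theorem abs_norm_sub_sq_sub_le (s h : ℝ) :
    |‖z (s + h) - z s‖ ^ 2 - length z ^ 2 * h ^ 2| ≤ 2 * B ^ 4 * |h| ^ 4 := by
  have hψ := norm_le_of_hasDerivAt_le
    (g := fun h => ⟪z (s + h) - z s, deriv z (s + h)⟫ - length z ^ 2 * h)
    (g' := fun h => ⟪z (s + h) - z s, iteratedDeriv 2 z (s + h)⟫)
    (fun h => by
      have h1 := ((hasDerivAt_comp_const_add (hz.hasDerivAt_one (s + h))).sub_const (z s)).inner ℝ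
        (hasDerivAt_comp_const_add (hz.hasDerivAt_two (s + h)))
      refine (h1.sub ((hasDerivAt_id h).const_mul (length z ^ 2))).congr_deriv ?_
      rw [real_inner_self_eq_norm_sq, hz.speed]; ring)
    (by simp) 2 (pow_nonneg hz.pos.le 4) (fun h => by
      rw [hz.iteratedDeriv_two_eq, inner_smul_right, norm_mul]
      have h1 : ‖length z ^ 2 * curvature z (s + h)‖ ≤ B := by
        have := hz.bound_two (s + h)
        rwa [hz.iteratedDeriv_two_eq, norm_smul, hz.norm_normal, mul_one] at this
      rw [pow_succ' B, mul_assoc]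
      exact mul_le_mul h1 (hz.abs_inner_sub_normal_le' s h) (norm_nonneg _) hz.pos.le)
  have hφ := norm_le_of_hasDerivAt_le
    (g := fun h => ‖z (s + h) - z s‖ ^ 2 - length z ^ 2 * h ^ 2)
    (g' := fun h => 2 * (⟪z (s + h) - z s, deriv z (s + h)⟫ - length z ^ 2 * h))
    (fun h => by
      have h1 := ((hasDerivAt_comp_const_add (hz.hasDerivAt_one (s + h))).sub_const (z s)).norm_sq
      refine (h1.sub (((hasDerivAt_id h).pow 2).const_mul (length z ^ 2))).congr_deriv ?_
      simp; ring)
    (by simp) 3 (C := 2 * B ^ 4) (by positivity) (fun h => by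
      rw [norm_mul, mul_assoc]
      simpa using hψ h) h
  simpa using hφ

end CurveBounds

/-! ### Estimates for negative powers -/

theorem abs_rpow_neg_sub_le {b m x y : ℝ} (hb : 0 < b) (hm : 0 < m) (hx : m ≤ x) (hy : m ≤ y) :
    |x ^ (-b) - y ^ (-b)| ≤ b * m ^ (-b - 1) * |x - y| := by
  have := (convex_Ici m).norm_image_sub_le_of_norm_hasDerivWithin_le
    (f := fun t : ℝ => t ^ (-b)) (f' := fun t => -b * t ^ (-b - 1)) (C := b * m ^ (-b - 1))
    (fun t ht => (Real.hasDerivAt_rpow_const (Or.inl (hm.trans_le ht).ne')).hasDerivWithinAt)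
    (fun t ht => by
      rw [norm_mul, norm_neg, Real.norm_of_nonneg hb.le,
        Real.norm_of_nonneg (Real.rpow_nonneg (hm.trans_le ht).le _)]
      exact mul_le_mul_of_nonneg_left
        (Real.rpow_le_rpow_of_nonpos hm ht (by linarith)) hb.le) (x := y) (y := x) hy hx
  simpa using this

theorem rpow_neg_le_inv_pow {b m x : ℝ} {n : ℕ} (hm : 0 < m) (hm1 : m ≤ 1) (hb0 : 0 ≤ b)
    (hb : b ≤ n) (hx : m ≤ x) : x ^ (-b) ≤ (m⁻¹) ^ n := by
  calc x ^ (-b) ≤ m ^ (-b) := Real.rpow_le_rpow_of_nonpos hm hx (by linarith)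
    _ ≤ m ^ (-(n : ℝ)) := Real.rpow_le_rpow_of_exponent_ge hm hm1 (by linarith)
    _ = (m⁻¹) ^ n := by rw [Real.rpow_neg hm.le, Real.rpow_natCast, inv_pow]

section

variable {a m : ℝ} (ha0 : 0 < a) (ha1 : a < 1) (hm : 0 < m) (hm1 : m ≤ 1)
include ha0 ha1 hm hm1

theorem rpow_neg_le_inv {x : ℝ} (hx : m ≤ x) : x ^ (-a) ≤ m⁻¹ := by
  simpa using rpow_neg_le_inv_pow (n := 1) hm hm1 ha0.le (by simpa using ha1.le) hx

theorem rpow_neg_sub_one_le {x : ℝ} (hx : m ≤ x) : x ^ (-a - 1) ≤ (m⁻¹) ^ 2 := by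
  rw [show -a - 1 = -(a + 1) by ring]
  exact rpow_neg_le_inv_pow (n := 2) hm hm1 (by linarith) (by push_cast; linarith) hx

theorem abs_rpow_sub_le_mul {x y : ℝ} (hx : m ≤ x) (hy : m ≤ y) :
    |x ^ (-a) - y ^ (-a)| ≤ (m⁻¹) ^ 2 * |x - y| := by
  refine (abs_rpow_neg_sub_le ha0 hm hx hy).trans ?_
  gcongr
  calc a * m ^ (-a - 1) ≤ 1 * m ^ (-a - 1) := by gcongr
    _ ≤ _ := by rw [one_mul]; exact rpow_neg_sub_one_le ha0 ha1 hm hm1 le_rfl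

theorem abs_rpow_sub_one_sub_le_mul {x y : ℝ} (hx : m ≤ x) (hy : m ≤ y) :
    |x ^ (-a - 1) - y ^ (-a - 1)| ≤ 2 * (m⁻¹) ^ 3 * |x - y| := by
  have h := abs_rpow_neg_sub_le (b := a + 1) (by linarith) hm hx hy
  rw [show -(a + 1) = -a - 1 by ring] at h
  refine h.trans ?_
  gcongr
  · linarith
  · rw [show -a - 1 - 1 = -(a + 2) by ring]
    exact rpow_neg_le_inv_pow (n := 3) hm hm1 (by linarith) (by push_cast; linarith) le_rfl

theorem abs_rpow_sub_le_min {x y : ℝ} (hx : m ≤ x) (hy : m ≤ y) :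
    |x ^ (-a) - y ^ (-a)| ≤ (m⁻¹) ^ 2 * min 1 |x - y| := by
  rw [mul_min_of_nonneg _ _ (by positivity), mul_one]
  refine le_min ?_ (abs_rpow_sub_le_mul ha0 ha1 hm hm1 hx hy)
  have h1 : m⁻¹ ≤ (m⁻¹) ^ 2 := by
    rw [sq]; exact le_mul_of_one_le_left (by positivity) ((one_le_inv₀ hm).2 hm1)
  have := rpow_neg_le_inv ha0 ha1 hm hm1 hx
  have := rpow_neg_le_inv ha0 ha1 hm hm1 hy
  have := Real.rpow_nonneg (hm.le.trans hx) (-a)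
  have := Real.rpow_nonneg (hm.le.trans hy) (-a)
  rw [abs_le]; constructor <;> linarith

theorem abs_rpow_sub_one_sub_le_min {x y : ℝ} (hx : m ≤ x) (hy : m ≤ y) :
    |x ^ (-a - 1) - y ^ (-a - 1)| ≤ 2 * (m⁻¹) ^ 3 * min 1 |x - y| := by
  rw [mul_min_of_nonneg _ _ (by positivity), mul_one]
  refine le_min ?_ (abs_rpow_sub_one_sub_le_mul ha0 ha1 hm hm1 hx hy)
  have h1 : (m⁻¹) ^ 2 ≤ 2 * (m⁻¹) ^ 3 := by
    have h0 : 0 ≤ (m⁻¹) ^ 3 := by positivity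
    have := pow_le_pow_right₀ ((one_le_inv₀ hm).2 hm1) (show 2 ≤ 3 by norm_num)
    linarith
  have := rpow_neg_sub_one_le ha0 ha1 hm hm1 hx
  have := rpow_neg_sub_one_le ha0 ha1 hm hm1 hy
  have := Real.rpow_nonneg (hm.le.trans hx) (-a - 1)
  have := Real.rpow_nonneg (hm.le.trans hy) (-a - 1)
  rw [abs_le]; constructor <;> linarith

omit ha0 ha1 hm1 in
theorem hasDerivAt_rpow_neg {t : ℝ} (ht : m ≤ t) :
    HasDerivAt (fun t : ℝ => t ^ (-a)) (-a * t ^ (-a - 1)) t :=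
  Real.hasDerivAt_rpow_const (Or.inl (hm.trans_le ht).ne')

/-- Second order Taylor bound: after removal of the linear part at `x`, the derivative is a
difference of two values of `t^{-a-1}`, which is Lipschitz away from zero. -/
theorem abs_rpow_taylor_le {x y : ℝ} (hx : m ≤ x) (hy : m ≤ y) :
    |y ^ (-a) - x ^ (-a) + a * x ^ (-a - 1) * (y - x)| ≤ 2 * (m⁻¹) ^ 3 * |y - x| ^ 2 := by
  have := (convex_uIcc x y).norm_image_sub_le_of_norm_hasDerivWithin_le
    (f := fun t : ℝ => t ^ (-a) + a * x ^ (-a - 1) * t)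
    (f' := fun t => -a * t ^ (-a - 1) + a * x ^ (-a - 1) * 1) (C := 2 * (m⁻¹) ^ 3 * |y - x|)
    (fun t ht => ((hasDerivAt_rpow_neg hm
      ((le_min hx hy).trans (Set.mem_Icc.1 ht).1)).add
        ((hasDerivAt_id t).const_mul _)).hasDerivWithinAt)
    (fun t ht => by
      have h1 := abs_rpow_sub_one_sub_le_mul ha0 ha1 hm hm1 hx
        ((le_min hx hy).trans (Set.mem_Icc.1 ht).1)
      have h2 : |x - t| ≤ |y - x| := by
        rw [abs_sub_comm x t]
        exact abs_sub_left_of_mem_uIcc ht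
      rw [show -a * t ^ (-a - 1) + a * x ^ (-a - 1) * 1 =
        a * (x ^ (-a - 1) - t ^ (-a - 1)) by ring, norm_mul, Real.norm_of_nonneg ha0.le]
      calc a * ‖x ^ (-a - 1) - t ^ (-a - 1)‖ ≤ 1 * (2 * (m⁻¹) ^ 3 * |y - x|) := by
            refine mul_le_mul ha1.le (h1.trans ?_) (norm_nonneg _) zero_le_one
            gcongr
        _ = _ := one_mul _) left_mem_uIcc right_mem_uIcc
  rw [Real.norm_eq_abs, Real.norm_eq_abs] at this
  rw [sq, ← mul_assoc]
  convert this using 2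
  ring

/-- A mixed second difference is small in both variables: the derivative in the base point is itself
a difference over the increment `Y`. The factor `min 1 Y` keeps the bound useful for large `Y`,
which occurs when `|h|` is much smaller than `δ`. -/
theorem abs_rpow_mixed_le {x y Y : ℝ} (hx : m ≤ x) (hy : m ≤ y) (hY : 0 ≤ Y) :
    |((x + Y) ^ (-a) - x ^ (-a)) - ((y + Y) ^ (-a) - y ^ (-a))|
      ≤ 2 * (m⁻¹) ^ 3 * min 1 Y * |x - y| := by
  have := (convex_Ici m).norm_image_sub_le_of_norm_hasDerivWithin_le
    (f := fun t : ℝ => (t + Y) ^ (-a) - t ^ (-a))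
    (f' := fun t => -a * (t + Y) ^ (-a - 1) - -a * t ^ (-a - 1))
    (C := 2 * (m⁻¹) ^ 3 * min 1 Y)
    (fun t ht => (((hasDerivAt_rpow_neg hm
      (le_trans ht (le_add_of_nonneg_right hY))).comp_add_const t Y).sub
        (hasDerivAt_rpow_neg hm ht)).hasDerivWithinAt)
    (fun t ht => by
      have ht : m ≤ t := ht
      have h1 := abs_rpow_sub_one_sub_le_min ha0 ha1 hm hm1 ht
        (ht.trans (le_add_of_nonneg_right hY))
      rw [show t - (t + Y) = -Y by ring, abs_neg, abs_of_nonneg hY] at h1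
      rw [show -a * (t + Y) ^ (-a - 1) - -a * t ^ (-a - 1) =
        a * (t ^ (-a - 1) - (t + Y) ^ (-a - 1)) by ring, norm_mul, Real.norm_of_nonneg ha0.le]
      calc _ ≤ 1 * (2 * (m⁻¹) ^ 3 * min 1 Y) :=
            mul_le_mul ha1.le h1 (abs_nonneg _) zero_le_one
        _ = _ := one_mul _) (x := y) (y := x) hy hx
  exact this

end

/-! ### The weight controlling the error terms -/

/-- The weight `δ^{1-a} |h|^{-a} |η|^{-a}`. -/
noncomputable def weight (a δ h η : ℝ) : ℝ := δ ^ (1 - a) * |h| ^ (-a) * |η| ^ (-a)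

theorem weight_nonneg {a δ h η : ℝ} (hδ : 0 ≤ δ) : 0 ≤ weight a δ h η := by
  unfold weight; positivity

section

variable {a δ h η : ℝ} (ha0 : 1 / 2 < a) (ha1 : a < 1) (hδ : 0 < δ) (hδ1 : δ ≤ 1)
  (hh : 0 < |h|) (hh1 : |h| ≤ 1) (hη : 0 < |η|) (hη2 : |η| ≤ 2)
include ha0 ha1 hδ hδ1 hh hh1 hη hη2

omit hδ hδ1 hh hh1 in
theorem one_le_two_mul_rpow : 1 ≤ 2 * |η| ^ (-a) := by
  have h1 : (2 : ℝ) ^ (-a) ≤ |η| ^ (-a) := Real.rpow_le_rpow_of_nonpos hη hη2 (by linarith)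
  have h2 : (2 : ℝ) ^ (-1 : ℝ) ≤ 2 ^ (-a) :=
    Real.rpow_le_rpow_of_exponent_le (by norm_num) (by linarith)
  rw [Real.rpow_neg_one] at h2
  linarith

omit hδ1 hh1 in
theorem le_two_mul_weight : δ ^ (1 - a) * |h| ^ (-a) ≤ 2 * weight a δ h η := by
  have := one_le_two_mul_rpow ha0 ha1 hη hη2
  have h0 : 0 ≤ δ ^ (1 - a) * |h| ^ (-a) := by positivity
  unfold weight
  nlinarith

theorem mul_rpow_le_weight : δ * |h| ^ (1 - 2 * a) ≤ 2 * weight a δ h η := by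
  refine le_trans ?_ (le_two_mul_weight ha0 ha1 hδ hh hη hη2)
  refine mul_le_mul ?_ ?_ (by positivity) (by positivity)
  · simpa using Real.rpow_le_rpow_of_exponent_ge hδ hδ1 (show 1 - a ≤ 1 by linarith)
  · exact Real.rpow_le_rpow_of_exponent_ge hh hh1 (by linarith)

omit ha0 ha1 hδ1 hh1 hη hη2 in
-- Interpolation between the regimes `|h| < δ` and `|h| > δ`. With `p = 1 - a` or `p = 2 - a` it
-- trades singularity at `h = 0` for a positive power of `δ`.
theorem min_sq_le_rpow {p : ℝ} (hp0 : 0 ≤ p) (hp2 : p ≤ 2) :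
    min 1 ((δ / |h|) ^ 2) ≤ (δ / |h|) ^ p := by
  have hρ : 0 < δ / |h| := by positivity
  rcases le_total 1 (δ / |h|) with h1 | h1
  · exact (min_le_left _ _).trans (Real.one_le_rpow h1 hp0)
  · refine (min_le_right _ _).trans ?_
    rw [← Real.rpow_natCast]
    exact Real.rpow_le_rpow_of_exponent_ge hρ h1 (by simpa using hp2)

omit hδ1 hh1 in
theorem min_mul_rpow_le_weight :
    min 1 ((δ / |h|) ^ 2) * |h| ^ (1 - 2 * a) ≤ 2 * weight a δ h η := by
  refine le_trans ?_ (le_two_mul_weight ha0 ha1 hδ hh hη hη2)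
  refine (mul_le_mul_of_nonneg_right (min_sq_le_rpow hδ hh
    (p := 1 - a) (by linarith) (by linarith)) (by positivity)).trans_eq ?_
  rw [Real.div_rpow hδ.le hh.le, div_mul_eq_mul_div, mul_div_assoc, ← Real.rpow_sub hh]
  congr 2; ring

omit hδ1 hh1 in
theorem min_mul_rpow_le_mul_weight :
    min 1 ((δ / |h|) ^ 2) * |h| ^ (2 - 2 * a) ≤ 2 * (δ * weight a δ h η) := by
  have := mul_le_mul_of_nonneg_left (le_two_mul_weight ha0 ha1 hδ hh hη hη2) hδ.le
  refine le_trans ?_ (this.trans_eq (by ring))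
  refine (mul_le_mul_of_nonneg_right (min_sq_le_rpow hδ hh
    (p := 2 - a) (by linarith) (by linarith)) (by positivity)).trans_eq ?_
  rw [Real.div_rpow hδ.le hh.le, div_mul_eq_mul_div, mul_div_assoc, ← Real.rpow_sub hh,
    ← mul_assoc]
  congr 1
  · rw [show 2 - a = 1 + (1 - a) by ring, Real.rpow_add hδ, Real.rpow_one]
  · congr 1; ring

end

/-! ### Estimates for the kernels -/

/-- The relation between the squared distances `P = |z - z_*|²`, `Z = |x - x_*|²`, `Λ h² = L² h²`
and the mixed term `Q = 2δ (z - z_*) · (ξ N - ξ_* N_*)`. -/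
structure KernelData (a m B δ h η P Z Λ Q : ℝ) : Prop where
  ha0 : 1 / 2 < a
  ha1 : a < 1
  hm : 0 < m
  hm1 : m ≤ 1
  hB : 1 ≤ B
  hδ : 0 < δ
  hδ1 : δ ≤ 1
  hδB : 2 * B * δ ≤ m
  hh : 0 < |h|
  hh1 : |h| ≤ 1
  hη : 0 < |η|
  hη2 : |η| ≤ 2
  hP : 2 * m * h ^ 2 ≤ P
  hΛ : 2 * m ≤ Λ
  hPΛ : |P - Λ * h ^ 2| ≤ B * |h| ^ 4
  hQ : |Q| ≤ B * δ * |h| ^ 2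
  hZ : |Z - P - Q - δ ^ 2 * η ^ 2| ≤ B * δ ^ 2 * |h| ^ 2

namespace KernelData

variable {a m B δ h η P Z Λ Q : ℝ} (K : KernelData a m B δ h η P Z Λ Q)
include K

theorem sq_pos : 0 < h ^ 2 := by rw [← sq_abs]; exact pow_pos K.hh 2

omit K in
theorem mul_rpow_sq {x : ℝ} (hx : 0 ≤ x) : (h ^ 2 * x) ^ (-a) = |h| ^ (-(2 * a)) * x ^ (-a) := by
  rw [Real.mul_rpow (sq_nonneg h) hx, ← sq_abs, ← Real.rpow_natCast,
    ← Real.rpow_mul (abs_nonneg h)]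
  congr 2; push_cast; ring

theorem abs_mul_rpow : |h| * |h| ^ (-(2 * a)) = |h| ^ (1 - 2 * a) := by
  rw [sub_eq_add_neg, Real.rpow_add K.hh, Real.rpow_one]

theorem abs_sq_mul_rpow : |h| ^ 2 * |h| ^ (-(2 * a)) = |h| ^ (2 - 2 * a) := by
  rw [sub_eq_add_neg, Real.rpow_add K.hh]; norm_num

/-- The rescaled perturbations: `P = h² p`, `Z = h² (p + Y + e)`. -/
theorem exists_scaled : ∃ p Y e q : ℝ, P = h ^ 2 * p ∧ Z = h ^ 2 * (p + Y + e) ∧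
    Λ * h ^ 2 + δ ^ 2 * η ^ 2 = h ^ 2 * (Λ + Y) ∧ Q = h ^ 2 * (δ * q) ∧
    Y = (δ / |h|) ^ 2 * η ^ 2 ∧ 2 * m ≤ p ∧ |p - Λ| ≤ B * |h| ^ 2 ∧ |q| ≤ B ∧
    |e - δ * q| ≤ B * δ ^ 2 ∧ |e| ≤ 2 * B * δ ∧ |e| ≤ m := by
  have hh2 := K.sq_pos
  have hδ := K.hδ
  have hne : h ≠ 0 := by intro h0; simp [h0] at hh2
  have hq : |Q / (δ * h ^ 2)| ≤ B := by
    rw [abs_div, abs_of_pos (show 0 < δ * h ^ 2 by positivity), div_le_iff₀ (by positivity)]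
    have := K.hQ; rw [sq_abs] at this; linarith
  have he : |(Z - P - δ ^ 2 * η ^ 2) / h ^ 2 - δ * (Q / (δ * h ^ 2))| ≤ B * δ ^ 2 := by
    have h1 : (Z - P - δ ^ 2 * η ^ 2) / h ^ 2 - δ * (Q / (δ * h ^ 2))
        = (Z - P - Q - δ ^ 2 * η ^ 2) / h ^ 2 := by field_simp; ring
    rw [h1, abs_div, abs_of_pos hh2, div_le_iff₀ hh2]
    have := K.hZ; rwa [sq_abs] at this
  have he2 : |(Z - P - δ ^ 2 * η ^ 2) / h ^ 2| ≤ 2 * B * δ := by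
    have h1 : |δ * (Q / (δ * h ^ 2))| ≤ δ * B := by
      rw [abs_mul, abs_of_pos hδ]; gcongr
    have h2 : B * δ ^ 2 ≤ B * δ := by
      have := K.hB
      have := K.hδ1
      rw [sq]; nlinarith [mul_pos (lt_of_lt_of_le one_pos K.hB) hδ]
    have := abs_le.1 he
    have := abs_le.1 h1
    rw [abs_le]; constructor <;> linarith
  refine ⟨P / h ^ 2, (δ / |h|) ^ 2 * η ^ 2, (Z - P - δ ^ 2 * η ^ 2) / h ^ 2, Q / (δ * h ^ 2),
    by field_simp, ?_, ?_, by field_simp, rfl, ?_, ?_, hq, he, he2, he2.trans K.hδB⟩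
  · rw [div_pow, sq_abs]; field_simp; ring
  · rw [div_pow, sq_abs]; field_simp
  · rw [le_div_iff₀ hh2]; exact K.hP
  · have h1 : P / h ^ 2 - Λ = (P - Λ * h ^ 2) / h ^ 2 := by field_simp
    rw [h1, abs_div, abs_of_pos hh2, div_le_iff₀ hh2]
    have := K.hPΛ
    rwa [← sq_abs h, mul_assoc, ← pow_add, sq_abs]

theorem scale_sq_le : (δ / |h|) ^ 2 * η ^ 2 ≤ 4 * (δ / |h|) ^ 2 := by
  have h1 : η ^ 2 ≤ 4 := by rw [← sq_abs]; nlinarith [K.hη2, K.hη]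
  nlinarith [sq_nonneg (δ / |h|)]

omit K in
theorem min_le_four_mul {x : ℝ} {Y : ℝ} (hY : Y ≤ 4 * x) :
    min 1 Y ≤ 4 * min 1 x := by
  rcases le_total 1 x with h | h
  · rw [min_eq_left h]; linarith [min_le_left 1 Y]
  · rw [min_eq_right h]; exact (min_le_right _ _).trans hY

/-- Arithmetic-geometric mean: `m h² + δ²η²` dominates `m δ|h||η|`. Distributing the singularity
equally between `h` and `η` makes it integrable in both, and this dictates the form of `weight`. -/
theorem rpow_le_weight {Z' : ℝ} (hZ' : m * h ^ 2 + δ ^ 2 * η ^ 2 ≤ Z') :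
    δ * Z' ^ (-a) ≤ m⁻¹ * weight a δ h η := by
  have hm := K.hm
  have hδ := K.hδ
  have hh := K.hh
  have hη := K.hη
  have h1 : m * (δ * |h| * |η|) ≤ Z' := by
    refine le_trans ?_ hZ'
    rw [← sq_abs h, ← sq_abs η]
    have h2 : 0 ≤ m * (|h| - δ * |η|) ^ 2 := by positivity
    have h3 : 0 ≤ (1 - m) * (δ * |η|) ^ 2 := mul_nonneg (by linarith [K.hm1]) (sq_nonneg _)
    have h4 : 0 < m * (δ * |h| * |η|) := by positivity
    nlinarith
  have h2 : Z' ^ (-a) ≤ m⁻¹ * (δ ^ (-a) * |h| ^ (-a) * |η| ^ (-a)) := by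
    calc Z' ^ (-a) ≤ (m * (δ * |h| * |η|)) ^ (-a) :=
          Real.rpow_le_rpow_of_nonpos (by positivity) h1 (by linarith [K.ha0])
      _ = m ^ (-a) * (δ ^ (-a) * |h| ^ (-a) * |η| ^ (-a)) := by
          rw [Real.mul_rpow hm.le (by positivity), Real.mul_rpow (by positivity) hη.le,
            Real.mul_rpow hδ.le hh.le]
      _ ≤ _ := by
          gcongr
          exact rpow_neg_le_inv (by linarith [K.ha0]) K.ha1 hm K.hm1 le_rfl
  calc δ * Z' ^ (-a) ≤ δ * (m⁻¹ * (δ ^ (-a) * |h| ^ (-a) * |η| ^ (-a))) := by gcongr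
    _ = m⁻¹ * weight a δ h η := by
        rw [weight, sub_eq_add_neg, Real.rpow_add hδ, Real.rpow_one]; ring

theorem lower_bound : m * h ^ 2 + δ ^ 2 * η ^ 2 ≤ Z := by
  obtain ⟨p, Y, e, q, hP, hZ, h0, -, hY, hp, -, -, -, -, he⟩ := K.exists_scaled
  have h1 : δ ^ 2 * η ^ 2 = h ^ 2 * Y := by linarith
  rw [hZ, h1]
  have := (abs_le.1 he).1
  nlinarith [K.sq_pos]

theorem kernel_le : δ * Z ^ (-a) ≤ m⁻¹ * weight a δ h η := K.rpow_le_weight K.lower_bound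

/-- After division by `h²`, the two arguments differ by `Y = (δη/h)²` and an `O(δ)` perturbation.
The factor `|h|` lowers the singularity to `|h|^{1-2a}`, which leaves room for the interpolation in
`min_mul_rpow_le_weight`. -/
theorem abs_mul_kernel_sub_le :
    |h| * |Z ^ (-a) - P ^ (-a)| ≤ 20 * B * (m⁻¹) ^ 2 * weight a δ h η := by
  obtain ⟨p, Y, e, q, hP, hZ, h0, hQ, hY, hp, hpΛ, hq, -, he, hem⟩ := K.exists_scaled
  have hm := K.hm
  have hB := K.hB
  have hY0 : 0 ≤ Y := by rw [hY]; positivity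
  have he' := abs_le.1 hem
  rw [hP, hZ, mul_rpow_sq (by linarith), mul_rpow_sq (by linarith), ← mul_sub, abs_mul,
    abs_of_nonneg (Real.rpow_nonneg (abs_nonneg h) _), ← mul_assoc, K.abs_mul_rpow]
  have h1 : min 1 |p + Y + e - p| ≤ 2 * B * δ + 4 * min 1 ((δ / |h|) ^ 2) := by
    have h2 : min 1 Y ≤ 4 * min 1 ((δ / |h|) ^ 2) :=
      min_le_four_mul (hY ▸ K.scale_sq_le)
    have h3 : |p + Y + e - p| ≤ Y + 2 * B * δ := by
      rw [show p + Y + e - p = Y + e by ring]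
      exact (abs_add_le _ _).trans (by rw [abs_of_nonneg hY0]; linarith)
    have h4 : 0 ≤ 2 * B * δ := (abs_nonneg e).trans he
    rcases le_total 1 Y with h5 | h5
    · rw [min_eq_left h5] at h2
      linarith [min_le_left 1 |p + Y + e - p|]
    · rw [min_eq_right h5] at h2
      linarith [min_le_right 1 |p + Y + e - p|]
  have hk := abs_rpow_sub_le_min (by linarith [K.ha0]) K.ha1 hm K.hm1
    (show m ≤ p + Y + e by linarith) (show m ≤ p by linarith)
  have e1 := mul_rpow_le_weight K.ha0 K.ha1 K.hδ K.hδ1 K.hh K.hh1 K.hη K.hη2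
  have e2 := min_mul_rpow_le_weight K.ha0 K.ha1 K.hδ K.hh K.hη K.hη2
  have hw := weight_nonneg (a := a) (h := h) (η := η) K.hδ.le
  have hk0 : 0 ≤ |h| ^ (1 - 2 * a) := by positivity
  calc _ ≤ |h| ^ (1 - 2 * a) * ((m⁻¹) ^ 2 * (2 * B * δ + 4 * min 1 ((δ / |h|) ^ 2))) := by
        gcongr; exact hk.trans (by gcongr)
    _ = (m⁻¹) ^ 2 * (2 * B * (δ * |h| ^ (1 - 2 * a))
          + 4 * (min 1 ((δ / |h|) ^ 2) * |h| ^ (1 - 2 * a))) := by ring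
    _ ≤ (m⁻¹) ^ 2 * (2 * B * (2 * weight a δ h η) + 4 * (2 * weight a δ h η)) := by gcongr
    _ = (m⁻¹) ^ 2 * ((4 * B + 8) * weight a δ h η) := by ring
    _ ≤ (m⁻¹) ^ 2 * ((20 * B) * weight a δ h η) := by gcongr; linarith
    _ = _ := by ring

theorem sq_mul_flat_sub_le :
    |h| ^ 2 * |(Λ * h ^ 2 + δ ^ 2 * η ^ 2) ^ (-a) - (Λ * h ^ 2) ^ (-a)|
      ≤ 8 * (m⁻¹) ^ 2 * (δ * weight a δ h η) := by
  obtain ⟨p, Y, e, q, hP, hZ, h0, hQ, hY, hp, hpΛ, hq, -, he, hem⟩ := K.exists_scaled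
  have hm := K.hm
  have hΛ := K.hΛ
  have hY0 : 0 ≤ Y := by rw [hY]; positivity
  rw [h0, mul_comm Λ, mul_rpow_sq (by linarith), mul_rpow_sq (by linarith), ← mul_sub, abs_mul,
    abs_of_nonneg (Real.rpow_nonneg (abs_nonneg h) _), ← mul_assoc, K.abs_sq_mul_rpow]
  have hk := abs_rpow_sub_le_min (by linarith [K.ha0]) K.ha1 hm K.hm1
    (show m ≤ Λ + Y by linarith) (show m ≤ Λ by linarith)
  rw [add_sub_cancel_left, abs_of_nonneg hY0] at hk
  have h2 : min 1 Y ≤ 4 * min 1 ((δ / |h|) ^ 2) :=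
    min_le_four_mul (hY ▸ K.scale_sq_le)
  have e2 := min_mul_rpow_le_mul_weight K.ha0 K.ha1 K.hδ K.hh K.hη K.hη2
  calc _ ≤ |h| ^ (2 - 2 * a) * ((m⁻¹) ^ 2 * (4 * min 1 ((δ / |h|) ^ 2))) := by
        gcongr; exact hk.trans (by gcongr)
    _ = 4 * (m⁻¹) ^ 2 * (min 1 ((δ / |h|) ^ 2) * |h| ^ (2 - 2 * a)) := by ring
    _ ≤ 4 * (m⁻¹) ^ 2 * (2 * (δ * weight a δ h η)) := by gcongr
    _ = _ := by ring

/-- Curve and straight line share the increment `Y`, so the difference is a mixed second difference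
in `p - Λ = O(h²)` and `Y`, plus the effect of the perturbation `e`. No factor `|h|` is available
here, since this estimate multiplies the frozen `G₀`. -/
theorem abs_kernel_sub_sub_flat_le :
    |(Z ^ (-a) - P ^ (-a)) - ((Λ * h ^ 2 + δ ^ 2 * η ^ 2) ^ (-a) - (Λ * h ^ 2) ^ (-a))|
      ≤ 20 * B * (m⁻¹) ^ 3 * weight a δ h η := by
  obtain ⟨p, Y, e, q, hP, hZ, h0, hQ, hY, hp, hpΛ, hq, -, he, hem⟩ := K.exists_scaled
  have hm := K.hm
  have hB := K.hB
  have hδ := K.hδ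
  have hΛ := K.hΛ
  have hh := K.hh
  have ha0 := K.ha0
  have ha1 := K.ha1
  have hY0 : 0 ≤ Y := by rw [hY]; positivity
  have he' := abs_le.1 hem
  have hw := weight_nonneg (a := a) (h := h) (η := η) K.hδ.le
  have hmi := (one_le_inv₀ hm).2 K.hm1
  rw [h0, hP, hZ, mul_comm Λ, mul_rpow_sq (by linarith), mul_rpow_sq (by linarith),
    mul_rpow_sq (by linarith), mul_rpow_sq (by linarith), ← mul_sub, ← mul_sub, ← mul_sub,
    abs_mul, abs_of_nonneg (Real.rpow_nonneg (abs_nonneg h) _)]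
  -- The factor `(m+Y)^{-a}` is retained on purpose: a constant in its place would leave the
  -- non-integrable `δ|h|^{-2a}`, whereas `h²(m+Y) = m h² + δ²η²` can be fed to `rpow_le_weight`.
  have h1 : |(p + Y + e) ^ (-a) - (p + Y) ^ (-a)| ≤ 2 * B * δ * m⁻¹ * (m + Y) ^ (-a) := by
    have := abs_rpow_neg_sub_le (b := a) (m := m + Y) (x := p + Y + e) (y := p + Y)
      (by linarith) (by linarith) (by linarith) (by linarith)
    refine this.trans ?_
    have h3 : (m + Y) ^ (-a - 1) ≤ m⁻¹ * (m + Y) ^ (-a) := by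
      rw [Real.rpow_sub (by linarith), Real.rpow_one, div_eq_inv_mul]
      gcongr; linarith
    rw [show p + Y + e - (p + Y) = e by ring]
    calc a * (m + Y) ^ (-a - 1) * |e| ≤ 1 * (m⁻¹ * (m + Y) ^ (-a)) * (2 * B * δ) := by gcongr
      _ = _ := by ring
  have h2 := abs_rpow_mixed_le (a := a) (by linarith) ha1 hm K.hm1 (show m ≤ p by linarith)
    (show m ≤ Λ by linarith) hY0
  have h3 : |((p + Y + e) ^ (-a) - p ^ (-a)) - ((Λ + Y) ^ (-a) - Λ ^ (-a))|
      ≤ 2 * B * δ * m⁻¹ * (m + Y) ^ (-a)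
        + 2 * (m⁻¹) ^ 3 * (4 * min 1 ((δ / |h|) ^ 2)) * (B * |h| ^ 2) := by
    have : ((p + Y + e) ^ (-a) - p ^ (-a)) - ((Λ + Y) ^ (-a) - Λ ^ (-a))
        = ((p + Y + e) ^ (-a) - (p + Y) ^ (-a))
          + (((p + Y) ^ (-a) - p ^ (-a)) - ((Λ + Y) ^ (-a) - Λ ^ (-a))) := by ring
    rw [this]
    refine (abs_add_le _ _).trans (add_le_add h1 (h2.trans ?_))
    gcongr
    exact min_le_four_mul (hY ▸ K.scale_sq_le)
  have h4 : δ * (|h| ^ (-(2 * a)) * (m + Y) ^ (-a)) ≤ m⁻¹ * weight a δ h η := by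
    rw [← mul_rpow_sq (by linarith)]
    apply K.rpow_le_weight
    have : δ ^ 2 * η ^ 2 = h ^ 2 * Y := by linarith
    rw [this]; linarith
  have e2 := min_mul_rpow_le_weight ha0 ha1 hδ hh K.hη K.hη2
  have e3 : |h| ^ 2 * |h| ^ (-(2 * a)) ≤ |h| ^ (1 - 2 * a) := by
    rw [K.abs_sq_mul_rpow]
    exact Real.rpow_le_rpow_of_exponent_ge hh K.hh1 (by linarith)
  have hmin : 0 ≤ min 1 ((δ / |h|) ^ 2) := le_min zero_le_one (sq_nonneg _)
  calc _ ≤ |h| ^ (-(2 * a)) * (2 * B * δ * m⁻¹ * (m + Y) ^ (-a)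
        + 2 * (m⁻¹) ^ 3 * (4 * min 1 ((δ / |h|) ^ 2)) * (B * |h| ^ 2)) := by gcongr
    _ = 2 * B * m⁻¹ * (δ * (|h| ^ (-(2 * a)) * (m + Y) ^ (-a)))
        + 8 * B * (m⁻¹) ^ 3 * (min 1 ((δ / |h|) ^ 2) * (|h| ^ 2 * |h| ^ (-(2 * a)))) := by ring
    _ ≤ 2 * B * m⁻¹ * (m⁻¹ * weight a δ h η)
        + 8 * B * (m⁻¹) ^ 3 * (min 1 ((δ / |h|) ^ 2) * |h| ^ (1 - 2 * a)) := by gcongr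
    _ ≤ 2 * B * m⁻¹ * (m⁻¹ * weight a δ h η)
        + 8 * B * (m⁻¹) ^ 3 * (2 * weight a δ h η) := by gcongr
    _ = 2 * B * ((m⁻¹) ^ 2 * weight a δ h η) + 16 * B * ((m⁻¹) ^ 3 * weight a δ h η) := by ring
    _ ≤ 2 * B * ((m⁻¹) ^ 3 * weight a δ h η) + 16 * B * ((m⁻¹) ^ 3 * weight a δ h η) := by
        gcongr 2 * B * (?_ * _) + _
        exact pow_le_pow_right₀ hmi (by norm_num)
    _ ≤ _ := by
        have : 0 ≤ B * ((m⁻¹) ^ 3 * weight a δ h η) := by positivity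
        linarith

set_option maxHeartbeats 1000000 in
-- The refined form of the preceding estimate, with error `δ · weight`, needed where the kernel
-- difference is divided by `δ`. The first order effect of `Q` is removed explicitly. Since `2a =
-- 1+α`, the product `a P^{-a-1} Q` is `δ` times the scalar part of the stretching integrand.
theorem abs_mul_kernel_expansion_le :
    |h| * |(Z ^ (-a) - P ^ (-a)) + a * P ^ (-a - 1) * Q
        - ((Λ * h ^ 2 + δ ^ 2 * η ^ 2) ^ (-a) - (Λ * h ^ 2) ^ (-a))|
      ≤ 100 * B ^ 2 * (m⁻¹) ^ 3 * (δ * weight a δ h η) := by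
  obtain ⟨p, Y, e, q, hP, hZ, h0, hQ, hY, hp, hpΛ, hq, heq, he, hem⟩ := K.exists_scaled
  have hm := K.hm
  have hB := K.hB
  have hδ := K.hδ
  have hΛ := K.hΛ
  have hh := K.hh
  have ha0 := K.ha0
  have ha1 := K.ha1
  have ha0' : 0 < a := by linarith
  have hY0 : 0 ≤ Y := by rw [hY]; positivity
  have he' := abs_le.1 hem
  have hw := weight_nonneg (a := a) (h := h) (η := η) K.hδ.le
  have hmi := (one_le_inv₀ hm).2 K.hm1
  have hBB : B ≤ B ^ 2 := by rw [sq]; exact le_mul_of_one_le_left (by linarith) hB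
  have hP1 : P ^ (-a - 1) * Q = |h| ^ (-(2 * a)) * (p ^ (-a - 1) * (δ * q)) := by
    have hp0 : 0 < p := by linarith
    have hP0 : 0 < P := by rw [hP]; exact mul_pos K.sq_pos hp0
    rw [Real.rpow_sub hP0, Real.rpow_sub hp0, Real.rpow_one, Real.rpow_one]
    have h5 : P ^ (-a) = |h| ^ (-(2 * a)) * p ^ (-a) := by rw [hP, mul_rpow_sq hp0.le]
    rw [h5, hQ, hP]
    have h7 : h ≠ 0 := by have := K.sq_pos; rintro rfl; simp at this
    field_simp
  rw [mul_assoc a, hP1, h0, hP, hZ, mul_comm Λ, mul_rpow_sq (by linarith),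
    mul_rpow_sq (by linarith), mul_rpow_sq (by linarith), mul_rpow_sq (by linarith)]
  have h1 := abs_rpow_taylor_le ha0' ha1 hm K.hm1 (show m ≤ p + Y by linarith)
    (show m ≤ p + Y + e by linarith)
  rw [add_sub_cancel_left] at h1
  have h2 := abs_rpow_mixed_le ha0' ha1 hm K.hm1 (show m ≤ p by linarith)
    (show m ≤ Λ by linarith) hY0
  have h3 := abs_rpow_sub_one_sub_le_min ha0' ha1 hm K.hm1 (show m ≤ p + Y by linarith)
    (show m ≤ p by linarith)
  rw [add_sub_cancel_left, abs_of_nonneg hY0] at h3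
  have h4 := rpow_neg_sub_one_le ha0' ha1 hm K.hm1 (show m ≤ p + Y by linarith)
  have hx0 : 0 ≤ (p + Y) ^ (-a - 1) := Real.rpow_nonneg (by linarith) _
  set μ := min 1 ((δ / |h|) ^ 2) with hμ
  have hμ0 : 0 ≤ μ := le_min zero_le_one (sq_nonneg _)
  have hYμ : min 1 Y ≤ 4 * μ := min_le_four_mul (hY ▸ K.scale_sq_le)
  -- The `O(h²)` deviation of the arc from the line, times `min 1 Y`, counts as `δ²`; without this
  -- the mixed difference would not be of the required order.
  have hδ2 : |h| ^ 2 * μ ≤ δ ^ 2 := by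
    calc |h| ^ 2 * μ ≤ |h| ^ 2 * (δ / |h|) ^ 2 := by gcongr; exact min_le_right _ _
      _ = δ ^ 2 := by field_simp
  have b1 : 2 * (m⁻¹) ^ 3 * |e| ^ 2 ≤ (m⁻¹) ^ 3 * (8 * B ^ 2 * δ ^ 2) := by
    have : |e| ^ 2 ≤ (2 * B * δ) ^ 2 := by gcongr
    calc _ ≤ 2 * (m⁻¹) ^ 3 * (2 * B * δ) ^ 2 := by gcongr
      _ = _ := by ring
  have b2 : |a * (p + Y) ^ (-a - 1) * (e - δ * q)| ≤ (m⁻¹) ^ 3 * (B ^ 2 * δ ^ 2) := by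
    rw [abs_mul, abs_of_nonneg (by positivity)]
    have : (m⁻¹) ^ 2 ≤ (m⁻¹) ^ 3 := pow_le_pow_right₀ hmi (by norm_num)
    calc _ ≤ 1 * (m⁻¹) ^ 3 * (B * δ ^ 2) := by gcongr; exact h4.trans this
      _ ≤ 1 * (m⁻¹) ^ 3 * (B ^ 2 * δ ^ 2) := by gcongr
      _ = _ := by ring
  have b3 : |a * ((p + Y) ^ (-a - 1) - p ^ (-a - 1)) * (δ * q)|
      ≤ (m⁻¹) ^ 3 * (8 * B ^ 2 * (δ * μ)) := by
    rw [abs_mul, abs_mul, abs_of_pos ha0', abs_mul, abs_of_pos hδ]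
    calc _ ≤ 1 * (2 * (m⁻¹) ^ 3 * (4 * μ)) * (δ * B) := by gcongr; exact h3.trans (by gcongr)
      _ ≤ 1 * (2 * (m⁻¹) ^ 3 * (4 * μ)) * (δ * B ^ 2) := by gcongr
      _ = _ := by ring
  have b4 : 2 * (m⁻¹) ^ 3 * min 1 Y * |p - Λ| ≤ (m⁻¹) ^ 3 * (8 * B ^ 2 * δ ^ 2) := by
    calc _ ≤ 2 * (m⁻¹) ^ 3 * (4 * μ) * (B * |h| ^ 2) := by gcongr
      _ = (m⁻¹) ^ 3 * (8 * B * (|h| ^ 2 * μ)) := by ring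
      _ ≤ (m⁻¹) ^ 3 * (8 * B ^ 2 * δ ^ 2) := by gcongr
  have key : |((p + Y + e) ^ (-a) - p ^ (-a)) + a * (p ^ (-a - 1) * (δ * q))
      - ((Λ + Y) ^ (-a) - Λ ^ (-a))|
      ≤ (m⁻¹) ^ 3 * (17 * B ^ 2 * δ ^ 2 + 8 * B ^ 2 * (δ * μ)) := by
    -- Four errors: the Taylor remainder in `e` at `p+Y`, the mixed difference between curve and
    -- line, the replacement of `e` by its main part `δq`, and the move of the derivative from `p+Y`
    -- to `p`.
    have : ((p + Y + e) ^ (-a) - p ^ (-a)) + a * (p ^ (-a - 1) * (δ * q))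
        - ((Λ + Y) ^ (-a) - Λ ^ (-a))
        = ((p + Y + e) ^ (-a) - (p + Y) ^ (-a) + a * (p + Y) ^ (-a - 1) * e)
          + (((p + Y) ^ (-a) - p ^ (-a)) - ((Λ + Y) ^ (-a) - Λ ^ (-a)))
          - a * (p + Y) ^ (-a - 1) * (e - δ * q)
          - a * ((p + Y) ^ (-a - 1) - p ^ (-a - 1)) * (δ * q) := by ring
    rw [this]
    refine (abs_sub _ _).trans ?_
    have c1 := abs_sub ((p + Y + e) ^ (-a) - (p + Y) ^ (-a) + a * (p + Y) ^ (-a - 1) * e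
      + (((p + Y) ^ (-a) - p ^ (-a)) - ((Λ + Y) ^ (-a) - Λ ^ (-a))))
      (a * (p + Y) ^ (-a - 1) * (e - δ * q))
    have c2 := abs_add_le ((p + Y + e) ^ (-a) - (p + Y) ^ (-a) + a * (p + Y) ^ (-a - 1) * e)
      (((p + Y) ^ (-a) - p ^ (-a)) - ((Λ + Y) ^ (-a) - Λ ^ (-a)))
    linarith
  have e1 := mul_rpow_le_weight ha0 ha1 hδ K.hδ1 hh K.hh1 K.hη K.hη2
  have e2 := min_mul_rpow_le_weight ha0 ha1 hδ hh K.hη K.hη2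
  calc _ = |h| * |h| ^ (-(2 * a)) * |((p + Y + e) ^ (-a) - p ^ (-a))
        + a * (p ^ (-a - 1) * (δ * q)) - ((Λ + Y) ^ (-a) - Λ ^ (-a))| := by
        rw [mul_assoc]
        congr 1
        rw [← abs_of_nonneg (Real.rpow_nonneg (abs_nonneg h) (-(2 * a))), ← abs_mul,
          abs_of_nonneg (Real.rpow_nonneg (abs_nonneg h) (-(2 * a)))]
        congr 1; ring
    _ ≤ |h| ^ (1 - 2 * a) * ((m⁻¹) ^ 3 * (17 * B ^ 2 * δ ^ 2 + 8 * B ^ 2 * (δ * μ))) := by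
        rw [K.abs_mul_rpow]; gcongr
    _ = (m⁻¹) ^ 3 * B ^ 2 * δ * (17 * (δ * |h| ^ (1 - 2 * a))
          + 8 * (μ * |h| ^ (1 - 2 * a))) := by ring
    _ ≤ (m⁻¹) ^ 3 * B ^ 2 * δ * (17 * (2 * weight a δ h η) + 8 * (2 * weight a δ h η)) := by
        gcongr
    _ = 50 * ((m⁻¹) ^ 3 * B ^ 2 * δ * weight a δ h η) := by ring
    _ ≤ 100 * ((m⁻¹) ^ 3 * B ^ 2 * δ * weight a δ h η) := by gcongr; norm_num
    _ = _ := by ring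

end KernelData

/-! ### The integral of a flat kernel -/

theorem integrable_one_add_sq_rpow {a : ℝ} (ha : 1 / 2 < a) :
    Integrable fun σ : ℝ => (1 + σ ^ 2) ^ (-a) := by
  have := integrable_rpow_neg_one_add_norm_sq (E := ℝ) (μ := volume) (r := 2 * a)
    (by simp; linarith)
  simpa [neg_div] using this

/-- `Γ(a)(1+σ²)^{-a}` is the integral of `r^{a-1} e^{-(1+σ²)r}` over `r > 0`. Exchanging the
integrals turns the inner one into a Gaussian and leaves `√π Γ(a-1/2)`. -/
theorem integral_one_add_sq_rpow {a : ℝ} (ha : 1 / 2 < a) :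
    ∫ σ : ℝ, (1 + σ ^ 2) ^ (-a) = √Real.pi * Real.Gamma (a - 1 / 2) / Real.Gamma a := by
  have ha0 : 0 < a := by linarith
  have hΓ : 0 < Real.Gamma a := Real.Gamma_pos_of_pos ha0
  set F : ℝ → ℝ → ℝ := fun σ r => r ^ (a - 1) * Real.exp (-((1 + σ ^ 2) * r)) with hF
  have hσ (r : ℝ) : ∀ σ, F σ r = r ^ (a - 1) * Real.exp (-r) * Real.exp (-r * σ ^ 2) := by
    intro σ
    rw [hF, mul_assoc, ← Real.exp_add]; ring_nf
  have hin (r : ℝ) (hr : 0 < r) :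
      ∫ σ, F σ r = √Real.pi * (r ^ (a - 1 / 2 - 1) * Real.exp (-(1 * r))) := by
    simp_rw [hσ r]
    rw [integral_const_mul, integral_gaussian, Real.sqrt_div Real.pi_nonneg,
      show a - 1 / 2 - 1 = (a - 1) - 1 / 2 by ring, Real.rpow_sub hr (a - 1),
      ← Real.sqrt_eq_rpow, one_mul]
    ring
  have hmeas : AEStronglyMeasurable (Function.uncurry F)
      (volume.prod (volume.restrict (Ioi 0))) := by
    apply Measurable.aestronglyMeasurable
    simp only [hF, Function.uncurry_def]
    fun_prop
  have hint : Integrable (Function.uncurry F) (volume.prod (volume.restrict (Ioi 0))) := by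
    rw [integrable_prod_iff' hmeas]
    constructor
    · refine (ae_restrict_mem measurableSet_Ioi).mono fun r hr => ?_
      simp only [Function.uncurry_apply_pair, hσ r]
      exact (integrable_exp_neg_mul_sq hr).const_mul _
    · have h1 : IntegrableOn (fun r : ℝ => √Real.pi * (r ^ (a - 1 / 2 - 1) * Real.exp (-(1 * r))))
          (Ioi 0) := by
        have := Real.GammaIntegral_convergent (s := a - 1 / 2) (by linarith)
        refine (this.congr_fun (fun r _ => ?_) measurableSet_Ioi).const_mul _
        rw [one_mul, mul_comm]
      refine h1.congr ((ae_restrict_mem measurableSet_Ioi).mono fun r hr => ?_)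
      have hr : 0 < r := hr
      simp only [Function.uncurry_apply_pair]
      rw [← hin r hr]
      congr 1; funext σ
      rw [Real.norm_of_nonneg]
      simp only [hF]; positivity
  have hswap := integral_integral_swap hint
  have hleft : ∫ σ : ℝ, ∫ r in Ioi (0 : ℝ), F σ r = ∫ σ : ℝ, (1 + σ ^ 2) ^ (-a) * Real.Gamma a := by
    congr 1; funext σ
    have h1 : 0 < 1 + σ ^ 2 := by positivity
    simp only [hF]
    rw [Real.integral_rpow_mul_exp_neg_mul_Ioi ha0 h1, one_div, Real.inv_rpow h1.le,
      Real.rpow_neg h1.le]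
  have hright : ∫ r in Ioi (0 : ℝ), ∫ σ : ℝ, F σ r = √Real.pi * Real.Gamma (a - 1 / 2) := by
    rw [setIntegral_congr_fun measurableSet_Ioi (fun r hr => hin r hr), integral_const_mul,
      Real.integral_rpow_mul_exp_neg_mul_Ioi (by linarith) one_pos]
    simp
  rw [hleft, hright, integral_mul_const] at hswap
  rw [eq_div_iff hΓ.ne', hswap]

/-! ### Scaling and tails of the flat kernel -/

section

variable {a l ε : ℝ} (ha : 1 / 2 < a) (hl : 0 < l) (hε : 0 < ε)
include ha hl hε

omit ha hl in
theorem flat_kernel_eq (h : ℝ) :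
    (l ^ 2 * h ^ 2 + ε ^ 2) ^ (-a) = ε ^ (-(2 * a)) * (1 + (l / ε * h) ^ 2) ^ (-a) := by
  have h1 : l ^ 2 * h ^ 2 + ε ^ 2 = ε ^ 2 * (1 + (l / ε * h) ^ 2) := by field_simp; ring
  rw [h1, Real.mul_rpow (by positivity) (by positivity), ← Real.rpow_natCast,
    ← Real.rpow_mul hε.le]
  congr 2; push_cast; ring

theorem integrable_flat_kernel : Integrable fun h : ℝ => (l ^ 2 * h ^ 2 + ε ^ 2) ^ (-a) := by
  simp_rw [flat_kernel_eq hε]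
  exact ((integrable_one_add_sq_rpow ha).comp_mul_left' (by positivity)).const_mul _

/-- The scaling `σ = l h/ε` extracts `ε^{1-2a}`. For `a = (1+α)/2` and `ε = δ|η|` this is
`δ^{-α}|η|^{-α}` with the constant `C_{1,α}`. -/
theorem integral_flat_kernel : ∫ h : ℝ, (l ^ 2 * h ^ 2 + ε ^ 2) ^ (-a)
    = l⁻¹ * ε ^ (1 - 2 * a) * (√Real.pi * Real.Gamma (a - 1 / 2) / Real.Gamma a) := by
  simp_rw [flat_kernel_eq hε]
  rw [integral_const_mul, Measure.integral_comp_mul_left (fun x : ℝ => (1 + x ^ 2) ^ (-a)),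
    integral_one_add_sq_rpow ha, smul_eq_mul, abs_of_pos (by positivity),
    sub_eq_add_neg 1, Real.rpow_add hε, Real.rpow_one, inv_div]
  ring

/-- On the tail `ε` is a perturbation of order `ε²`, so the kernel may be replaced by the pure
power. Its integral is half of the term `2^{1+α}/α` in `C_{2,α}`. -/
theorem integral_Ioi_flat_kernel_sub_le (ha1 : a < 1) :
    |(∫ h in Ioi (1 / 2 : ℝ), (l ^ 2 * h ^ 2 + ε ^ 2) ^ (-a))
      - (l ^ (-(2 * a)) * (2 ^ (2 * a - 1) / (2 * a - 1)))|
      ≤ 8 * l ^ (-(2 * a) - 2) * ε ^ 2 := by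
  have hp : ∀ p : ℝ, 1 < p → IntegrableOn (fun h : ℝ => h ^ (-p)) (Ioi (1 / 2)) ∧
      ∫ h in Ioi (1 / 2 : ℝ), h ^ (-p) = 2 ^ (p - 1) / (p - 1) := by
    intro p hp
    refine ⟨integrableOn_Ioi_rpow_of_lt (by linarith) (by norm_num), ?_⟩
    rw [integral_Ioi_rpow_of_lt (by linarith) (by norm_num), one_div, Real.inv_rpow (by norm_num),
      ← Real.rpow_neg (by norm_num), show -(-p + 1) = p - 1 by ring,
      show -p + 1 = -(p - 1) by ring, neg_div_neg_eq]
  have h1 : ∀ h ∈ Ioi (1 / 2 : ℝ), l ^ (-(2 * a)) * h ^ (-(2 * a)) = (l ^ 2 * h ^ 2) ^ (-a) := by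
    intro h hh
    have hh : 0 < h := lt_trans (by norm_num) (mem_Ioi.1 hh)
    rw [← Real.mul_rpow hl.le hh.le, ← mul_pow, ← Real.rpow_natCast (l * h) 2,
      ← Real.rpow_mul (by positivity)]
    congr 1; push_cast; ring
  have e1 := (hp (2 * a) (by linarith)).2
  have e2 := (hp (2 * a + 2) (by linarith)).2
  have i1 := (hp (2 * a) (by linarith)).1.const_mul (l ^ (-(2 * a)))
  have i2 := (hp (2 * a + 2) (by linarith)).1.const_mul (l ^ (-(2 * a) - 2) * ε ^ 2)
  rw [← e1, ← integral_const_mul, ← integral_sub (integrable_flat_kernel ha hl hε).integrableOn i1]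
  have hb : ‖∫ h in Ioi (1 / 2 : ℝ), ((l ^ 2 * h ^ 2 + ε ^ 2) ^ (-a)
      - l ^ (-(2 * a)) * h ^ (-(2 * a)))‖
      ≤ ∫ h in Ioi (1 / 2 : ℝ), l ^ (-(2 * a) - 2) * ε ^ 2 * h ^ (-(2 * a + 2)) := by
    refine norm_integral_le_of_norm_le i2 ?_
    refine (ae_restrict_mem measurableSet_Ioi).mono fun h hh => ?_
    rw [h1 h hh, Real.norm_eq_abs]
    have hh : 0 < h := lt_trans (by norm_num) (mem_Ioi.1 hh)
    have hx : 0 < l ^ 2 * h ^ 2 := by positivity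
    refine (abs_rpow_neg_sub_le (b := a) (m := l ^ 2 * h ^ 2) (by linarith) hx
      (by nlinarith [sq_nonneg ε]) le_rfl).trans ?_
    rw [add_sub_cancel_left, abs_of_nonneg (sq_nonneg ε), Real.mul_rpow (by positivity)
      (by positivity), ← Real.rpow_natCast l 2, ← Real.rpow_mul hl.le, ← Real.rpow_natCast h 2,
      ← Real.rpow_mul hh.le]
    have q1 : ((2 : ℕ) : ℝ) * (-a - 1) = -(2 * a) - 2 := by push_cast; ring
    have q2 : -(2 * a) - 2 = -(2 * a + 2) := by ring
    rw [q1, q2]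
    have : 0 ≤ l ^ (-(2 * a + 2)) * h ^ (-(2 * a + 2)) := by positivity
    calc _ ≤ 1 * (l ^ (-(2 * a + 2)) * h ^ (-(2 * a + 2))) * ε ^ 2 := by gcongr
      _ = _ := by ring
  rw [Real.norm_eq_abs] at hb
  refine hb.trans ?_
  rw [integral_const_mul, e2]
  have h3 : (2 : ℝ) ^ (2 * a + 2 - 1) / (2 * a + 2 - 1) ≤ 8 := by
    have : (2 : ℝ) ^ (2 * a + 2 - 1) ≤ 2 ^ (3 : ℝ) :=
      Real.rpow_le_rpow_of_exponent_le (by norm_num) (by linarith)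
    rw [div_le_iff₀ (by linarith)]
    have h4 : (2 : ℝ) ^ (3 : ℝ) = 8 := by norm_num
    nlinarith
  calc _ ≤ l ^ (-(2 * a) - 2) * ε ^ 2 * 8 := by gcongr
    _ = _ := by ring

theorem abs_integral_flat_kernel_sub_le (ha1 : a < 1) :
    |(∫ h in (-(1 / 2) : ℝ)..(1 / 2), (l ^ 2 * h ^ 2 + ε ^ 2) ^ (-a))
      - (l⁻¹ * ε ^ (1 - 2 * a) * (√Real.pi * Real.Gamma (a - 1 / 2) / Real.Gamma a)
        - l ^ (-(2 * a)) * (2 ^ (2 * a) / (2 * a - 1)))|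
      ≤ 16 * l ^ (-(2 * a) - 2) * ε ^ 2 := by
  have hi := integrable_flat_kernel ha hl hε
  have htail := integral_Ioi_flat_kernel_sub_le ha hl hε ha1
  have hneg : ∫ h in Iic (-(1 / 2) : ℝ), (l ^ 2 * h ^ 2 + ε ^ 2) ^ (-a)
      = ∫ h in Ioi (1 / 2 : ℝ), (l ^ 2 * h ^ 2 + ε ^ 2) ^ (-a) := by
    have := integral_comp_neg_Ioi (1 / 2 : ℝ) (fun h => (l ^ 2 * h ^ 2 + ε ^ 2) ^ (-a))
    rw [← this]; simp
  have hsplit : (∫ h in (-(1 / 2) : ℝ)..(1 / 2), (l ^ 2 * h ^ 2 + ε ^ 2) ^ (-a))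
      = (∫ h : ℝ, (l ^ 2 * h ^ 2 + ε ^ 2) ^ (-a))
        - 2 * ∫ h in Ioi (1 / 2 : ℝ), (l ^ 2 * h ^ 2 + ε ^ 2) ^ (-a) := by
    have h1 := intervalIntegral.integral_Iic_sub_Iic (a := -(1 / 2 : ℝ)) (b := 1 / 2)
      hi.integrableOn hi.integrableOn
    have h2 := integral_add_compl (measurableSet_Iic (a := (1 / 2 : ℝ))) hi
    rw [compl_Iic] at h2
    rw [← h1, ← h2, hneg]; ring
  have h2 : (2 : ℝ) ^ (2 * a) = 2 * 2 ^ (2 * a - 1) := by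
    rw [Real.rpow_sub (by norm_num), Real.rpow_one]; ring
  rw [hsplit, integral_flat_kernel ha hl hε, h2]
  rw [abs_le] at htail ⊢
  have e : l ^ (-(2 * a)) * (2 * 2 ^ (2 * a - 1) / (2 * a - 1))
    = 2 * (l ^ (-(2 * a)) * (2 ^ (2 * a - 1) / (2 * a - 1))) := by ring
  rw [e]
  constructor <;> linarith

end

/-! ### The rescaled sine -/

theorem abs_rsin_le (h : ℝ) : |rsin h| ≤ |h| := by
  rw [rsin, abs_div, abs_of_pos Real.pi_pos, div_le_iff₀ Real.pi_pos]
  refine (Real.abs_sin_le_abs).trans ?_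
  rw [abs_mul, abs_of_pos Real.pi_pos, mul_comm]

theorem two_div_pi_mul_le_abs_rsin {h : ℝ} (hh : |h| ≤ 1 / 2) :
    2 / Real.pi * |h| ≤ |rsin h| := by
  have hpi := Real.pi_pos
  have h1 := Real.mul_abs_le_abs_sin (x := Real.pi * h) (by
    rw [abs_mul, abs_of_pos hpi]; nlinarith)
  rw [rsin, abs_div, abs_of_pos hpi, le_div_iff₀ hpi]
  rw [abs_mul, abs_of_pos hpi] at h1
  calc 2 / Real.pi * |h| * Real.pi = 2 / Real.pi * (Real.pi * |h|) := by ring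
    _ ≤ _ := h1

theorem rsin_neg (h : ℝ) : rsin (-h) = -rsin h := by
  simp [rsin, neg_div]

theorem continuous_rsin : Continuous rsin := by
  unfold rsin; fun_prop

theorem hasDerivAt_rsin (h : ℝ) : HasDerivAt rsin (Real.cos (Real.pi * h)) h := by
  have := ((Real.hasDerivAt_sin (Real.pi * h)).comp h
    ((hasDerivAt_id h).const_mul Real.pi)).div_const Real.pi
  refine this.congr_deriv ?_
  field_simp

theorem abs_rsin_sub_le (h : ℝ) : |rsin h - h| ≤ Real.pi ^ 2 / 2 * |h| ^ 3 := by
  refine norm_le_of_hasDerivAt_le (g := fun h => rsin h - h)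
    (fun h => (hasDerivAt_rsin h).sub (hasDerivAt_id h)) (by simp [rsin]) 2 (by positivity)
    (fun h => ?_) h
  have h1 := Real.one_sub_sq_div_two_le_cos (x := Real.pi * h)
  have h2 := Real.cos_le_one (Real.pi * h)
  rw [Real.norm_eq_abs, sq_abs, abs_le]
  constructor <;> nlinarith

theorem abs_rsin_sq_sub_le (h : ℝ) : |rsin h ^ 2 - h ^ 2| ≤ Real.pi ^ 2 * |h| ^ 4 := by
  rw [sq_sub_sq, abs_mul]
  have h1 : |rsin h + h| ≤ 2 * |h| := (abs_add_le _ _).trans (by linarith [abs_rsin_le h])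
  calc _ ≤ 2 * |h| * (Real.pi ^ 2 / 2 * |h| ^ 3) := by gcongr; exact abs_rsin_sub_le h
    _ = _ := by ring

/-! ### Distances in tubular coordinates -/

namespace CurveBounds

variable {B : ℝ} {z : ℝ → Plane} (hz : CurveBounds B z)
include hz

/-- Both normals are unit vectors, so `2 N·N_* = 2 - |N-N_*|²`. This isolates `(ξ-ξ')²`, the part
seen by the straight-line model. -/
theorem norm_smul_normal_sub_sq (s s' ξ ξ' : ℝ) :
    ‖ξ • normal z s - ξ' • normal z s'‖ ^ 2
      = (ξ - ξ') ^ 2 + ξ * ξ' * ‖normal z s - normal z s'‖ ^ 2 := by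
  rw [norm_sub_sq_real, norm_sub_sq_real, norm_smul, norm_smul, hz.norm_normal, hz.norm_normal,
    inner_smul_left, inner_smul_right, mul_one, mul_one, Real.norm_eq_abs, Real.norm_eq_abs,
    sq_abs, sq_abs]
  simp only [conj_trivial]
  ring

theorem norm_tubular_sub_sq (δ s s' ξ ξ' : ℝ) :
    ‖tubular δ z s ξ - tubular δ z s' ξ'‖ ^ 2
      = ‖z s - z s'‖ ^ 2 + 2 * δ * ⟪z s - z s', ξ • normal z s - ξ' • normal z s'⟫
        + δ ^ 2 * ((ξ - ξ') ^ 2 + ξ * ξ' * ‖normal z s - normal z s'‖ ^ 2) := by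
  have : tubular δ z s ξ - tubular δ z s' ξ'
      = (z s - z s') + δ • (ξ • normal z s - ξ' • normal z s') := by
    simp only [tubular, smul_sub, smul_smul]; abel
  rw [this, norm_add_sq_real, norm_smul, inner_smul_right, mul_pow, Real.norm_eq_abs, sq_abs,
    hz.norm_smul_normal_sub_sq]
  ring

theorem abs_inner_sub_smul_normal_le (s h ξ ξ' : ℝ) {ρ : ℝ} (hξ : |ξ| ≤ ρ) (hξ' : |ξ'| ≤ ρ) :
    |⟪z s - z (s + h), ξ • normal z s - ξ' • normal z (s + h)⟫| ≤ 2 * B ^ 3 * ρ * |h| ^ 2 := by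
  have h1 := hz.abs_inner_sub_normal_le s h
  have h2 := hz.abs_inner_sub_normal_le' s h
  rw [← neg_sub, inner_neg_left, abs_neg, inner_sub_right, inner_smul_right, inner_smul_right]
  refine (abs_sub _ _).trans ?_
  rw [abs_mul, abs_mul]
  have hρ : 0 ≤ ρ := (abs_nonneg ξ).trans hξ
  calc _ ≤ ρ * (B ^ 3 * |h| ^ 2) + ρ * (B ^ 3 * |h| ^ 2) := by gcongr
    _ = _ := by ring

theorem norm_normal_sub_sq_le (s h : ℝ) :
    ‖normal z s - normal z (s + h)‖ ^ 2 ≤ B ^ 4 * |h| ^ 2 := by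
  rw [norm_sub_rev]
  calc _ ≤ (B ^ 2 * |h|) ^ 2 := by gcongr; exact hz.norm_normal_sub_le s h
    _ = _ := by ring

theorem sq_le_norm_sub_sq {s h : ℝ} (hh : |h| ≤ 1 / 2) :
    (B⁻¹) ^ 2 * h ^ 2 ≤ ‖z s - z (s + h)‖ ^ 2 := by
  have := hz.chord s h hh
  have hB := hz.pos
  rw [← sq_abs h, ← mul_pow]
  gcongr

/-- The strip radius `1/(16B⁶)` is chosen so that even after multiplication by `B⁴` it stays below a
fraction of `B⁻²`, the lower bound for the squared chord ratio. -/
theorem mul_inv_pow_le {k : ℕ} (n : ℕ) (hn : n + 2 ≤ k) :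
    B ^ n * (1 / (16 * B ^ k)) ≤ (B⁻¹) ^ 2 / 16 := by
  have hB := hz.pos
  have h1 : B ^ (n + 2) ≤ B ^ k := pow_le_pow_right₀ hz.one_le hn
  rw [mul_one_div, inv_pow, div_le_div_iff₀ (by positivity) (by positivity)]
  have h2 : (B ^ 2)⁻¹ * B ^ (n + 2) = B ^ n := by rw [pow_add]; field_simp
  calc B ^ n * 16 = (B ^ 2)⁻¹ * (16 * B ^ (n + 2)) := by rw [← h2]; ring
    _ ≤ (B ^ 2)⁻¹ * (16 * B ^ k) := by gcongr

/-- Tubular coordinates separate points. -/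
theorem le_norm_tubular_sub_sq {δ s h ξ ξ' : ℝ} (hh : |h| ≤ 1 / 2)
    (hξ : |δ * ξ| ≤ 1 / (16 * B ^ 6)) (hξ' : |δ * ξ'| ≤ 1 / (16 * B ^ 6)) :
    (B⁻¹) ^ 2 / 2 * h ^ 2 + δ ^ 2 * (ξ - ξ') ^ 2
      ≤ ‖tubular δ z s ξ - tubular δ z (s + h) ξ'‖ ^ 2 := by
  have hB := hz.pos
  have hP := hz.sq_le_norm_sub_sq (s := s) hh
  have hQ := hz.abs_inner_sub_smul_normal_le s h (δ * ξ) (δ * ξ') hξ hξ'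
  have hR := hz.norm_normal_sub_sq_le s h
  have e1 : ⟪z s - z (s + h), (δ * ξ) • normal z s - (δ * ξ') • normal z (s + h)⟫
      = δ * ⟪z s - z (s + h), ξ • normal z s - ξ' • normal z (s + h)⟫ := by
    rw [mul_smul, mul_smul, ← smul_sub, inner_smul_right]
  rw [e1] at hQ
  have b1 := hz.mul_inv_pow_le (k := 6) 3 (by norm_num)
  have b2 := hz.mul_inv_pow_le (k := 6) 4 (by norm_num)
  have hρ1 : 1 / (16 * B ^ 6) ≤ 1 := by
    rw [div_le_one (by positivity)]
    have := one_le_pow₀ hz.one_le (n := 6)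
    linarith
  have hQ' : |δ * ⟪z s - z (s + h), ξ • normal z s - ξ' • normal z (s + h)⟫|
      ≤ (B⁻¹) ^ 2 / 8 * h ^ 2 := by
    refine hQ.trans ?_
    rw [sq_abs]
    calc _ = 2 * (B ^ 3 * (1 / (16 * B ^ 6))) * h ^ 2 := by ring
      _ ≤ 2 * ((B⁻¹) ^ 2 / 16) * h ^ 2 := by gcongr
      _ = _ := by ring
  have hR' : |(δ * ξ) * (δ * ξ') * ‖normal z s - normal z (s + h)‖ ^ 2|
      ≤ (B⁻¹) ^ 2 / 16 * h ^ 2 := by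
    rw [abs_mul, abs_mul, abs_of_nonneg (sq_nonneg ‖_‖)]
    calc _ ≤ 1 / (16 * B ^ 6) * 1 * (B ^ 4 * |h| ^ 2) := by
          gcongr; exact hξ'.trans hρ1
      _ = (B ^ 4 * (1 / (16 * B ^ 6))) * h ^ 2 := by rw [sq_abs]; ring
      _ ≤ _ := by gcongr
  rw [hz.norm_tubular_sub_sq]
  have := (abs_le.1 hQ').1
  have := (abs_le.1 hR').1
  have : 0 ≤ (B⁻¹) ^ 2 * h ^ 2 := by positivity
  nlinarith

/-- Connects geometry with the scalar kernel estimates. The chord-arc bound gives `P ≥ B⁻²h²`; half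
of this is given away as `m`, so that the mixed and normal corrections can be absorbed. -/
theorem kernelData {a δ s ξ ξ' h : ℝ} (ha0 : 1 / 2 < a) (ha1 : a < 1) (hδ : 0 < δ)
    (hδB : δ ≤ 1 / (16 * B ^ 6)) (hξ : |ξ| ≤ 1) (hξ' : |ξ'| ≤ 1) (hne : ξ' ≠ ξ) (hh0 : h ≠ 0)
    (hh : |h| ≤ 1 / 2) :
    KernelData a ((B⁻¹) ^ 2 / 2) (4 * B ^ 4) δ h (ξ - ξ') (‖z s - z (s + h)‖ ^ 2)
      (‖tubular δ z s ξ - tubular δ z (s + h) ξ'‖ ^ 2) (length z ^ 2)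
      (2 * δ * ⟪z s - z (s + h), ξ • normal z s - ξ' • normal z (s + h)⟫) where
  ha0 := ha0
  ha1 := ha1
  hm := by have := hz.pos; positivity
  hm1 := by
    have : (B⁻¹) ^ 2 ≤ 1 := pow_le_one₀ (inv_nonneg.2 hz.pos.le) (inv_le_one_of_one_le₀ hz.one_le)
    linarith
  hB := by have := one_le_pow₀ hz.one_le (n := 4); linarith
  hδ := hδ
  hδ1 := by
    refine hδB.trans ?_
    have := one_le_pow₀ hz.one_le (n := 6)
    rw [div_le_one (by positivity)]; linarith
  hδB := by
    have b2 := hz.mul_inv_pow_le (k := 6) 4 (by norm_num)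
    have := hz.pos
    calc 2 * (4 * B ^ 4) * δ ≤ 2 * (4 * B ^ 4) * (1 / (16 * B ^ 6)) := by gcongr
      _ = 8 * (B ^ 4 * (1 / (16 * B ^ 6))) := by ring
      _ ≤ 8 * ((B⁻¹) ^ 2 / 16) := by gcongr
      _ = _ := by ring
  hh := abs_pos.2 hh0
  hh1 := by linarith
  hη := abs_pos.2 (sub_ne_zero.2 hne.symm)
  hη2 := (abs_sub _ _).trans (by linarith)
  hP := by
    have := hz.sq_le_norm_sub_sq (s := s) hh
    linarith
  hΛ := by
    have h1 := hz.le_length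
    have h2 : 0 < B⁻¹ := inv_pos.2 hz.pos
    nlinarith
  hPΛ := by
    rw [norm_sub_rev]
    refine (hz.abs_norm_sub_sq_sub_le s h).trans ?_
    gcongr; norm_num
  hQ := by
    have h1 := hz.abs_inner_sub_smul_normal_le s h ξ ξ' hξ hξ'
    have hB := hz.pos
    rw [abs_mul, abs_of_pos (show 0 < 2 * δ by positivity)]
    calc _ ≤ 2 * δ * (2 * B ^ 3 * 1 * |h| ^ 2) := by gcongr
      _ = 4 * B ^ 3 * δ * |h| ^ 2 := by ring
      _ ≤ _ := by gcongr; exacts [hz.one_le, by norm_num]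
  hZ := by
    have h1 := hz.norm_normal_sub_sq_le s h
    have hB := hz.pos
    rw [hz.norm_tubular_sub_sq]
    have e : ‖z s - z (s + h)‖ ^ 2
        + 2 * δ * ⟪z s - z (s + h), ξ • normal z s - ξ' • normal z (s + h)⟫
        + δ ^ 2 * ((ξ - ξ') ^ 2 + ξ * ξ' * ‖normal z s - normal z (s + h)‖ ^ 2)
        - ‖z s - z (s + h)‖ ^ 2
        - 2 * δ * ⟪z s - z (s + h), ξ • normal z s - ξ' • normal z (s + h)⟫
        - δ ^ 2 * (ξ - ξ') ^ 2 = δ ^ 2 * (ξ * ξ' * ‖normal z s - normal z (s + h)‖ ^ 2) := by ring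
    rw [e, abs_mul, abs_mul, abs_mul, abs_of_nonneg (sq_nonneg δ), abs_of_nonneg (sq_nonneg ‖_‖)]
    calc _ ≤ δ ^ 2 * (1 * 1 * (B ^ 4 * |h| ^ 2)) := by gcongr
      _ = 1 * B ^ 4 * δ ^ 2 * |h| ^ 2 := by ring
      _ ≤ _ := by gcongr; norm_num

theorem abs_inner_tangent_sub_one_le (s h : ℝ) (hh : |h| ≤ 1 / 2) :
    |⟪tangent z (s + h), tangent z s⟫ - 1| ≤ B ^ 4 * |h| := by
  have h1 := hz.norm_tangent_sub_le s h
  have h2 := norm_sub_sq_real (tangent z (s + h)) (tangent z s)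
  rw [hz.norm_tangent, hz.norm_tangent] at h2
  have h3 : ‖tangent z (s + h) - tangent z s‖ ^ 2 ≤ (B ^ 2 * |h|) ^ 2 := by gcongr
  have h4 : |⟪tangent z (s + h), tangent z s⟫ - 1| = ‖tangent z (s + h) - tangent z s‖ ^ 2 / 2 := by
    rw [h2, abs_of_nonpos]
    · ring
    · have := sq_nonneg ‖tangent z (s + h) - tangent z s‖
      linarith
  rw [h4]
  have h5 : (B ^ 2 * |h|) ^ 2 ≤ B ^ 4 * |h| := by
    have : 0 ≤ B ^ 4 * |h| := by have := hz.pos; positivity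
    nlinarith [abs_nonneg h]
  have : 0 ≤ (B ^ 2 * |h|) ^ 2 := sq_nonneg _
  linarith

theorem abs_inner_tangent_le (s s' : ℝ) : |⟪tangent z s, tangent z s'⟫| ≤ 1 := by
  refine (abs_real_inner_le_norm _ _).trans ?_
  rw [hz.norm_tangent, hz.norm_tangent, one_mul]

theorem half_le_one_sub {δ ξ : ℝ} (hδ : 0 < δ) (hδB : δ ≤ 1 / (16 * B ^ 6)) (hξ : |ξ| ≤ 1)
    (s : ℝ) : 1 / 2 ≤ 1 - δ * ξ * curvature z s := by
  have h1 := hz.abs_curvature_le s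
  have hB := hz.pos
  have h2 : |δ * ξ * curvature z s| ≤ 1 / 2 := by
    rw [abs_mul, abs_mul, abs_of_pos hδ]
    have b1 := hz.mul_inv_pow_le (k := 6) 3 (by norm_num)
    have b3 : (B⁻¹) ^ 2 ≤ 1 :=
      pow_le_one₀ (inv_nonneg.2 hz.pos.le) (inv_le_one_of_one_le₀ hz.one_le)
    calc _ ≤ 1 / (16 * B ^ 6) * 1 * B ^ 3 := by gcongr
      _ = B ^ 3 * (1 / (16 * B ^ 6)) := by ring
      _ ≤ 1 / 2 := by linarith
  have := (abs_le.1 h2).2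
  linarith

end CurveBounds

theorem abs_le_of_mul {x y b c : ℝ} (hx : |x| ≤ b) (hy : |y| ≤ c) : |x * y| ≤ b * c := by
  rw [abs_mul]
  exact mul_le_mul hx hy (abs_nonneg _) ((abs_nonneg _).trans hx)

/-- The pointwise expansion of the combined integrand. -/
theorem abs_integrand_sub_le
    {B L δ h W c Kx Kz D₀ q Kr X S X' S' X₀ S₀ τN τT κ₀ k k' ξ ξ' : ℝ}
    (hB : 1 ≤ B) (hL : 0 < L) (hLB : L ≤ B) (hLB' : L⁻¹ ≤ B) (hδ : 0 < δ) (hh : |h| ≤ 1)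
    (hW : 0 ≤ W) (hc : 0 ≤ c) (hKx : 0 ≤ Kx)
    (e1 : |h| * |Kx - Kz| ≤ c * W) (e2 : |h| ^ 2 * |D₀| ≤ c * (δ * W))
    (e3 : |Kx - Kz - D₀| ≤ c * W) (e4 : |h| * |Kx - Kz + q - D₀| ≤ c * (δ * W))
    (e5 : δ * Kx ≤ c * W) (hX : |X| ≤ B) (hS : |S| ≤ B) (hX' : |X'| ≤ B) (hS' : |S'| ≤ B)
    (hX₀ : |X₀| ≤ B) (hS₀ : |S₀| ≤ B) (hXX : |X' - X₀| ≤ B * |h|) (hSS : |S' - S₀| ≤ B * |h|)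
    (hN : |τN| ≤ B ^ 2 * |h|) (hN2 : |τN - κ₀ * h| ≤ B ^ 2 * |h| ^ 2) (hT : |τT| ≤ 1)
    (hT1 : |τT - 1| ≤ B ^ 4 * |h|) (hk : |k| ≤ B ^ 3) (hk' : |k'| ≤ B ^ 3)
    (hξ : |ξ| ≤ 1) (hξ' : |ξ'| ≤ 1) (hJ : 1 / 2 ≤ 1 - δ * ξ * k) :
    |(-(Kz * L * τN * X') - Kx * (δ * S' * τT - L * (1 - δ * ξ' * k') * X' * τN)) / δ * X
        + Kx * (δ * S' * τN + L * (1 - δ * ξ' * k') * X' * τT) * (S / (L * (1 - δ * ξ * k)))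
        + L * τN * X' * (q / δ) * X + L * k' * τN * Kz * ξ' * X' * X
        + (τT * (-X' * S + S' * X) * Kz - (-X₀ * S + S₀ * X) * Kr)
      - (-(D₀ * (-X₀ * S + S₀ * X)) - (-X₀ * S + S₀ * X) * Kr + L * X * X₀ * κ₀ / δ * (h * D₀))|
      ≤ 16 * B ^ 8 * (c * W) := by
  have hB0 : 0 < B := by linarith
  have hJ0 : 0 < 1 - δ * ξ * k := by linarith
  have hcW : 0 ≤ c * W := by positivity
  have hLabs : |L| ≤ B := by rwa [abs_of_pos hL]
  have hG' : |-X' * S + S' * X| ≤ 2 * B ^ 2 := by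
    refine (abs_add_le _ _).trans ?_
    have h1 := abs_le_of_mul (show |-X'| ≤ B by rwa [abs_neg]) hS
    have h2 := abs_le_of_mul hS' hX
    linarith
  have hG₀ : |-X₀ * S + S₀ * X| ≤ 2 * B ^ 2 := by
    refine (abs_add_le _ _).trans ?_
    have h1 := abs_le_of_mul (show |-X₀| ≤ B by rwa [abs_neg]) hS
    have h2 := abs_le_of_mul hS₀ hX
    linarith
  have hGG : |(-X' * S + S' * X) - (-X₀ * S + S₀ * X)| ≤ 2 * B ^ 2 * |h| := by
    have h0 : (-X' * S + S' * X) - (-X₀ * S + S₀ * X) = (S' - S₀) * X - (X' - X₀) * S := by ring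
    rw [h0]
    refine (abs_sub _ _).trans ?_
    have h1 := abs_le_of_mul hXX hS
    have h2 := abs_le_of_mul hSS hX
    linarith
  have hKx' : δ * Kx = |δ * Kx| := (abs_of_nonneg (by positivity)).symm
  rw [hKx'] at e5
  set D := Kx - Kz with hD
  -- The next seven bounds treat in turn: the kernel expansion divided by `δ`; freezing `X'τN` at
  -- `X₀κ₀h`; the curvature term with `K_x` against `K_z`; freezing `τT G'` at `G₀`; replacing `D`
  -- by `D₀`; the product `S S'`, which carries a free factor `δ`; and the ratio of the Jacobians `1
  -- - δξ'k'` and `1 - δξk`.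
  have t1 : |L * X * X' * τN * (D + q - D₀) / δ| ≤ B ^ 5 * (c * W) := by
    rw [abs_div, abs_of_pos hδ, div_le_iff₀ hδ, abs_mul]
    have h1 := abs_le_of_mul (abs_le_of_mul (abs_le_of_mul hLabs hX) hX') hN
    calc _ ≤ B * B * B * (B ^ 2 * |h|) * |D + q - D₀| := by gcongr
      _ = B ^ 5 * (|h| * |D + q - D₀|) := by ring
      _ ≤ B ^ 5 * (c * (δ * W)) := by gcongr
      _ = _ := by ring
  have t2 : |L * X * (X' * τN - X₀ * (κ₀ * h)) * D₀ / δ| ≤ 2 * B ^ 5 * (c * W) := by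
    rw [abs_div, abs_of_pos hδ, div_le_iff₀ hδ, abs_mul]
    have h0 : |X' * τN - X₀ * (κ₀ * h)| ≤ 2 * B ^ 3 * |h| ^ 2 := by
      have : X' * τN - X₀ * (κ₀ * h) = (X' - X₀) * τN + X₀ * (τN - κ₀ * h) := by ring
      rw [this]
      refine (abs_add_le _ _).trans ?_
      have h1 := abs_le_of_mul hXX hN
      have h2 := abs_le_of_mul hX₀ hN2
      calc _ ≤ _ := add_le_add h1 h2
        _ = _ := by ring
    have h1 := abs_le_of_mul (abs_le_of_mul hLabs hX) h0
    calc _ ≤ B * B * (2 * B ^ 3 * |h| ^ 2) * |D₀| := by gcongr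
      _ = 2 * B ^ 5 * (|h| ^ 2 * |D₀|) := by ring
      _ ≤ 2 * B ^ 5 * (c * (δ * W)) := by gcongr
      _ = _ := by ring
  have t3 : |X * L * k' * τN * ξ' * X' * D| ≤ B ^ 8 * (c * W) := by
    have h1 := abs_le_of_mul (abs_le_of_mul (abs_le_of_mul (abs_le_of_mul
      (abs_le_of_mul hX hLabs) hk') hN) hξ') hX'
    rw [abs_mul]
    calc _ ≤ B * B * B ^ 3 * (B ^ 2 * |h|) * 1 * B * |D| := by gcongr
      _ = B ^ 8 * (|h| * |D|) := by ring
      _ ≤ _ := by gcongr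
  have t4 : |D * (τT * (-X' * S + S' * X) - (-X₀ * S + S₀ * X))| ≤ 4 * B ^ 6 * (c * W) := by
    have h0 : |τT * (-X' * S + S' * X) - (-X₀ * S + S₀ * X)| ≤ 4 * B ^ 6 * |h| := by
      have : τT * (-X' * S + S' * X) - (-X₀ * S + S₀ * X)
        = (τT - 1) * (-X' * S + S' * X) + ((-X' * S + S' * X) - (-X₀ * S + S₀ * X)) := by ring
      rw [this]
      refine (abs_add_le _ _).trans ?_
      have h1 := abs_le_of_mul hT1 hG'
      have h2 : B ^ 2 ≤ B ^ 6 := pow_le_pow_right₀ hB (by norm_num)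
      calc _ ≤ _ := add_le_add h1 hGG
        _ = (2 * B ^ 6 + 2 * B ^ 2) * |h| := by ring
        _ ≤ _ := by gcongr; linarith
    rw [abs_mul]
    calc _ ≤ |D| * (4 * B ^ 6 * |h|) := by gcongr
      _ = 4 * B ^ 6 * (|h| * |D|) := by ring
      _ ≤ _ := by gcongr
  have t5 : |(D - D₀) * (-X₀ * S + S₀ * X)| ≤ 2 * B ^ 2 * (c * W) :=
    (abs_le_of_mul e3 hG₀).trans_eq (by ring)
  have hJinv : |(1 - δ * ξ * k)⁻¹| ≤ 2 := by
    rw [abs_of_pos (by positivity), inv_le_comm₀ hJ0 (by norm_num)]; linarith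
  have hLinv : |L⁻¹| ≤ B := by rwa [abs_of_pos (by positivity)]
  have t6 : |(δ * Kx) * (S * S' * τN * L⁻¹ * (1 - δ * ξ * k)⁻¹)| ≤ 2 * B ^ 5 * (c * W) := by
    have h1 := abs_le_of_mul (abs_le_of_mul (abs_le_of_mul (abs_le_of_mul hS hS')
      (hN.trans (mul_le_of_le_one_right (by positivity) hh))) hLinv) hJinv
    exact (abs_le_of_mul e5 h1).trans_eq (by ring)
  have t7 : |(δ * Kx) * (S * X' * τT * (ξ * k - ξ' * k') * (1 - δ * ξ * k)⁻¹)|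
      ≤ 4 * B ^ 5 * (c * W) := by
    have h0 : |ξ * k - ξ' * k'| ≤ 2 * B ^ 3 := by
      refine (abs_sub _ _).trans ?_
      have h1 := abs_le_of_mul hξ hk
      have h2 := abs_le_of_mul hξ' hk'
      linarith
    have h1 := abs_le_of_mul (abs_le_of_mul (abs_le_of_mul (abs_le_of_mul hS hX') hT) h0) hJinv
    exact (abs_le_of_mul e5 h1).trans_eq (by ring)
  have hpow : ∀ n ≤ 8, B ^ n * (c * W) ≤ B ^ 8 * (c * W) := fun n hn => by gcongr
  have p5 := hpow 5 (by norm_num)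
  have p6 := hpow 6 (by norm_num)
  have p2 := hpow 2 (by norm_num)
  -- Exact algebra: the difference from the leading part is the signed sum of the seven terms just
  -- bounded.
  have key : (-(Kz * L * τN * X') - Kx * (δ * S' * τT - L * (1 - δ * ξ' * k') * X' * τN)) / δ * X
        + Kx * (δ * S' * τN + L * (1 - δ * ξ' * k') * X' * τT) * (S / (L * (1 - δ * ξ * k)))
        + L * τN * X' * (q / δ) * X + L * k' * τN * Kz * ξ' * X' * X
        + (τT * (-X' * S + S' * X) * Kz - (-X₀ * S + S₀ * X) * Kr)
      - (-(D₀ * (-X₀ * S + S₀ * X)) - (-X₀ * S + S₀ * X) * Kr + L * X * X₀ * κ₀ / δ * (h * D₀))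
      = L * X * X' * τN * (D + q - D₀) / δ + L * X * (X' * τN - X₀ * (κ₀ * h)) * D₀ / δ
        - X * L * k' * τN * ξ' * X' * D - D * (τT * (-X' * S + S' * X) - (-X₀ * S + S₀ * X))
        - (D - D₀) * (-X₀ * S + S₀ * X)
        + (δ * Kx) * (S * S' * τN * L⁻¹ * (1 - δ * ξ * k)⁻¹)
        + (δ * Kx) * (S * X' * τT * (ξ * k - ξ' * k') * (1 - δ * ξ * k)⁻¹) := by
    rw [hD]
    have := hJ0.ne'
    field_simp
    ring
  rw [key]
  rw [abs_le] at t1 t2 t3 t4 t5 t6 t7 ⊢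
  constructor <;> linarith [t1.1, t1.2, t2.1, t2.2, t3.1, t3.2, t4.1, t4.2, t5.1, t5.2, t6.1, t6.2,
    t7.1, t7.2]

/-- Bounds for the profile `f = Ω(·, ·, τ)` on the strip `|ξ| ≤ 1`. -/
structure ProfileBounds (B : ℝ) (f : ℝ → ℝ → ℝ) : Prop where
  continuous_dXi : Continuous fun p : ℝ × ℝ => dXi f p.1 p.2
  continuous_dS : Continuous fun p : ℝ × ℝ => dS f p.1 p.2
  periodic : ∀ ξ, Function.Periodic (fun s => f s ξ) 1
  dXi_le : ∀ s ξ, |ξ| ≤ 1 → |dXi f s ξ| ≤ B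
  dS_le : ∀ s ξ, |ξ| ≤ 1 → |dS f s ξ| ≤ B
  dXi_sub_le : ∀ s h ξ, |ξ| ≤ 1 → |dXi f (s + h) ξ - dXi f s ξ| ≤ B * |h|
  dS_sub_le : ∀ s h ξ, |ξ| ≤ 1 → |dS f (s + h) ξ - dS f s ξ| ≤ B * |h|
  integral_dXi : ∀ s, ∫ ξ in (-1 : ℝ)..1, dXi f s ξ = 1

/-! ### Integration over the coordinate box -/

/-- Lebesgue measure in `(ξ_*, h)`, `h = s_* - s`, on `[-1, 1] × [-1/2, 1/2]`. -/
noncomputable def boxMeasure : Measure (ℝ × ℝ) :=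
  (volume.restrict (Ioc (-1 : ℝ) 1)).prod (volume.restrict (Ioc (-(1 / 2) : ℝ) (1 / 2)))

/-- Measurable functions of `(ξ_*, h)` whose singularities at `h = 0` and `ξ_* = ξ` are at most
of order `a`. -/
structure Tame (a ξ : ℝ) (F : ℝ × ℝ → ℝ) : Prop where
  measurable : Measurable F
  bound : ∃ C, 0 ≤ C ∧ ∀ ξ' h, |ξ'| ≤ 1 → ξ' ≠ ξ → |h| ≤ 1 / 2 → h ≠ 0 →
    |F (ξ', h)| ≤ C * (|h| ^ (-a) * |ξ - ξ'| ^ (-a))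

theorem locallyIntegrable_abs_rpow {a : ℝ} (ha1 : a < 1) :
    LocallyIntegrable (fun h : ℝ => |h| ^ (-a)) := by
  refine locallyIntegrable_of_norm_le_rpow (α := a) (C := 1) (by simp) (by simpa using ha1)
    (Filter.Eventually.of_forall fun h => ?_) ?_
  · rw [one_mul, Real.norm_eq_abs, Real.norm_eq_abs, abs_of_nonneg (by positivity)]
  · exact (by fun_prop : Measurable fun h : ℝ => |h| ^ (-a)).aestronglyMeasurable

theorem intervalIntegrable_abs_rpow {a : ℝ} (ha1 : a < 1) (x y : ℝ) :
    IntervalIntegrable (fun h : ℝ => |h| ^ (-a)) volume x y :=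
  intervalIntegrable_iff.2 (((locallyIntegrable_abs_rpow ha1).integrableOn_isCompact
    isCompact_uIcc).mono_set uIoc_subset_uIcc)

theorem intervalIntegrable_abs_sub_rpow {a : ℝ} (ha1 : a < 1) (ξ x y : ℝ) :
    IntervalIntegrable (fun ξ' : ℝ => |ξ - ξ'| ^ (-a)) volume x y := by
  have := (intervalIntegrable_abs_rpow ha1 (x - ξ) (y - ξ)).comp_sub_right ξ
  simp only [sub_add_cancel] at this
  refine this.congr (fun x _ => ?_)
  simp only [abs_sub_comm]

theorem integral_abs_sub_rpow_le {a ξ : ℝ} (ha1 : a < 1) (hξ : |ξ| ≤ 1) :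
    ∫ ξ' in (-1 : ℝ)..1, |ξ - ξ'| ^ (-a) ≤ ∫ η in (-2 : ℝ)..2, |η| ^ (-a) := by
  have h1 := intervalIntegral.integral_comp_sub_left (a := -1) (b := 1)
    (fun η : ℝ => |η| ^ (-a)) ξ
  rw [h1]
  have := abs_le.1 hξ
  refine intervalIntegral.integral_mono_interval (by linarith) (by linarith) (by linarith)
    (Filter.Eventually.of_forall fun η => ?_) (intervalIntegrable_abs_rpow ha1 _ _)
  simp only [Pi.zero_apply]
  positivity

theorem ae_boxMeasure (ξ : ℝ) :
    ∀ᵐ p ∂boxMeasure, |p.1| ≤ 1 ∧ p.1 ≠ ξ ∧ |p.2| ≤ 1 / 2 ∧ p.2 ≠ 0 := by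
  have h1 : ∀ᵐ x ∂(volume.restrict (Ioc (-1 : ℝ) 1)), |x| ≤ 1 ∧ x ≠ ξ := by
    filter_upwards [ae_restrict_mem measurableSet_Ioc, ae_restrict_of_ae (Measure.ae_ne volume ξ)]
      with x hx hne
    exact ⟨abs_le.2 ⟨hx.1.le, hx.2⟩, hne⟩
  have h2 : ∀ᵐ x ∂(volume.restrict (Ioc (-(1 / 2) : ℝ) (1 / 2))), |x| ≤ 1 / 2 ∧ x ≠ 0 := by
    filter_upwards [ae_restrict_mem measurableSet_Ioc, ae_restrict_of_ae (Measure.ae_ne volume 0)]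
      with x hx hne
    exact ⟨abs_le.2 ⟨hx.1.le, hx.2⟩, hne⟩
  filter_upwards [Measure.quasiMeasurePreserving_fst.ae h1,
    Measure.quasiMeasurePreserving_snd.ae h2] with p hp1 hp2
  exact ⟨hp1.1, hp1.2, hp2.1, hp2.2⟩

theorem integral_boxMeasure {F : ℝ × ℝ → ℝ} (hF : Integrable F boxMeasure) :
    ∫ p, F p ∂boxMeasure
      = ∫ ξ' in (-1 : ℝ)..1, ∫ h in (-(1 / 2) : ℝ)..(1 / 2), F (ξ', h) := by
  rw [boxMeasure, integral_prod F hF, intervalIntegral.integral_of_le (by norm_num)]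
  simp_rw [intervalIntegral.integral_of_le (show (-(1 / 2) : ℝ) ≤ 1 / 2 by norm_num)]

theorem integral_boxMeasure_swap {F : ℝ × ℝ → ℝ} (hF : Integrable F boxMeasure) :
    ∫ p, F p ∂boxMeasure
      = ∫ h in (-(1 / 2) : ℝ)..(1 / 2), ∫ ξ' in (-1 : ℝ)..1, F (ξ', h) := by
  rw [boxMeasure, integral_prod_symm F hF, intervalIntegral.integral_of_le (by norm_num)]
  simp_rw [intervalIntegral.integral_of_le (show (-1 : ℝ) ≤ 1 by norm_num)]

theorem intervalIntegrable_integral_boxMeasure {F : ℝ × ℝ → ℝ} (hF : Integrable F boxMeasure) :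
    IntervalIntegrable (fun ξ' => ∫ h in (-(1 / 2) : ℝ)..(1 / 2), F (ξ', h)) volume (-1) 1 := by
  rw [intervalIntegrable_iff_integrableOn_Ioc_of_le (by norm_num)]
  have := hF.integral_prod_left
  simp_rw [intervalIntegral.integral_of_le (show (-(1 / 2) : ℝ) ≤ 1 / 2 by norm_num)]
  exact this

namespace Tame

variable {a ξ : ℝ} {F G : ℝ × ℝ → ℝ}

theorem add (hF : Tame a ξ F) (hG : Tame a ξ G) : Tame a ξ (fun p => F p + G p) := by
  obtain ⟨C, hC, h1⟩ := hF.bound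
  obtain ⟨C', hC', h2⟩ := hG.bound
  refine ⟨hF.measurable.add hG.measurable, C + C', by positivity, fun ξ' h a1 a2 a3 a4 => ?_⟩
  rw [add_mul]
  exact (abs_add_le _ _).trans (add_le_add (h1 ξ' h a1 a2 a3 a4) (h2 ξ' h a1 a2 a3 a4))

theorem mul_const (hF : Tame a ξ F) (c : ℝ) : Tame a ξ (fun p => F p * c) := by
  obtain ⟨C, hC, h1⟩ := hF.bound
  refine ⟨hF.measurable.mul_const c, C * |c|, by positivity, fun ξ' h a1 a2 a3 a4 => ?_⟩
  rw [abs_mul]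
  calc _ ≤ C * (|h| ^ (-a) * |ξ - ξ'| ^ (-a)) * |c| := by gcongr; exact h1 ξ' h a1 a2 a3 a4
    _ = _ := by ring

theorem integrable (ha1 : a < 1) (hF : Tame a ξ F) : Integrable F boxMeasure := by
  obtain ⟨C, hC, h1⟩ := hF.bound
  have i1 : Integrable (fun p : ℝ × ℝ => |ξ - p.1| ^ (-a) * |p.2| ^ (-a)) boxMeasure := by
    refine Integrable.mul_prod (f := fun x : ℝ => |ξ - x| ^ (-a)) (g := fun x : ℝ => |x| ^ (-a))
      ?_ ?_
    · exact ((intervalIntegrable_abs_sub_rpow ha1 ξ _ _).1)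
    · exact ((intervalIntegrable_abs_rpow ha1 _ _).1)
  refine (i1.const_mul C).mono' hF.measurable.aestronglyMeasurable ?_
  filter_upwards [ae_boxMeasure ξ] with p hp
  rw [mul_comm (|ξ - p.1| ^ (-a))]
  exact h1 p.1 p.2 hp.1 hp.2.1 hp.2.2.1 hp.2.2.2

theorem intervalIntegrable (ha1 : a < 1) (hF : Tame a ξ F) {ξ' : ℝ} (hξ' : |ξ'| ≤ 1)
    (hne : ξ' ≠ ξ) :
    IntervalIntegrable (fun h => F (ξ', h)) volume (-(1 / 2)) (1 / 2) := by
  obtain ⟨C, hC, h1⟩ := hF.bound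
  rw [intervalIntegrable_iff_integrableOn_Ioc_of_le (by norm_num)]
  have i1 := (intervalIntegrable_abs_rpow ha1 (-(1 / 2)) (1 / 2)).1
  refine (i1.const_mul (C * |ξ - ξ'| ^ (-a))).mono'
    (hF.measurable.comp measurable_prodMk_left).aestronglyMeasurable ?_
  filter_upwards [ae_restrict_mem measurableSet_Ioc, ae_restrict_of_ae (Measure.ae_ne volume 0)]
    with h hh h0
  refine (h1 ξ' h hξ' hne (abs_le.2 ⟨hh.1.le, hh.2⟩) h0).trans_eq (by ring)

/-- A bound by `|h|^{1-2a}` suffices. -/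
theorem of_abs_le (ha0 : 1 / 2 < a) (ha1 : a < 1) (hξ : |ξ| ≤ 1) (hF : Measurable F) {C : ℝ}
    (hC : 0 ≤ C) (hb : ∀ ξ' h, |ξ'| ≤ 1 → |h| ≤ 1 / 2 → h ≠ 0 →
      |F (ξ', h)| ≤ C * |h| ^ (1 - 2 * a)) : Tame a ξ F := by
  refine ⟨hF, 2 * C, by positivity, fun ξ' h h1 h2 h3 h4 => (hb ξ' h h1 h3 h4).trans ?_⟩
  have hη := one_le_two_mul_rpow (η := ξ - ξ') ha0 ha1 (abs_pos.2 (sub_ne_zero.2 h2.symm))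
    ((abs_sub _ _).trans (by linarith))
  have hh : |h| ^ (1 - 2 * a) ≤ |h| ^ (-a) :=
    Real.rpow_le_rpow_of_exponent_ge (abs_pos.2 h4) (by linarith) (by linarith)
  calc C * |h| ^ (1 - 2 * a) ≤ C * |h| ^ (-a) * 1 := by rw [mul_one]; gcongr
    _ ≤ C * |h| ^ (-a) * (2 * |ξ - ξ'| ^ (-a)) := by gcongr
    _ = _ := by ring

end Tame

/-! ### The integrands -/

section

variable (α δ : ℝ) (z : ℝ → Plane) (f : ℝ → ℝ → ℝ) (s ξ : ℝ)

/-- The first commutator integrand of the approximate equation, in `(ξ_*, h)`. -/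
noncomputable def stretchIntegrand (p : ℝ × ℝ) : ℝ :=
  ⟪tangent z (s + p.2), normal z s⟫ / ‖z s - z (s + p.2)‖ ^ (3 + α)
    * ⟪z s - z (s + p.2), ξ • normal z s - p.1 • normal z (s + p.2)⟫ * dXi f (s + p.2) p.1

/-- The curvature integrand of the approximate equation. -/
noncomputable def curvatureIntegrand (p : ℝ × ℝ) : ℝ :=
  length z * curvature z (s + p.2) * ⟪tangent z (s + p.2), normal z s⟫
    / ‖z s - z (s + p.2)‖ ^ (1 + α) * p.1 * dXi f (s + p.2) p.1

/-- The regularised transport integrand of the approximate equation. -/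
noncomputable def regularIntegrand (p : ℝ × ℝ) : ℝ :=
  ⟪tangent z (s + p.2), tangent z s⟫ * gradPerpDotGrad f (s + p.2) p.1 s ξ
      / ‖z s - z (s + p.2)‖ ^ (1 + α)
    - gradPerpDotGrad f s p.1 s ξ / (length z ^ (1 + α) * |rsin (s - (s + p.2))| ^ (1 + α))

/-- The integrand of the normal component of the front operator. -/
noncomputable def frontIntegrand (p : ℝ × ℝ) : ℝ :=
  (‖z s - z (s + p.2)‖ ^ (1 + α))⁻¹ * length z * ⟪tangent z (s + p.2), normal z s⟫
    * dXi f (s + p.2) p.1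

/-- The integrand of the normal velocity in tubular coordinates. -/
noncomputable def normalIntegrand (p : ℝ × ℝ) : ℝ :=
  (‖tubular δ z s ξ - tubular δ z (s + p.2) p.1‖ ^ (1 + α))⁻¹
    * (δ * dS f (s + p.2) p.1 * ⟪tangent z (s + p.2), tangent z s⟫
      - length z * (1 - δ * p.1 * curvature z (s + p.2)) * dXi f (s + p.2) p.1
        * ⟪tangent z (s + p.2), normal z s⟫)

/-- The integrand of minus the tangential velocity in tubular coordinates. -/
noncomputable def tangentIntegrand (p : ℝ × ℝ) : ℝ :=
  (‖tubular δ z s ξ - tubular δ z (s + p.2) p.1‖ ^ (1 + α))⁻¹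
    * (δ * dS f (s + p.2) p.1 * ⟪tangent z (s + p.2), normal z s⟫
      + length z * (1 - δ * p.1 * curvature z (s + p.2)) * dXi f (s + p.2) p.1
        * ⟪tangent z (s + p.2), tangent z s⟫)

end

section Measurability

variable {B : ℝ} {z : ℝ → Plane} {f : ℝ → ℝ → ℝ} (hz : CurveBounds B z) (hf : ProfileBounds B f)
  (α δ s ξ : ℝ)
include hz

omit hz in
theorem continuous_shift {E : Type*} [TopologicalSpace E] {g : ℝ → E} (hg : Continuous g) (s : ℝ) :
    Continuous fun p : ℝ × ℝ => g (s + p.2) := hg.comp (by fun_prop)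

theorem continuous_inner_tangent_normal :
    Continuous fun p : ℝ × ℝ => ⟪tangent z (s + p.2), normal z s⟫ :=
  (continuous_shift hz.continuous_tangent s).inner continuous_const

theorem continuous_inner_tangent_tangent :
    Continuous fun p : ℝ × ℝ => ⟪tangent z (s + p.2), tangent z s⟫ :=
  (continuous_shift hz.continuous_tangent s).inner continuous_const

theorem continuous_norm_sub : Continuous fun p : ℝ × ℝ => ‖z s - z (s + p.2)‖ :=
  (continuous_const.sub (continuous_shift hz.continuous_curve s)).norm

theorem continuous_norm_tubular_sub :
    Continuous fun p : ℝ × ℝ => ‖tubular δ z s ξ - tubular δ z (s + p.2) p.1‖ := by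
  have h1 := hz.continuous_curve
  have h2 := hz.continuous_normal
  unfold tubular
  fun_prop

omit hz in
include hf in
theorem continuous_dXi_shift : Continuous fun p : ℝ × ℝ => dXi f (s + p.2) p.1 :=
  hf.continuous_dXi.comp (f := fun p : ℝ × ℝ => (s + p.2, p.1)) (by fun_prop)

omit hz in
include hf in
theorem continuous_dS_shift : Continuous fun p : ℝ × ℝ => dS f (s + p.2) p.1 :=
  hf.continuous_dS.comp (f := fun p : ℝ × ℝ => (s + p.2, p.1)) (by fun_prop)

include hf

theorem measurable_stretchIntegrand : Measurable (stretchIntegrand α z f s ξ) := by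
  have h1 := (continuous_inner_tangent_normal hz s).measurable
  have h2 := (continuous_norm_sub hz s).measurable
  have h3 := (continuous_dXi_shift hf s).measurable
  have h4 := hz.continuous_curve
  have h5 := hz.continuous_normal
  have h6 : Measurable fun p : ℝ × ℝ =>
      ⟪z s - z (s + p.2), ξ • normal z s - p.1 • normal z (s + p.2)⟫ :=
    Continuous.measurable (Continuous.inner (by fun_prop) (by fun_prop))
  exact ((h1.div (h2.pow_const _)).mul h6).mul h3

theorem measurable_curvatureIntegrand : Measurable (curvatureIntegrand α z f s) := by
  have h1 := (continuous_inner_tangent_normal hz s).measurable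
  have h2 := (continuous_norm_sub hz s).measurable
  have h3 := (continuous_dXi_shift hf s).measurable
  have h4 := (continuous_shift hz.continuous_curvature s).measurable
  exact ((((h4.const_mul _).mul h1).div (h2.pow_const _)).mul measurable_fst).mul h3

theorem measurable_regularIntegrand : Measurable (regularIntegrand α z f s ξ) := by
  have h1 := (continuous_inner_tangent_tangent hz s).measurable
  have h2 := (continuous_norm_sub hz s).measurable
  have h3 := continuous_dXi_shift hf s
  have h4 := continuous_dS_shift hf s
  have h5 : Measurable fun p : ℝ × ℝ => gradPerpDotGrad f (s + p.2) p.1 s ξ := by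
    unfold gradPerpDotGrad; exact Continuous.measurable (by fun_prop)
  have h6 : Continuous fun p : ℝ × ℝ => dXi f s p.1 :=
    hf.continuous_dXi.comp (f := fun p : ℝ × ℝ => (s, p.1)) (by fun_prop)
  have h7 : Continuous fun p : ℝ × ℝ => dS f s p.1 :=
    hf.continuous_dS.comp (f := fun p : ℝ × ℝ => (s, p.1)) (by fun_prop)
  have h8 : Measurable fun p : ℝ × ℝ => gradPerpDotGrad f s p.1 s ξ := by
    unfold gradPerpDotGrad; exact Continuous.measurable (by fun_prop)
  have h9 : Measurable fun p : ℝ × ℝ => |rsin (s - (s + p.2))| :=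
    ((continuous_rsin.comp (by fun_prop : Continuous fun p : ℝ × ℝ =>
      s - (s + p.2))).abs).measurable
  exact ((h1.mul h5).div (h2.pow_const _)).sub (h8.div ((h9.pow_const _).const_mul _))

theorem measurable_frontIntegrand : Measurable (frontIntegrand α z f s) := by
  have h1 := (continuous_inner_tangent_normal hz s).measurable
  have h2 := (continuous_norm_sub hz s).measurable
  have h3 := (continuous_dXi_shift hf s).measurable
  exact ((((h2.pow_const _).inv.mul_const _).mul h1).mul h3)

theorem measurable_normalIntegrand : Measurable (normalIntegrand α δ z f s ξ) := by
  have h1 := continuous_inner_tangent_normal hz s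
  have h2 := continuous_inner_tangent_tangent hz s
  have h3 := continuous_dXi_shift hf s
  have h4 := continuous_dS_shift hf s
  have h5 := continuous_shift hz.continuous_curvature s
  have h6 := (continuous_norm_tubular_sub hz δ s ξ).measurable
  exact (h6.pow_const _).inv.mul (Continuous.measurable (by fun_prop))

theorem measurable_tangentIntegrand : Measurable (tangentIntegrand α δ z f s ξ) := by
  have h1 := continuous_inner_tangent_normal hz s
  have h2 := continuous_inner_tangent_tangent hz s
  have h3 := continuous_dXi_shift hf s
  have h4 := continuous_dS_shift hf s
  have h5 := continuous_shift hz.continuous_curvature s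
  have h6 := (continuous_norm_tubular_sub hz δ s ξ).measurable
  exact (h6.pow_const _).inv.mul (Continuous.measurable (by fun_prop))

end Measurability

/-! ### Bounds for the integrands -/

theorem inv_rpow_eq_sq_rpow {x : ℝ} (hx : 0 ≤ x) (β : ℝ) :
    (x ^ β)⁻¹ = (x ^ 2) ^ (-(β / 2)) := by
  rw [← Real.rpow_natCast x 2, ← Real.rpow_mul hx, ← Real.rpow_neg hx]
  congr 1; push_cast; ring

section

variable {B : ℝ} {z : ℝ → Plane} {f : ℝ → ℝ → ℝ} (hz : CurveBounds B z) (hf : ProfileBounds B f)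
include hz

theorem inv_norm_sub_rpow_le {s h β : ℝ} (hβ : 0 ≤ β) (hh : |h| ≤ 1 / 2) (h0 : h ≠ 0) :
    (‖z s - z (s + h)‖ ^ β)⁻¹ ≤ B ^ β * |h| ^ (-β) := by
  have hB := hz.pos
  have hh0 : 0 < |h| := abs_pos.2 h0
  have h1 : (B⁻¹ * |h|) ^ β ≤ ‖z s - z (s + h)‖ ^ β :=
    Real.rpow_le_rpow (by positivity) (hz.chord s h hh) hβ
  have h2 : ((B⁻¹ * |h|) ^ β)⁻¹ = B ^ β * |h| ^ (-β) := by
    rw [Real.mul_rpow (by positivity) hh0.le, mul_inv, Real.inv_rpow hB.le, inv_inv,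
      Real.rpow_neg hh0.le]
  rw [← h2]
  exact inv_anti₀ (by positivity) h1

theorem sq_mul_le_length_sq_mul_rsin_sq {h : ℝ} (hh : |h| ≤ 1 / 2) :
    (B⁻¹) ^ 2 / 4 * h ^ 2 ≤ length z ^ 2 * rsin h ^ 2 := by
  have h1 := two_div_pi_mul_le_abs_rsin hh
  have h2 := hz.le_length
  have hB := hz.pos
  have h3 : 1 / 2 ≤ 2 / Real.pi := by
    rw [div_le_div_iff₀ (by norm_num) Real.pi_pos]; linarith [Real.pi_le_four]
  have h4 : 1 / 2 * |h| ≤ |rsin h| := le_trans (by gcongr) h1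
  rw [← sq_abs h, ← sq_abs (rsin h)]
  calc (B⁻¹) ^ 2 / 4 * |h| ^ 2 = (B⁻¹) ^ 2 * (1 / 2 * |h|) ^ 2 := by ring
    _ ≤ _ := by gcongr

/-- Both arguments equal `L²h² + O(h⁴)`, so after scaling by `h²` they differ by `O(h²)` and the
powers by `O(|h|^{2-2a})`. Applied with `P = |z-z_*|²` for the regularised integrand and with `P =
L²h²` for the constant `b_α`. -/
theorem abs_rpow_sub_rsin_rpow_le {a : ℝ} (ha0 : 1 / 2 < a) (ha1 : a < 1) {P h : ℝ}
    (hh : |h| ≤ 1 / 2) (h0 : h ≠ 0) (hP : (B⁻¹) ^ 2 / 4 * h ^ 2 ≤ P)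
    (hP2 : |P - length z ^ 2 * h ^ 2| ≤ 2 * B ^ 4 * |h| ^ 4) :
    |P ^ (-a) - (length z ^ 2 * rsin h ^ 2) ^ (-a)|
      ≤ (((B⁻¹) ^ 2 / 4)⁻¹) ^ 2 * (2 * B ^ 4 + B ^ 2 * Real.pi ^ 2) * |h| ^ (1 - 2 * a) := by
  have hB := hz.pos
  have hh0 : 0 < |h| := abs_pos.2 h0
  have hh2 : 0 < h ^ 2 := by positivity
  have hr := sq_mul_le_length_sq_mul_rsin_sq hz hh
  set m := (B⁻¹) ^ 2 / 4 with hm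
  have hm0 : 0 < m := by positivity
  have hm1 : m ≤ 1 := by
    have : (B⁻¹) ^ 2 ≤ 1 := pow_le_one₀ (inv_nonneg.2 hz.pos.le) (inv_le_one_of_one_le₀ hz.one_le)
    linarith
  have e1 : P = h ^ 2 * (P / h ^ 2) := by field_simp
  have e2 : length z ^ 2 * rsin h ^ 2 = h ^ 2 * (length z ^ 2 * rsin h ^ 2 / h ^ 2) := by
    field_simp
  have l1 : m ≤ P / h ^ 2 := by rwa [le_div_iff₀ hh2]
  have l2 : m ≤ length z ^ 2 * rsin h ^ 2 / h ^ 2 := by rwa [le_div_iff₀ hh2]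
  have d1 : |P - length z ^ 2 * rsin h ^ 2| ≤ (2 * B ^ 4 + B ^ 2 * Real.pi ^ 2) * |h| ^ 4 := by
    have h1 := abs_rsin_sq_sub_le h
    have h2 : |length z ^ 2 * (rsin h ^ 2 - h ^ 2)| ≤ B ^ 2 * (Real.pi ^ 2 * |h| ^ 4) := by
      rw [abs_mul, abs_of_nonneg (sq_nonneg _)]
      gcongr
      · exact hz.length_pos.le
      · exact hz.length_le
    have : P - length z ^ 2 * rsin h ^ 2
      = (P - length z ^ 2 * h ^ 2) - length z ^ 2 * (rsin h ^ 2 - h ^ 2) := by ring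
    rw [this]
    exact (abs_sub _ _).trans (by linarith)
  have d2 : |P / h ^ 2 - length z ^ 2 * rsin h ^ 2 / h ^ 2|
      ≤ (2 * B ^ 4 + B ^ 2 * Real.pi ^ 2) * |h| ^ 2 := by
    rw [← sub_div, abs_div, abs_of_pos hh2, div_le_iff₀ hh2]
    refine d1.trans_eq ?_
    rw [mul_assoc, ← sq_abs h, ← pow_add]
  have d3 := abs_rpow_sub_le_mul (by linarith) ha1 hm0 hm1 l1 l2
  rw [e1, e2, KernelData.mul_rpow_sq (hm0.le.trans l1), KernelData.mul_rpow_sq (hm0.le.trans l2),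
    ← mul_sub, abs_mul, abs_of_nonneg (by positivity : 0 ≤ |h| ^ (-(2 * a)))]
  have d4 : |h| ^ (-(2 * a)) * |h| ^ 2 ≤ |h| ^ (1 - 2 * a) := by
    rw [← Real.rpow_natCast |h| 2, ← Real.rpow_add hh0]
    exact Real.rpow_le_rpow_of_exponent_ge hh0 (by linarith) (by push_cast; linarith)
  calc _ ≤ |h| ^ (-(2 * a)) * ((m⁻¹) ^ 2 * ((2 * B ^ 4 + B ^ 2 * Real.pi ^ 2) * |h| ^ 2)) := by
        gcongr; exact d3.trans (by gcongr)
    _ = (m⁻¹) ^ 2 * (2 * B ^ 4 + B ^ 2 * Real.pi ^ 2) * (|h| ^ (-(2 * a)) * |h| ^ 2) := by ring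
    _ ≤ _ := by gcongr

omit hz in
theorem mul_abs_rpow_eq {α h : ℝ} (h0 : h ≠ 0) :
    |h| * |h| ^ (-(1 + α)) = |h| ^ (1 - 2 * ((1 + α) / 2)) ∧
    |h| ^ 3 * |h| ^ (-(3 + α)) = |h| ^ (1 - 2 * ((1 + α) / 2)) := by
  have hh0 : 0 < |h| := abs_pos.2 h0
  constructor
  · nth_rewrite 1 [← Real.rpow_one |h|]
    rw [← Real.rpow_add hh0]; congr 1; ring
  · rw [← Real.rpow_natCast |h| 3, ← Real.rpow_add hh0]; congr 1; push_cast; ring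

include hf

variable {α : ℝ} (hα0 : 0 < α) (hα1 : α < 1) {s ξ : ℝ} (hξ : |ξ| ≤ 1)
include hα0 hα1 hξ

/-- `T_*·N = O(h)` and the mixed scalar product is `O(h²)`; together they reduce `|h|^{-3-α}` to
`|h|^{-α}`. -/
theorem tame_stretchIntegrand : Tame ((1 + α) / 2) ξ (stretchIntegrand α z f s ξ) := by
  have hB := hz.pos
  refine Tame.of_abs_le (C := B ^ 2 * B ^ (3 + α) * (2 * B ^ 3 * 1) * B) (by linarith)
    (by linarith) hξ (measurable_stretchIntegrand hz hf α s ξ) (by positivity)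
    fun ξ' h hξ' hh h0 => ?_
  rw [stretchIntegrand, div_eq_mul_inv]
  have h1 := hz.abs_inner_tangent_normal_le s h
  have h2 := inv_norm_sub_rpow_le hz (s := s) (β := 3 + α) (by linarith) hh h0
  have h3 := hz.abs_inner_sub_smul_normal_le s h ξ ξ' hξ hξ'
  rw [← abs_of_nonneg (inv_nonneg.2 (Real.rpow_nonneg (norm_nonneg (z s - z (s + h))) (3 + α)))]
    at h2
  refine (abs_le_of_mul (abs_le_of_mul (abs_le_of_mul h1 h2) h3)
    (hf.dXi_le (s + h) ξ' hξ')).trans_eq ?_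
  rw [← (mul_abs_rpow_eq h0).2]; ring

theorem tame_curvatureIntegrand : Tame ((1 + α) / 2) ξ (curvatureIntegrand α z f s) := by
  have hB := hz.pos
  refine Tame.of_abs_le (C := B * B ^ 3 * B ^ 2 * B ^ (1 + α) * 1 * B) (by linarith)
    (by linarith) hξ (measurable_curvatureIntegrand hz hf α s) (by positivity)
    fun ξ' h hξ' hh h0 => ?_
  rw [curvatureIntegrand, div_eq_mul_inv]
  have h1 := hz.abs_inner_tangent_normal_le s h
  have h2 := inv_norm_sub_rpow_le hz (s := s) (β := 1 + α) (by linarith) hh h0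
  have h3 : |length z| ≤ B := by rw [abs_of_pos hz.length_pos]; exact hz.length_le
  rw [← abs_of_nonneg (inv_nonneg.2 (Real.rpow_nonneg (norm_nonneg (z s - z (s + h))) (1 + α)))]
    at h2
  refine (abs_le_of_mul (abs_le_of_mul (abs_le_of_mul (abs_le_of_mul (abs_le_of_mul h3
    (hz.abs_curvature_le (s + h))) h1) h2) hξ') (hf.dXi_le (s + h) ξ' hξ')).trans_eq ?_
  rw [← (mul_abs_rpow_eq h0).1]; ring

theorem tame_frontIntegrand : Tame ((1 + α) / 2) ξ (frontIntegrand α z f s) := by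
  have hB := hz.pos
  refine Tame.of_abs_le (C := B ^ (1 + α) * B * B ^ 2 * B) (by linarith)
    (by linarith) hξ (measurable_frontIntegrand hz hf α s) (by positivity)
    fun ξ' h hξ' hh h0 => ?_
  rw [frontIntegrand]
  have h1 := hz.abs_inner_tangent_normal_le s h
  have h2 := inv_norm_sub_rpow_le hz (s := s) (β := 1 + α) (by linarith) hh h0
  have h3 : |length z| ≤ B := by rw [abs_of_pos hz.length_pos]; exact hz.length_le
  rw [← abs_of_nonneg (inv_nonneg.2 (Real.rpow_nonneg (norm_nonneg (z s - z (s + h))) (1 + α)))]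
    at h2
  refine (abs_le_of_mul (abs_le_of_mul (abs_le_of_mul h2 h3) h1)
    (hf.dXi_le (s + h) ξ' hξ')).trans_eq ?_
  rw [← (mul_abs_rpow_eq h0).1]; ring

omit hz hα0 hα1 in
theorem abs_gradPerpDotGrad_le {s' ξ' : ℝ} (hξ' : |ξ'| ≤ 1) :
    |gradPerpDotGrad f s' ξ' s ξ| ≤ 2 * B ^ 2 := by
  unfold gradPerpDotGrad
  refine (abs_add_le _ _).trans ?_
  have h0 : |-dXi f s' ξ'| ≤ B := by rw [abs_neg]; exact hf.dXi_le s' ξ' hξ'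
  have h1 := abs_le_of_mul h0 (hf.dS_le s ξ hξ)
  have h2 := abs_le_of_mul (hf.dS_le s' ξ' hξ') (hf.dXi_le s ξ hξ)
  linarith

omit hz hα0 hα1 in
theorem abs_gradPerpDotGrad_sub_le {h ξ' : ℝ} (hξ' : |ξ'| ≤ 1) :
    |gradPerpDotGrad f (s + h) ξ' s ξ - gradPerpDotGrad f s ξ' s ξ| ≤ 2 * B ^ 2 * |h| := by
  have : gradPerpDotGrad f (s + h) ξ' s ξ - gradPerpDotGrad f s ξ' s ξ
      = (dS f (s + h) ξ' - dS f s ξ') * dXi f s ξ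
        - (dXi f (s + h) ξ' - dXi f s ξ') * dS f s ξ := by unfold gradPerpDotGrad; ring
  rw [this]
  refine (abs_sub _ _).trans ?_
  have h1 := abs_le_of_mul (hf.dS_sub_le s h ξ' hξ') (hf.dXi_le s ξ hξ)
  have h2 := abs_le_of_mul (hf.dXi_sub_le s h ξ' hξ') (hf.dS_le s ξ hξ)
  linarith

omit hf hα0 hα1 hξ in
theorem length_rsin_rpow_eq (h : ℝ) :
    (length z ^ (1 + α) * |rsin (s - (s + h))| ^ (1 + α))⁻¹
      = (length z ^ 2 * rsin h ^ 2) ^ (-((1 + α) / 2)) := by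
  rw [sub_add_cancel_left, rsin_neg, abs_neg,
    ← Real.mul_rpow hz.length_pos.le (abs_nonneg _),
    inv_rpow_eq_sq_rpow (mul_nonneg hz.length_pos.le (abs_nonneg _)), mul_pow, sq_abs]

/-- The subtraction removes the non-integrable `|h|^{-1-α}`: `(T_*·T) G'` differs from `G₀` by
`O(h)`, and the two kernels differ by `O(|h|^{1-2a})`. -/
theorem tame_regularIntegrand : Tame ((1 + α) / 2) ξ (regularIntegrand α z f s ξ) := by
  have hB := hz.pos
  refine Tame.of_abs_le (C := (B ^ 4 * (2 * B ^ 2) + 2 * B ^ 2) * B ^ (1 + α)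
      + 2 * B ^ 2 * ((((B⁻¹) ^ 2 / 4)⁻¹) ^ 2 * (2 * B ^ 4 + B ^ 2 * Real.pi ^ 2))) (by linarith)
    (by linarith) hξ (measurable_regularIntegrand hz hf α s ξ) (by positivity)
    fun ξ' h hξ' hh h0 => ?_
  rw [regularIntegrand, div_eq_mul_inv, div_eq_mul_inv, length_rsin_rpow_eq hz]
  set G' := gradPerpDotGrad f (s + h) ξ' s ξ with hG'
  set G₀ := gradPerpDotGrad f s ξ' s ξ with hG₀
  have h2 := inv_norm_sub_rpow_le hz (s := s) (β := 1 + α) (by linarith) hh h0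
  rw [← abs_of_nonneg (inv_nonneg.2 (Real.rpow_nonneg (norm_nonneg (z s - z (s + h))) (1 + α)))]
    at h2
  have h3 := abs_rpow_sub_rsin_rpow_le hz (a := (1 + α) / 2) (P := ‖z s - z (s + h)‖ ^ 2)
    (by linarith) (by linarith) hh h0
    (le_trans (by
      have : 0 ≤ (B⁻¹) ^ 2 * h ^ 2 := by positivity
      linarith) (hz.sq_le_norm_sub_sq hh))
    (by rw [norm_sub_rev]; exact hz.abs_norm_sub_sq_sub_le s h)
  rw [← inv_rpow_eq_sq_rpow (norm_nonneg _)] at h3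
  have h4 : |⟪tangent z (s + h), tangent z s⟫ * G' - G₀|
      ≤ (B ^ 4 * (2 * B ^ 2) + 2 * B ^ 2) * |h| := by
    have : ⟪tangent z (s + h), tangent z s⟫ * G' - G₀
      = (⟪tangent z (s + h), tangent z s⟫ - 1) * G' + (G' - G₀) := by ring
    rw [this]
    refine (abs_add_le _ _).trans ?_
    have := abs_le_of_mul (hz.abs_inner_tangent_sub_one_le s h hh)
      (abs_gradPerpDotGrad_le hf (s := s) (s' := s + h) hξ hξ')
    have := abs_gradPerpDotGrad_sub_le hf (s := s) (h := h) hξ hξ'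
    linarith
  have e : ⟪tangent z (s + h), tangent z s⟫ * G' * (‖z s - z (s + h)‖ ^ (1 + α))⁻¹
      - G₀ * (length z ^ 2 * rsin h ^ 2) ^ (-((1 + α) / 2))
      = (⟪tangent z (s + h), tangent z s⟫ * G' - G₀) * (‖z s - z (s + h)‖ ^ (1 + α))⁻¹
        + G₀ * ((‖z s - z (s + h)‖ ^ (1 + α))⁻¹
          - (length z ^ 2 * rsin h ^ 2) ^ (-((1 + α) / 2))) := by ring
  rw [e]
  refine (abs_add_le _ _).trans ((add_le_add (abs_le_of_mul h4 h2)
    (abs_le_of_mul (abs_gradPerpDotGrad_le hf hξ hξ') h3)).trans_eq ?_)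
  rw [← (mul_abs_rpow_eq (α := α) h0).1]; ring

/-! ### Integrability of the velocity integrands -/

variable {δ : ℝ} (hδ : 0 < δ) (hδB : δ ≤ 1 / (16 * B ^ 6))
include hδ hδB

omit hf in
-- The constant blows up like `δ^{-a}`; it serves only to justify integrability and Fubini at fixed
-- `δ`.
theorem inv_norm_tubular_sub_rpow_le {ξ' h : ℝ} (hξ' : |ξ'| ≤ 1) (hne : ξ' ≠ ξ)
    (hh : |h| ≤ 1 / 2) (h0 : h ≠ 0) :
    (‖tubular δ z s ξ - tubular δ z (s + h) ξ'‖ ^ (1 + α))⁻¹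
      ≤ δ⁻¹ * (((B⁻¹) ^ 2 / 2)⁻¹ * δ ^ (1 - (1 + α) / 2))
        * (|h| ^ (-((1 + α) / 2)) * |ξ - ξ'| ^ (-((1 + α) / 2))) := by
  have K := (hz.kernelData (a := (1 + α) / 2) (s := s) (by linarith) (by linarith) hδ hδB hξ hξ'
    hne h0 hh).kernel_le
  rw [inv_rpow_eq_sq_rpow (norm_nonneg _)]
  rw [weight] at K
  rw [mul_assoc, ← div_eq_inv_mul, le_div_iff₀ hδ]
  linarith

omit hf hα0 hα1 hξ in
theorem abs_one_sub_mul_curvature_le {ξ' s' : ℝ} (hξ' : |ξ'| ≤ 1) :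
    |1 - δ * ξ' * curvature z s'| ≤ 2 := by
  have h1 := hz.half_le_one_sub hδ hδB hξ' s'
  have h2 := hz.half_le_one_sub hδ hδB (ξ := -ξ') (by rwa [abs_neg]) s'
  rw [abs_of_nonneg (by linarith)]
  linarith

omit hf hz hα0 hα1 hξ hδ in
theorem le_one_of_le_inv_pow (hB : 1 ≤ B) : δ ≤ 1 := by
  refine hδB.trans ?_
  have := one_le_pow₀ hB (n := 6)
  rw [div_le_one (by positivity)]; linarith

theorem tame_normalIntegrand : Tame ((1 + α) / 2) ξ (normalIntegrand α δ z f s ξ) := by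
  have hB := hz.pos
  have hδ1 := le_one_of_le_inv_pow hδB hz.one_le
  refine ⟨measurable_normalIntegrand hz hf α δ s ξ,
    δ⁻¹ * (((B⁻¹) ^ 2 / 2)⁻¹ * δ ^ (1 - (1 + α) / 2)) * (1 * B * 1 + B * 2 * B * B ^ 2),
    by positivity, fun ξ' h hξ' hne hh h0 => ?_⟩
  have h1 := inv_norm_tubular_sub_rpow_le hz hα0 hα1 (s := s) hξ hδ hδB hξ' hne hh h0
  rw [← abs_of_nonneg (inv_nonneg.2 (Real.rpow_nonneg (norm_nonneg (tubular δ z s ξ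
    - tubular δ z (s + h) ξ')) (1 + α)))] at h1
  have h3 : |length z| ≤ B := by rw [abs_of_pos hz.length_pos]; exact hz.length_le
  have h4 : |δ| ≤ 1 := by rwa [abs_of_pos hδ]
  have h5 := (hz.abs_inner_tangent_normal_le s h).trans
    (mul_le_of_le_one_right (by positivity) (by linarith : |h| ≤ 1))
  have h6 := abs_le_of_mul (abs_le_of_mul h4 (hf.dS_le (s + h) ξ' hξ'))
    (hz.abs_inner_tangent_le (s + h) s)
  have h7 := abs_le_of_mul (abs_le_of_mul (abs_le_of_mul h3
    (abs_one_sub_mul_curvature_le hz hδ hδB (s' := s + h) hξ')) (hf.dXi_le (s + h) ξ' hξ')) h5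
  exact (abs_le_of_mul h1 ((abs_sub _ _).trans (add_le_add h6 h7))).trans_eq (by ring)

theorem tame_tangentIntegrand : Tame ((1 + α) / 2) ξ (tangentIntegrand α δ z f s ξ) := by
  have hB := hz.pos
  have hδ1 := le_one_of_le_inv_pow hδB hz.one_le
  refine ⟨measurable_tangentIntegrand hz hf α δ s ξ,
    δ⁻¹ * (((B⁻¹) ^ 2 / 2)⁻¹ * δ ^ (1 - (1 + α) / 2)) * (1 * B * B ^ 2 + B * 2 * B * 1),
    by positivity, fun ξ' h hξ' hne hh h0 => ?_⟩
  have h1 := inv_norm_tubular_sub_rpow_le hz hα0 hα1 (s := s) hξ hδ hδB hξ' hne hh h0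
  rw [← abs_of_nonneg (inv_nonneg.2 (Real.rpow_nonneg (norm_nonneg (tubular δ z s ξ
    - tubular δ z (s + h) ξ')) (1 + α)))] at h1
  have h3 : |length z| ≤ B := by rw [abs_of_pos hz.length_pos]; exact hz.length_le
  have h4 : |δ| ≤ 1 := by rwa [abs_of_pos hδ]
  have h5 := (hz.abs_inner_tangent_normal_le s h).trans
    (mul_le_of_le_one_right (by positivity) (by linarith : |h| ≤ 1))
  have h6 := abs_le_of_mul (abs_le_of_mul h4 (hf.dS_le (s + h) ξ' hξ')) h5
  have h7 := abs_le_of_mul (abs_le_of_mul (abs_le_of_mul h3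
    (abs_one_sub_mul_curvature_le hz hδ hδB (s' := s + h) hξ')) (hf.dXi_le (s + h) ξ' hξ'))
    (hz.abs_inner_tangent_le (s + h) s)
  exact (abs_le_of_mul h1 ((abs_add_le _ _).trans (add_le_add h6 h7))).trans_eq (by ring)

end

/-! ### The combined integrand -/

/-- The sum of all integrands with the factors with which they enter the approximate equation. -/
noncomputable def combined (α δ : ℝ) (z : ℝ → Plane) (f : ℝ → ℝ → ℝ) (s ξ : ℝ) (p : ℝ × ℝ) : ℝ :=
  frontIntegrand α z f s p * (-(δ⁻¹ * dXi f s ξ))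
    + normalIntegrand α δ z f s ξ p * (-(δ⁻¹ * dXi f s ξ))
    + tangentIntegrand α δ z f s ξ p * (dS f s ξ / (length z * (1 - δ * ξ * curvature z s)))
    + stretchIntegrand α z f s ξ p * ((1 + α) * length z * dXi f s ξ)
    + curvatureIntegrand α z f s p * dXi f s ξ
    + regularIntegrand α z f s ξ p

/-- `(L² h² + ε²)^{-a} - (L² h²)^{-a}`. -/
noncomputable def flatDiff (a l ε h : ℝ) : ℝ :=
  (l ^ 2 * h ^ 2 + ε ^ 2) ^ (-a) - (l ^ 2 * h ^ 2) ^ (-a)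

/-- The leading part of the combined integrand. -/
noncomputable def leading (α δ : ℝ) (z : ℝ → Plane) (f : ℝ → ℝ → ℝ) (s ξ ξ' h : ℝ) : ℝ :=
  -(flatDiff ((1 + α) / 2) (length z) (δ * |ξ - ξ'|) h * gradPerpDotGrad f s ξ' s ξ)
    - gradPerpDotGrad f s ξ' s ξ * (length z ^ 2 * rsin h ^ 2) ^ (-((1 + α) / 2))
    + length z * dXi f s ξ * dXi f s ξ' * (length z * curvature z s) / δ
      * (h * flatDiff ((1 + α) / 2) (length z) (δ * |ξ - ξ'|) h)

/-- The constant in the pointwise expansion. -/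
noncomputable def expansionConst (B : ℝ) : ℝ :=
  16 * B ^ 8 * (100 * (4 * B ^ 4) ^ 2 * (((B⁻¹) ^ 2 / 2)⁻¹) ^ 3)

/-! ### Comparison of the combined integrand with its leading part -/

section

variable {B : ℝ} {z : ℝ → Plane} {f : ℝ → ℝ → ℝ} (hz : CurveBounds B z) (hf : ProfileBounds B f)
  {α : ℝ} (hα0 : 0 < α) (hα1 : α < 1) {s ξ : ℝ} (hξ : |ξ| ≤ 1)
  {δ : ℝ} (hδ : 0 < δ) (hδB : δ ≤ 1 / (16 * B ^ 6))
include hz hf hα0 hα1 hξ hδ hδB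

theorem tame_combined : Tame ((1 + α) / 2) ξ (combined α δ z f s ξ) :=
  ((((((tame_frontIntegrand hz hf hα0 hα1 hξ).mul_const _).add
    ((tame_normalIntegrand hz hf hα0 hα1 hξ hδ hδB).mul_const _)).add
    ((tame_tangentIntegrand hz hf hα0 hα1 hξ hδ hδB).mul_const _)).add
    ((tame_stretchIntegrand hz hf hα0 hα1 hξ).mul_const _)).add
    ((tame_curvatureIntegrand hz hf hα0 hα1 hξ).mul_const _)).add
    (tame_regularIntegrand hz hf hα0 hα1 hξ)

theorem abs_combined_sub_leading_le {ξ' h : ℝ} (hξ' : |ξ'| ≤ 1) (hne : ξ' ≠ ξ)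
    (hh : |h| ≤ 1 / 2) (h0 : h ≠ 0) :
    |combined α δ z f s ξ (ξ', h) - leading α δ z f s ξ ξ' h|
      ≤ expansionConst B * weight ((1 + α) / 2) δ h (ξ - ξ') := by
  have hB := hz.pos
  have hL := hz.length_pos
  have K := hz.kernelData (a := (1 + α) / 2) (s := s) (by linarith) (by linarith) hδ hδB hξ hξ'
    hne h0 hh
  set m := (B⁻¹) ^ 2 / 2 with hm
  set W := weight ((1 + α) / 2) δ h (ξ - ξ') with hWdef
  have hW : 0 ≤ W := weight_nonneg hδ.le
  have hmi : 1 ≤ m⁻¹ := (one_le_inv₀ K.hm).2 K.hm1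
  have hB4 := K.hB
  have hm0 := K.hm
  -- The largest of the constants in the kernel estimates of `KernelData` used here, with `4B⁴` in
  -- the role of its geometric bound; one `c` then serves for all five hypotheses on the kernels.
  set c := 100 * (4 * B ^ 4) ^ 2 * (m⁻¹) ^ 3 with hc
  have hc0 : 0 ≤ c := by positivity
  have q1 : (m⁻¹) ^ 2 ≤ (m⁻¹) ^ 3 := pow_le_pow_right₀ hmi (by norm_num)
  have q0 : m⁻¹ ≤ (m⁻¹) ^ 3 := by simpa using pow_le_pow_right₀ hmi (show 1 ≤ 3 by norm_num)
  have q2 : 4 * B ^ 4 ≤ (4 * B ^ 4) ^ 2 := by nlinarith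
  have c1 : 20 * (4 * B ^ 4) * (m⁻¹) ^ 2 ≤ c := by
    rw [hc]; gcongr ?_ * ?_; linarith
  have c2 : 8 * (m⁻¹) ^ 2 ≤ c := by
    rw [hc]; gcongr ?_ * ?_; linarith
  have c3 : 20 * (4 * B ^ 4) * (m⁻¹) ^ 3 ≤ c := by
    rw [hc]; gcongr ?_ * ?_; linarith
  have c5 : m⁻¹ ≤ c := by
    rw [hc]
    calc m⁻¹ ≤ 1 * (m⁻¹) ^ 3 := by linarith
      _ ≤ _ := by gcongr; linarith
  have hε : (δ * |ξ - ξ'|) ^ 2 = δ ^ 2 * (ξ - ξ') ^ 2 := by rw [mul_pow, sq_abs]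
  have hP0 : 0 < ‖z s - z (s + h)‖ := by
    have := hz.chord s h hh
    have h1 : 0 < |h| := abs_pos.2 h0
    exact lt_of_lt_of_le (by positivity) this
  have e1 := K.abs_mul_kernel_sub_le.trans (mul_le_mul_of_nonneg_right c1 hW)
  have e2 := K.sq_mul_flat_sub_le.trans
    (mul_le_mul_of_nonneg_right c2 (mul_nonneg hδ.le hW))
  have e3 := K.abs_kernel_sub_sub_flat_le.trans (mul_le_mul_of_nonneg_right c3 hW)
  have e4 := K.abs_mul_kernel_expansion_le
  rw [← hc] at e4
  have e5 := K.kernel_le.trans (mul_le_mul_of_nonneg_right c5 hW)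
  have key := abs_integrand_sub_le (B := B) (L := length z) (δ := δ) (h := h) (W := W) (c := c)
    (Kr := (length z ^ 2 * rsin h ^ 2) ^ (-((1 + α) / 2)))
    (X := dXi f s ξ) (S := dS f s ξ) (X' := dXi f (s + h) ξ') (S' := dS f (s + h) ξ')
    (X₀ := dXi f s ξ') (S₀ := dS f s ξ') (τN := ⟪tangent z (s + h), normal z s⟫)
    (τT := ⟪tangent z (s + h), tangent z s⟫) (κ₀ := length z * curvature z s)
    (k := curvature z s) (k' := curvature z (s + h)) (ξ := ξ) (ξ' := ξ')
    hz.one_le hL hz.length_le hz.inv_length_le hδ (by linarith) hW hc0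
    (Real.rpow_nonneg (sq_nonneg _) _) e1 e2 e3 e4 e5
    (hf.dXi_le s ξ hξ) (hf.dS_le s ξ hξ) (hf.dXi_le _ ξ' hξ') (hf.dS_le _ ξ' hξ')
    (hf.dXi_le _ ξ' hξ') (hf.dS_le _ ξ' hξ') (hf.dXi_sub_le s h ξ' hξ') (hf.dS_sub_le s h ξ' hξ')
    (hz.abs_inner_tangent_normal_le s h) (hz.abs_inner_tangent_normal_sub_le s h)
    (hz.abs_inner_tangent_le _ _) (hz.abs_inner_tangent_sub_one_le s h hh)
    (hz.abs_curvature_le _) (hz.abs_curvature_le _) hξ hξ' (hz.half_le_one_sub hδ hδB hξ s)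
  have hconst : expansionConst B * W = 16 * B ^ 8 * (c * W) := by
    rw [expansionConst, hc, hm]; ring
  rw [hconst]
  refine le_trans (le_of_eq ?_) key
  have hcube : (‖z s - z (s + h)‖ ^ (3 + α))⁻¹
      = (‖z s - z (s + h)‖ ^ 2) ^ (-((1 + α) / 2) - 1) := by
    rw [inv_rpow_eq_sq_rpow hP0.le]; congr 1; ring
  congr 1
  simp only [combined, leading, frontIntegrand, normalIntegrand, tangentIntegrand,
    stretchIntegrand, curvatureIntegrand, regularIntegrand, flatDiff, gradPerpDotGrad]
  rw [div_eq_mul_inv _ (‖z s - z (s + h)‖ ^ (3 + α)), hcube,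
    div_eq_mul_inv _ (‖z s - z (s + h)‖ ^ (1 + α)),
    div_eq_mul_inv _ (‖z s - z (s + h)‖ ^ (1 + α)),
    inv_rpow_eq_sq_rpow hP0.le, inv_rpow_eq_sq_rpow (norm_nonneg _), div_eq_mul_inv _
    (length z ^ (1 + α) * |rsin (s - (s + h))| ^ (1 + α)), length_rsin_rpow_eq hz, hε]
  field_simp
  ring

end

/-! ### Integration of the leading part in `h` -/

section

variable {a l ε : ℝ}

theorem flatDiff_neg (h : ℝ) : flatDiff a l ε (-h) = flatDiff a l ε h := by
  simp [flatDiff]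

/-- The integrand is odd. This removes the part of `leading` with the factor `δ⁻¹`, which could not
be controlled by its size. -/
theorem integral_mul_flatDiff (r : ℝ) : ∫ h in (-r)..r, h * flatDiff a l ε h = 0 := by
  have h1 := intervalIntegral.integral_comp_neg (a := -r) (b := r)
    (fun h => h * flatDiff a l ε h)
  simp only [flatDiff_neg, neg_neg, neg_mul, intervalIntegral.integral_neg] at h1
  linarith

end

section

variable {B : ℝ} {z : ℝ → Plane} {f : ℝ → ℝ → ℝ} (hz : CurveBounds B z) (hf : ProfileBounds B f)
  {α : ℝ} (hα0 : 0 < α) (hα1 : α < 1) {s ξ : ℝ} (hξ : |ξ| ≤ 1)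
  {δ : ℝ} (hδ : 0 < δ) (hδB : δ ≤ 1 / (16 * B ^ 6))
include hz hα0

omit hα0 in
theorem flat_sub_rsin_eq (h : ℝ) :
    (length z ^ 2 * h ^ 2) ^ (-((1 + α) / 2)) - (length z ^ 2 * rsin h ^ 2) ^ (-((1 + α) / 2))
      = (length z ^ (1 + α))⁻¹ * (1 / |h| ^ (1 + α) - 1 / |rsin h| ^ (1 + α)) := by
  have hL := hz.length_pos.le
  rw [← sq_abs h, ← sq_abs (rsin h), ← mul_pow, ← mul_pow,
    ← inv_rpow_eq_sq_rpow (mul_nonneg hL (abs_nonneg _)),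
    ← inv_rpow_eq_sq_rpow (mul_nonneg hL (abs_nonneg _)),
    Real.mul_rpow hL (abs_nonneg _), Real.mul_rpow hL (abs_nonneg _), mul_inv, mul_inv]
  ring

omit hα0 in
theorem integral_flat_sub_rsin :
    ∫ h in (-(1 / 2) : ℝ)..(1 / 2), ((length z ^ 2 * h ^ 2) ^ (-((1 + α) / 2))
      - (length z ^ 2 * rsin h ^ 2) ^ (-((1 + α) / 2))) = (length z ^ (1 + α))⁻¹ * constB α := by
  simp_rw [flat_sub_rsin_eq hz]
  rw [intervalIntegral.integral_const_mul, constB]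

include hα1

theorem intervalIntegrable_flat_sub_rsin :
    IntervalIntegrable (fun h : ℝ => (length z ^ 2 * h ^ 2) ^ (-((1 + α) / 2))
      - (length z ^ 2 * rsin h ^ 2) ^ (-((1 + α) / 2))) volume (-(1 / 2)) (1 / 2) := by
  have hm : Measurable (fun p : ℝ × ℝ => (length z ^ 2 * p.2 ^ 2) ^ (-((1 + α) / 2))
      - (length z ^ 2 * rsin p.2 ^ 2) ^ (-((1 + α) / 2))) := by
    have := continuous_rsin.measurable
    fun_prop
  have hB := hz.pos
  have ht : Tame ((1 + α) / 2) 0 (fun p : ℝ × ℝ => (length z ^ 2 * p.2 ^ 2) ^ (-((1 + α) / 2))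
      - (length z ^ 2 * rsin p.2 ^ 2) ^ (-((1 + α) / 2))) := by
    refine Tame.of_abs_le (C := (((B⁻¹) ^ 2 / 4)⁻¹) ^ 2 * (2 * B ^ 4 + B ^ 2 * Real.pi ^ 2))
      (by linarith) (by linarith) (by simp) hm
      (by positivity) fun ξ' h _ hh h0 => ?_
    refine abs_rpow_sub_rsin_rpow_le hz (by linarith) (by linarith) hh h0 ?_ ?_
    · have h1 := hz.le_length
      have h2 : 0 < B⁻¹ := inv_pos.2 hz.pos
      have h3 : (B⁻¹) ^ 2 ≤ length z ^ 2 := by gcongr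
      gcongr
      have : 0 ≤ (B⁻¹) ^ 2 := by positivity
      linarith
    · rw [sub_self, abs_zero]; positivity
  -- The function does not depend on `ξ_*`; the slice at `1` is any slice away from the dummy
  -- singular value `0`.
  exact ht.intervalIntegrable (by linarith) (ξ' := 1) (by simp) (by simp)

include hf hξ hδ hδB

/-- The slices of the combined integrand, up to the singular and the constant terms of the
approximate equation, are small. -/
theorem abs_slice_le {ξ' : ℝ} (hξ' : |ξ'| ≤ 1) (hne : ξ' ≠ ξ) :
    |(∫ h in (-(1 / 2) : ℝ)..(1 / 2), combined α δ z f s ξ (ξ', h))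
      + constOne α * δ ^ (-α) / length z * (gradPerpDotGrad f s ξ' s ξ / |ξ - ξ'| ^ α)
      + constTwo α / length z ^ (1 + α) * gradPerpDotGrad f s ξ' s ξ|
      ≤ (expansionConst B * (∫ h in (-(1 / 2) : ℝ)..(1 / 2), |h| ^ (-((1 + α) / 2)))
          + 256 * B ^ 6) * δ ^ (1 - (1 + α) / 2) * |ξ - ξ'| ^ (-((1 + α) / 2)) := by
  set a := (1 + α) / 2 with ha
  have ha0 : 1 / 2 < a := by linarith
  have ha1 : a < 1 := by linarith
  have hB := hz.pos
  have hL := hz.length_pos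
  have hη : 0 < |ξ - ξ'| := abs_pos.2 (sub_ne_zero.2 hne.symm)
  have hη2 : |ξ - ξ'| ≤ 2 := (abs_sub _ _).trans (by linarith)
  have hε : 0 < δ * |ξ - ξ'| := by positivity
  have hδ1 := le_one_of_le_inv_pow hδB hz.one_le
  set G := gradPerpDotGrad f s ξ' s ξ with hG
  set ε := δ * |ξ - ξ'| with hεdef
  have hGb : |G| ≤ 2 * B ^ 2 := abs_gradPerpDotGrad_le hf hξ hξ'
  set c := length z * dXi f s ξ * dXi f s ξ' * (length z * curvature z s) / δ with hc
  set E : ℝ → ℝ := fun h => combined α δ z f s ξ (ξ', h) - leading α δ z f s ξ ξ' h with hE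
  set F₁ : ℝ → ℝ := fun h => (length z ^ 2 * h ^ 2 + ε ^ 2) ^ (-a) with hF₁
  set F₂ : ℝ → ℝ := fun h => (length z ^ 2 * h ^ 2) ^ (-a) - (length z ^ 2 * rsin h ^ 2) ^ (-a)
    with hF₂
  have iF : IntervalIntegrable (fun h => combined α δ z f s ξ (ξ', h)) volume (-(1 / 2)) (1 / 2) :=
    (tame_combined hz hf hα0 hα1 hξ hδ hδB).intervalIntegrable ha1 hξ' hne
  have i1 : IntervalIntegrable F₁ volume (-(1 / 2)) (1 / 2) :=
    (integrable_flat_kernel ha0 hL hε).intervalIntegrable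
  have i2 : IntervalIntegrable F₂ volume (-(1 / 2)) (1 / 2) :=
    intervalIntegrable_flat_sub_rsin hz hα0 hα1
  have ia := intervalIntegrable_abs_rpow ha1 (-(1 / 2)) (1 / 2)
  have hbE : ∀ h, |h| ≤ 1 / 2 → h ≠ 0 →
      |E h| ≤ expansionConst B * (δ ^ (1 - a) * |ξ - ξ'| ^ (-a)) * |h| ^ (-a) := by
    intro h hh h0
    refine (abs_combined_sub_leading_le hz hf hα0 hα1 hξ hδ hδB hξ' hne hh h0).trans_eq ?_
    rw [weight]; ring
  have haeE : ∀ᵐ h ∂volume, h ∈ uIoc (-(1 / 2) : ℝ) (1 / 2) →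
      ‖E h‖ ≤ expansionConst B * (δ ^ (1 - a) * |ξ - ξ'| ^ (-a)) * |h| ^ (-a) := by
    filter_upwards [Measure.ae_ne volume (0 : ℝ)] with h h0 hh
    rw [uIoc_of_le (by norm_num)] at hh
    exact hbE h (abs_le.2 ⟨hh.1.le, hh.2⟩) h0
  have hmE : Measurable E := by
    have h1 : Measurable fun h => combined α δ z f s ξ (ξ', h) :=
      (tame_combined hz hf hα0 hα1 hξ hδ hδB).measurable.comp measurable_prodMk_left
    have h2 := continuous_rsin.measurable
    have h3 : Measurable fun h => leading α δ z f s ξ ξ' h := by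
      unfold leading flatDiff; fun_prop
    exact h1.sub h3
  have iE : IntervalIntegrable E volume (-(1 / 2)) (1 / 2) := by
    refine (ia.const_mul (expansionConst B * (δ ^ (1 - a) * |ξ - ξ'| ^ (-a)))).mono_fun'
      hmE.aestronglyMeasurable ?_
    rw [Filter.EventuallyLE, ae_restrict_iff' measurableSet_uIoc]
    exact haeE
  -- Solving for the odd term exhibits it as a combination of integrable functions; its vanishing
  -- integral becomes a linear relation between their integrals.
  have hsplit : ∀ h, c * (h * flatDiff a (length z) ε h)
      = combined α δ z f s ξ (ξ', h) - E h + G * F₁ h - G * F₂ h := by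
    intro h
    simp only [hE, hF₁, hF₂, leading, ← ha, ← hG, ← hεdef, ← hc]
    simp only [flatDiff]
    ring
  have hodd : ∫ h in (-(1 / 2) : ℝ)..(1 / 2), (combined α δ z f s ξ (ξ', h) - E h + G * F₁ h
      - G * F₂ h) = 0 := by
    simp_rw [← hsplit]
    rw [intervalIntegral.integral_const_mul, integral_mul_flatDiff, mul_zero]
  rw [intervalIntegral.integral_sub ((iF.sub iE).add (i1.const_mul G)) (i2.const_mul G),
    intervalIntegral.integral_add (iF.sub iE) (i1.const_mul G),
    intervalIntegral.integral_sub iF iE, intervalIntegral.integral_const_mul,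
    intervalIntegral.integral_const_mul] at hodd
  have hF₂int : ∫ h in (-(1 / 2) : ℝ)..(1 / 2), F₂ h = (length z ^ (1 + α))⁻¹ * constB α :=
    integral_flat_sub_rsin hz
  have hEint : |∫ h in (-(1 / 2) : ℝ)..(1 / 2), E h|
      ≤ expansionConst B * (δ ^ (1 - a) * |ξ - ξ'| ^ (-a))
        * ∫ h in (-(1 / 2) : ℝ)..(1 / 2), |h| ^ (-a) := by
    rw [← intervalIntegral.integral_const_mul]
    refine intervalIntegral.norm_integral_le_of_norm_le (f := E) (by norm_num) ?_
      (ia.const_mul (expansionConst B * (δ ^ (1 - a) * |ξ - ξ'| ^ (-a))))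
    rw [uIoc_of_le (by norm_num)] at haeE
    exact haeE
  have hflat := abs_integral_flat_kernel_sub_le ha0 hL hε ha1
  set I₁ := ∫ h in (-(1 / 2) : ℝ)..(1 / 2), F₁ h with hI₁
  -- The whole-line part is the `C_{1,α}` term, because `1 - 2a = -α` and `ε = δ|ξ-ξ'|`. The next
  -- identity assembles `C_{2,α}` from the tails and from `b_α`.
  have hconst : G * (length z)⁻¹ * ε ^ (1 - 2 * a)
        * (√Real.pi * Real.Gamma (a - 1 / 2) / Real.Gamma a)
      = constOne α * δ ^ (-α) / length z * (G / |ξ - ξ'| ^ α) := by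
    rw [constOne, show a - 1 / 2 = α / 2 by rw [ha]; ring, show 1 - 2 * a = -α by rw [ha]; ring,
      hεdef, Real.mul_rpow hδ.le hη.le, Real.rpow_neg hη.le, show (α + 1) / 2 = a by rw [ha]; ring]
    ring
  have hconst2 : constTwo α / length z ^ (1 + α) * G
      = -(G * (length z ^ (-(2 * a)) * (2 ^ (2 * a) / (2 * a - 1))))
        - G * ((length z ^ (1 + α))⁻¹ * constB α) := by
    rw [constTwo, show 2 * a - 1 = α by rw [ha]; ring, show 2 * a = 1 + α by rw [ha]; ring,
      Real.rpow_neg hL.le]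
    ring
  have htotal : (∫ h in (-(1 / 2) : ℝ)..(1 / 2), combined α δ z f s ξ (ξ', h))
      + constOne α * δ ^ (-α) / length z * (G / |ξ - ξ'| ^ α)
      + constTwo α / length z ^ (1 + α) * G
      = (∫ h in (-(1 / 2) : ℝ)..(1 / 2), E h)
        - G * (I₁ - ((length z)⁻¹ * ε ^ (1 - 2 * a)
            * (√Real.pi * Real.Gamma (a - 1 / 2) / Real.Gamma a)
          - length z ^ (-(2 * a)) * (2 ^ (2 * a) / (2 * a - 1)))) := by
    rw [hF₂int] at hodd
    rw [hconst2, ← hconst]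
    linear_combination hodd
  rw [htotal]
  have hη1 := one_le_two_mul_rpow ha0 ha1 hη hη2
  have hLpow : length z ^ (-(2 * a) - 2) ≤ B ^ 4 := by
    have h1 : length z ^ (-(2 * a) - 2) ≤ (B⁻¹) ^ (-(2 * a) - 2) :=
      Real.rpow_le_rpow_of_nonpos (inv_pos.2 hB) hz.le_length (by linarith)
    rw [Real.inv_rpow hB.le, ← Real.rpow_neg hB.le] at h1
    refine h1.trans ?_
    rw [← Real.rpow_natCast B 4]
    exact Real.rpow_le_rpow_of_exponent_le hz.one_le (by push_cast; linarith)
  have hε2 : ε ^ 2 ≤ 4 * δ ^ (1 - a) := by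
    have h1 : δ ^ 2 ≤ δ ^ (1 - a) := by
      rw [← Real.rpow_natCast δ 2]
      exact Real.rpow_le_rpow_of_exponent_ge hδ hδ1 (by push_cast; linarith)
    calc ε ^ 2 ≤ (δ * 2) ^ 2 := by rw [hεdef]; gcongr
      _ = 4 * δ ^ 2 := by ring
      _ ≤ _ := by gcongr
  -- The error `O(ε²)` in the flat integral is put into the form of the weight. The number 256 is
  -- `2·16·4·2`: from `G`, from the flat integral, from `ε² ≤ 4δ^{1-a}` and from `1 ≤ 2|η|^{-a}`.
  have hpart : |G * (I₁ - ((length z)⁻¹ * ε ^ (1 - 2 * a)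
            * (√Real.pi * Real.Gamma (a - 1 / 2) / Real.Gamma a)
          - length z ^ (-(2 * a)) * (2 ^ (2 * a) / (2 * a - 1))))|
      ≤ 256 * B ^ 6 * (δ ^ (1 - a) * |ξ - ξ'| ^ (-a)) := by
    refine (abs_le_of_mul hGb hflat).trans ?_
    calc _ ≤ 2 * B ^ 2 * (16 * B ^ 4 * (4 * δ ^ (1 - a))) := by gcongr
      _ = 128 * B ^ 6 * δ ^ (1 - a) * 1 := by ring
      _ ≤ 128 * B ^ 6 * δ ^ (1 - a) * (2 * |ξ - ξ'| ^ (-a)) := by gcongr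
      _ = _ := by ring
  refine (abs_sub _ _).trans ((add_le_add hEint hpart).trans_eq ?_)
  ring

omit hz hα0 hξ hδ hδB in
theorem intervalIntegrable_gradPerpDotGrad_div :
    IntervalIntegrable (fun ξ' => gradPerpDotGrad f s ξ' s ξ / |ξ - ξ'| ^ α) volume (-1) 1 := by
  have h1 : Continuous fun x : ℝ => dXi f s x :=
    hf.continuous_dXi.comp (f := fun x : ℝ => (s, x)) (by fun_prop)
  have h2 : Continuous fun x : ℝ => dS f s x :=
    hf.continuous_dS.comp (f := fun x : ℝ => (s, x)) (by fun_prop)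
  have h3 : Continuous fun ξ' => gradPerpDotGrad f s ξ' s ξ := by
    unfold gradPerpDotGrad; fun_prop
  have := (intervalIntegrable_abs_sub_rpow hα1 ξ (-1) 1).continuousOn_mul h3.continuousOn
  refine this.congr fun x _ => ?_
  simp only [Real.rpow_neg (abs_nonneg _), div_eq_mul_inv]

omit hz hδ hδB hα0 hα1 hξ in
theorem continuous_gradPerpDotGrad : Continuous fun ξ' => gradPerpDotGrad f s ξ' s ξ := by
  have h1 : Continuous fun x : ℝ => dXi f s x :=
    hf.continuous_dXi.comp (f := fun x : ℝ => (s, x)) (by fun_prop)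
  have h2 : Continuous fun x : ℝ => dS f s x :=
    hf.continuous_dS.comp (f := fun x : ℝ => (s, x)) (by fun_prop)
  unfold gradPerpDotGrad; fun_prop

/-- The constant in the estimate of the remainder. -/
noncomputable def remainderConst (α B : ℝ) : ℝ :=
  (expansionConst B * (∫ h in (-(1 / 2) : ℝ)..(1 / 2), |h| ^ (-((1 + α) / 2))) + 256 * B ^ 6)
    * ∫ η in (-2 : ℝ)..2, |η| ^ (-((1 + α) / 2))

omit hz hf hα0 hα1 hξ hδ hδB in
theorem constFactor_nonneg (hB : 0 < B) :
    0 ≤ expansionConst B * (∫ h in (-(1 / 2) : ℝ)..(1 / 2), |h| ^ (-((1 + α) / 2)))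
      + 256 * B ^ 6 := by
  have h1 : 0 ≤ ∫ h in (-(1 / 2) : ℝ)..(1 / 2), |h| ^ (-((1 + α) / 2)) :=
    intervalIntegral.integral_nonneg (by norm_num) fun _ _ => by positivity
  have h2 : 0 ≤ expansionConst B := by unfold expansionConst; positivity
  positivity

/-- The combined integrals and the local terms of the approximate equation cancel up to a positive
power of `δ`. -/
theorem abs_integral_combined_add_le :
    |(∫ p, combined α δ z f s ξ p ∂boxMeasure)
      + constOne α * δ ^ (-α) / length z
        * (∫ ξ' in (-1 : ℝ)..1, gradPerpDotGrad f s ξ' s ξ / |ξ - ξ'| ^ α)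
      + constTwo α / length z ^ (1 + α) * (∫ ξ' in (-1 : ℝ)..1, gradPerpDotGrad f s ξ' s ξ)|
      ≤ remainderConst α B * δ ^ (1 - (1 + α) / 2) := by
  have ha1 : (1 + α) / 2 < 1 := by linarith
  have iF := (tame_combined hz hf hα0 hα1 (s := s) hξ hδ hδB).integrable ha1
  have j1 := intervalIntegrable_integral_boxMeasure iF
  have j2 := (intervalIntegrable_gradPerpDotGrad_div hf hα1 (s := s) (ξ := ξ)).const_mul
    (constOne α * δ ^ (-α) / length z)
  have j3 := ((continuous_gradPerpDotGrad hf (s := s) (ξ := ξ)).intervalIntegrable (-1) 1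
    (μ := volume)).const_mul (constTwo α / length z ^ (1 + α))
  rw [integral_boxMeasure iF, ← intervalIntegral.integral_const_mul,
    ← intervalIntegral.integral_const_mul, ← intervalIntegral.integral_add j1 j2,
    ← intervalIntegral.integral_add (j1.add j2) j3]
  set K := expansionConst B * (∫ h in (-(1 / 2) : ℝ)..(1 / 2), |h| ^ (-((1 + α) / 2)))
    + 256 * B ^ 6 with hK
  have hK0 : 0 ≤ K := constFactor_nonneg hz.pos
  have hb := intervalIntegral.norm_integral_le_of_norm_le (a := -1) (b := 1) (μ := volume)
    (f := fun ξ' => (∫ h in (-(1 / 2) : ℝ)..(1 / 2), combined α δ z f s ξ (ξ', h))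
      + constOne α * δ ^ (-α) / length z * (gradPerpDotGrad f s ξ' s ξ / |ξ - ξ'| ^ α)
      + constTwo α / length z ^ (1 + α) * gradPerpDotGrad f s ξ' s ξ)
    (g := fun ξ' => K * δ ^ (1 - (1 + α) / 2) * |ξ - ξ'| ^ (-((1 + α) / 2))) (by norm_num)
    (by
      filter_upwards [Measure.ae_ne volume ξ] with x hne hx
      exact abs_slice_le hz hf hα0 hα1 hξ hδ hδB (abs_le.2 ⟨hx.1.le, hx.2⟩) hne)
    ((intervalIntegrable_abs_sub_rpow ha1 ξ _ _).const_mul _)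
  refine hb.trans ?_
  rw [intervalIntegral.integral_const_mul, remainderConst, ← hK]
  have := integral_abs_sub_rpow_le ha1 hξ
  calc _ ≤ K * δ ^ (1 - (1 + α) / 2) * ∫ η in (-2 : ℝ)..2, |η| ^ (-((1 + α) / 2)) := by gcongr
    _ = _ := by ring

/-- The integral of the combined integrand in terms of its parts. -/
theorem integral_combined :
    ∫ p, combined α δ z f s ξ p ∂boxMeasure
      = (∫ p, frontIntegrand α z f s p ∂boxMeasure) * (-(δ⁻¹ * dXi f s ξ))
        + (∫ p, normalIntegrand α δ z f s ξ p ∂boxMeasure) * (-(δ⁻¹ * dXi f s ξ))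
        + (∫ p, tangentIntegrand α δ z f s ξ p ∂boxMeasure)
          * (dS f s ξ / (length z * (1 - δ * ξ * curvature z s)))
        + (∫ p, stretchIntegrand α z f s ξ p ∂boxMeasure) * ((1 + α) * length z * dXi f s ξ)
        + (∫ p, curvatureIntegrand α z f s p ∂boxMeasure) * dXi f s ξ
        + ∫ p, regularIntegrand α z f s ξ p ∂boxMeasure := by
  have ha1 : (1 + α) / 2 < 1 := by linarith
  have t1 := (tame_frontIntegrand hz hf hα0 hα1 (s := s) hξ).mul_const (-(δ⁻¹ * dXi f s ξ))
  have t2 := (tame_normalIntegrand hz hf hα0 hα1 (s := s) hξ hδ hδB).mul_const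
    (-(δ⁻¹ * dXi f s ξ))
  have t3 := (tame_tangentIntegrand hz hf hα0 hα1 (s := s) hξ hδ hδB).mul_const
    (dS f s ξ / (length z * (1 - δ * ξ * curvature z s)))
  have t4 := (tame_stretchIntegrand hz hf hα0 hα1 (s := s) hξ).mul_const
    ((1 + α) * length z * dXi f s ξ)
  have t5 := (tame_curvatureIntegrand hz hf hα0 hα1 (s := s) hξ).mul_const (dXi f s ξ)
  have t6 := tame_regularIntegrand hz hf hα0 hα1 (s := s) hξ
  simp only [combined]
  rw [integral_add (((((t1.add t2).add t3).add t4).add t5).integrable ha1) (t6.integrable ha1),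
    integral_add ((((t1.add t2).add t3).add t4).integrable ha1) (t5.integrable ha1),
    integral_add (((t1.add t2).add t3).integrable ha1) (t4.integrable ha1),
    integral_add ((t1.add t2).integrable ha1) (t3.integrable ha1),
    integral_add (t1.integrable ha1) (t2.integrable ha1),
    integral_mul_const, integral_mul_const, integral_mul_const, integral_mul_const,
    integral_mul_const]

end

/-! ### The approximate equation and the front operator as integrals over the box -/

theorem integral_shift_of_periodic {E : Type*} [NormedAddCommGroup E] [NormedSpace ℝ E]
    {g : ℝ → E} (hg : Function.Periodic g 1) (s : ℝ) :
    ∫ s' in (-(1 / 2) : ℝ)..(1 / 2), g s' = ∫ h in (-(1 / 2) : ℝ)..(1 / 2), g (s + h) := by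
  rw [intervalIntegral.integral_comp_add_left g s]
  have := hg.intervalIntegral_add_eq (-(1 / 2)) (s + -(1 / 2))
  rw [show (-(1 / 2) : ℝ) + 1 = 1 / 2 by norm_num,
    show s + -(1 / 2) + 1 = s + 1 / 2 by ring] at this
  exact this

theorem abs_rsin_periodic (s : ℝ) : Function.Periodic (fun s' => |rsin (s - s')|) 1 := fun s' => by
  have : rsin (s - (s' + 1)) = -rsin (s - s') := by
    rw [rsin, rsin, show Real.pi * (s - (s' + 1)) = Real.pi * (s - s') - Real.pi by ring,
      Real.sin_sub_pi, neg_div]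
  simp only [this, abs_neg]

section

variable {B : ℝ} {z : ℝ → Plane} {f : ℝ → ℝ → ℝ} (hz : CurveBounds B z) (hf : ProfileBounds B f)
  {α : ℝ} (hα0 : 0 < α) (hα1 : α < 1) {s ξ : ℝ} (hξ : |ξ| ≤ 1)

namespace ProfileBounds

include hf

theorem periodic_dXi (ξ : ℝ) : Function.Periodic (fun s => dXi f s ξ) 1 := fun s => by
  have : (fun ξ' => f (s + 1) ξ') = fun ξ' => f s ξ' := funext fun ξ' => hf.periodic ξ' s
  simp only [dXi, this]

theorem periodic_dS (ξ : ℝ) : Function.Periodic (fun s => dS f s ξ) 1 := fun s => by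
  have : (fun x => f (x + 1) ξ) = fun x => f x ξ := funext (hf.periodic ξ)
  simp only [dS]
  rw [← deriv_comp_add_const, this]

theorem periodic_gradPerpDotGrad (ξ' s ξ : ℝ) :
    Function.Periodic (fun s' => gradPerpDotGrad f s' ξ' s ξ) 1 := fun s' => by
  have h1 := hf.periodic_dXi ξ' s'
  have h2 := hf.periodic_dS ξ' s'
  simp only at h1 h2
  simp only [gradPerpDotGrad, h1, h2]

end ProfileBounds

include hz hf hα0 hα1

/-- Since `∂_ξ Ω` has integral one across the strip, it may be inserted under the integral of the
front operator. The term `∂_s z` drops out because it is tangential. In this form the operator can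
be subtracted from the velocity integrand pointwise. -/
theorem inner_frontOperator_normal :
    ⟪frontOperator α z s, normal z s⟫ = ∫ p, frontIntegrand α z f s p ∂boxMeasure := by
  have ha1 : (1 + α) / 2 < 1 := by linarith
  have hB := hz.pos
  have hper : Function.Periodic
      (fun s' => (‖z s - z s'‖ ^ (1 + α))⁻¹ • (deriv z s' - deriv z s)) 1 := fun s' => by
    simp only [hz.periodic s', hz.periodic_deriv s']
  have hint : IntervalIntegrable (fun h => (‖z s - z (s + h)‖ ^ (1 + α))⁻¹
      • (deriv z (s + h) - deriv z s)) volume (-(1 / 2)) (1 / 2) := by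
    refine ((intervalIntegrable_abs_rpow ha1 (-(1 / 2)) (1 / 2)).const_mul
      (B ^ (1 + α) * B * B ^ 2)).mono_fun' ?_ ?_
    · have h1 := hz.continuous_curve
      have h2 := hz.contDiff_deriv.continuous
      have h3 : Measurable fun h => ‖z s - z (s + h)‖ := Continuous.measurable (by fun_prop)
      have h4 : Measurable fun h => deriv z (s + h) - deriv z s :=
        Continuous.measurable (by fun_prop)
      exact ((h3.pow_const _).inv.smul h4).aestronglyMeasurable
    · rw [Filter.EventuallyLE, ae_restrict_iff' measurableSet_uIoc, uIoc_of_le (by norm_num)]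
      filter_upwards [Measure.ae_ne volume (0 : ℝ)] with h h0 hh
      have hh : |h| ≤ 1 / 2 := abs_le.2 ⟨hh.1.le, hh.2⟩
      have h1 := inv_norm_sub_rpow_le hz (s := s) (β := 1 + α) (by linarith) hh h0
      have h2 := hz.norm_tangent_sub_le s h
      rw [norm_smul, Real.norm_of_nonneg (by positivity), hz.deriv_eq, hz.deriv_eq, ← smul_sub,
        norm_smul, Real.norm_of_nonneg hz.length_pos.le]
      have h3 : |h| ^ (1 - 2 * ((1 + α) / 2)) ≤ |h| ^ (-((1 + α) / 2)) :=
        Real.rpow_le_rpow_of_exponent_ge (abs_pos.2 h0) (by linarith) (by linarith)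
      have h4 := mul_le_mul hz.length_le h2 (norm_nonneg _) hB.le
      calc _ ≤ B ^ (1 + α) * |h| ^ (-(1 + α)) * (B * (B ^ 2 * |h|)) :=
            mul_le_mul h1 h4 (mul_nonneg hz.length_pos.le (norm_nonneg _)) (by positivity)
        _ = B ^ (1 + α) * B * B ^ 2 * (|h| * |h| ^ (-(1 + α))) := by ring
        _ ≤ _ := by rw [(mul_abs_rpow_eq h0).1]; gcongr
  have htame := tame_frontIntegrand hz hf hα0 hα1 (s := s) (ξ := 0) (by simp)
  rw [integral_boxMeasure_swap (htame.integrable ha1), frontOperator,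
    integral_shift_of_periodic hper s]
  have h1 := (innerSL ℝ (normal z s)).intervalIntegral_comp_comm hint
  simp only [innerSL_apply_apply] at h1
  rw [real_inner_comm, ← h1]
  refine intervalIntegral.integral_congr fun h _ => ?_
  simp only [frontIntegrand]
  rw [intervalIntegral.integral_const_mul, hf.integral_dXi, mul_one, hz.deriv_eq, hz.deriv_eq,
    ← smul_sub, inner_smul_right, inner_smul_right, real_inner_comm, inner_sub_left,
    CurveBounds.inner_tangent_normal, sub_zero]
  ring

include hξ

theorem approxOperator_eq (δ : ℝ) (v : ℝ → Plane) :
    approxOperator α δ z v f s ξ = -⟪v s, tangent z s⟫ / length z * dS f s ξ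
      + (∫ p, stretchIntegrand α z f s ξ p ∂boxMeasure) * ((1 + α) * length z * dXi f s ξ)
      + (∫ p, curvatureIntegrand α z f s p ∂boxMeasure) * dXi f s ξ
      + (∫ p, regularIntegrand α z f s ξ p ∂boxMeasure)
      + constOne α * δ ^ (-α) / length z
        * (∫ ξ' in (-1 : ℝ)..1, gradPerpDotGrad f s ξ' s ξ / |ξ - ξ'| ^ α)
      + constTwo α / length z ^ (1 + α)
        * (∫ ξ' in (-1 : ℝ)..1, gradPerpDotGrad f s ξ' s ξ) := by
  have ha1 : (1 + α) / 2 < 1 := by linarith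
  have hT := hz.periodic_tangent
  have hN := hz.periodic_normal
  have hκ := hz.periodic_curvature
  have hp := hz.periodic
  have hX := hf.periodic_dXi
  have hG := hf.periodic_gradPerpDotGrad
  simp only [Function.Periodic] at hT hN hκ hp hX hG
  have hr := abs_rsin_periodic s
  simp only [Function.Periodic] at hr
  have e1 : (∫ ξ' in (-1 : ℝ)..1, ∫ s' in (-(1 / 2) : ℝ)..(1 / 2),
        ⟪tangent z s', normal z s⟫ / ‖z s - z s'‖ ^ (3 + α)
          * ⟪z s - z s', ξ • normal z s - ξ' • normal z s'⟫ * dXi f s' ξ')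
      = ∫ p, stretchIntegrand α z f s ξ p ∂boxMeasure := by
    rw [integral_boxMeasure ((tame_stretchIntegrand hz hf hα0 hα1 hξ).integrable ha1)]
    refine intervalIntegral.integral_congr fun ξ' _ => ?_
    exact integral_shift_of_periodic (fun s' => by simp only [hT, hN, hp, hX]) s
  have e2 : (∫ ξ' in (-1 : ℝ)..1, ∫ s' in (-(1 / 2) : ℝ)..(1 / 2),
        length z * curvature z s' * ⟪tangent z s', normal z s⟫ / ‖z s - z s'‖ ^ (1 + α)
          * ξ' * dXi f s' ξ')
      = ∫ p, curvatureIntegrand α z f s p ∂boxMeasure := by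
    rw [integral_boxMeasure ((tame_curvatureIntegrand hz hf hα0 hα1 hξ).integrable ha1)]
    refine intervalIntegral.integral_congr fun ξ' _ => ?_
    exact integral_shift_of_periodic (fun s' => by simp only [hT, hκ, hp, hX]) s
  have e3 : (∫ ξ' in (-1 : ℝ)..1, ∫ s' in (-(1 / 2) : ℝ)..(1 / 2),
      (⟪tangent z s', tangent z s⟫ * gradPerpDotGrad f s' ξ' s ξ / ‖z s - z s'‖ ^ (1 + α)
        - gradPerpDotGrad f s ξ' s ξ / (length z ^ (1 + α) * |rsin (s - s')| ^ (1 + α))))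
      = ∫ p, regularIntegrand α z f s ξ p ∂boxMeasure := by
    rw [integral_boxMeasure ((tame_regularIntegrand hz hf hα0 hα1 hξ).integrable ha1)]
    refine intervalIntegral.integral_congr fun ξ' _ => ?_
    exact integral_shift_of_periodic (fun s' => by simp only [hT, hG, hp, hr]) s
  rw [approxOperator, e1, e2, e3]
  ring

/-- The analytic core: up to a positive power of `δ`, the approximate operator is determined by the
velocity in tubular coordinates and the front operator. -/
theorem abs_approxOperator_sub_le {δ : ℝ} (hδ : 0 < δ) (hδB : δ ≤ 1 / (16 * B ^ 6))
    (v : ℝ → Plane) :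
    |approxOperator α δ z v f s ξ + ⟪v s, tangent z s⟫ / length z * dS f s ξ
      - (⟪frontOperator α z s, normal z s⟫ + ∫ p, normalIntegrand α δ z f s ξ p ∂boxMeasure)
        * (δ⁻¹ * dXi f s ξ)
      + (∫ p, tangentIntegrand α δ z f s ξ p ∂boxMeasure)
        * (dS f s ξ / (length z * (1 - δ * ξ * curvature z s)))|
      ≤ remainderConst α B * δ ^ (1 - (1 + α) / 2) := by
  refine le_trans (le_of_eq ?_) (abs_integral_combined_add_le hz hf hα0 hα1 (s := s) hξ hδ hδB)
  rw [approxOperator_eq hz hf hα0 hα1 hξ, inner_frontOperator_normal hz hf hα0 hα1,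
    integral_combined hz hf hα0 hα1 hξ hδ hδB]
  congr 1
  ring

end

/-! ### The gradient of the Riesz potential -/

theorem inner_gradient (g : Plane → ℝ) (x w : Plane) : ⟪gradient g x, w⟫ = fderiv ℝ g x w :=
  InnerProductSpace.toDual_symm_apply

theorem locallyIntegrable_kernel {α : ℝ} (hα1 : α < 1) :
    LocallyIntegrable (fun y : Plane => (‖y‖ ^ (1 + α))⁻¹) := by
  refine locallyIntegrable_of_norm_le_rpow (α := 1 + α) (C := 1) (by simp) (by simp; linarith)
    (Filter.Eventually.of_forall fun y => ?_) ?_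
  · rw [one_mul, Real.rpow_neg (norm_nonneg _), Real.norm_of_nonneg (by positivity)]
  · exact (by fun_prop : Measurable fun y : Plane => (‖y‖ ^ (1 + α))⁻¹).aestronglyMeasurable

/-- The kernel is locally integrable because `1+α < 2`, so the convolution may be differentiated in
the compactly supported `C¹` factor. No derivative of the kernel, and hence no principal value,
appears. -/
theorem inner_gradient_rieszPotential {α : ℝ} (hα1 : α < 1) {g : Plane → ℝ}
    (hg : ContDiff ℝ 1 g) (hc : HasCompactSupport g) (x w : Plane) :
    ⟪gradient (rieszPotential α g) x, w⟫
      = ∫ y, (‖x - y‖ ^ (1 + α))⁻¹ * ⟪gradient g y, w⟫ := by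
  have hK := locallyIntegrable_kernel hα1
  have hconv : rieszPotential α g
      = convolution g (fun y : Plane => (‖y‖ ^ (1 + α))⁻¹) (ContinuousLinearMap.mul ℝ ℝ) volume := by
    funext x
    simp only [rieszPotential, convolution, ContinuousLinearMap.mul_apply', div_eq_mul_inv]
  have hd := hc.hasFDerivAt_convolution_left (ContinuousLinearMap.mul ℝ ℝ) hg hK x
  rw [← hconv] at hd
  have hex := (hc.fderiv ℝ).convolutionExists_left
    ((ContinuousLinearMap.mul ℝ ℝ).precompL Plane) (hg.continuous_fderiv one_ne_zero) hK x
  rw [inner_gradient, hd.fderiv, convolution, ContinuousLinearMap.integral_apply hex]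
  refine integral_congr_ae (Filter.Eventually.of_forall fun y => ?_)
  simp only [ContinuousLinearMap.precompL_apply, ContinuousLinearMap.mul_apply', inner_gradient]
  ring

/-! ### Tubular coordinates -/

theorem exists_norm_sub_eq_infDist {z : ℝ → Plane} (hc : Continuous z)
    (hp : Function.Periodic z 1) (y : Plane) :
    ∃ s, ‖y - z s‖ = Metric.infDist y (range z) := by
  have hr : range z = z '' Icc 0 (0 + 1) := (hp.image_Icc one_pos 0).symm
  have hcomp : IsCompact (range z) := hr ▸ isCompact_Icc.image hc
  obtain ⟨_, ⟨s, rfl⟩, hs⟩ := hcomp.exists_infDist_eq_dist (range_nonempty z) y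
  exact ⟨s, by rw [hs, dist_eq_norm]⟩

section

variable {B : ℝ} {z : ℝ → Plane} (hz : CurveBounds B z)
include hz

namespace CurveBounds

/-- First order condition at a nearest point of the curve. -/
theorem inner_sub_deriv_eq_zero {y : Plane} {s : ℝ}
    (hs : ∀ s', ‖y - z s‖ ≤ ‖y - z s'‖) : ⟪y - z s, tangent z s⟫ = 0 := by
  have h1 : HasDerivAt (fun s => ‖y - z s‖ ^ 2) (2 * ⟪y - z s, -deriv z s⟫) s :=
    ((hz.hasDerivAt_one s).const_sub y).norm_sq
  have hmin : IsLocalMin (fun s => ‖y - z s‖ ^ 2) s :=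
    Filter.Eventually.of_forall fun s' => by
      have := hs s'
      simp only
      gcongr
  have h2 := hmin.hasDerivAt_eq_zero h1
  rw [inner_neg_right] at h2
  rw [tangent, inner_smul_right, show ⟪y - z s, deriv z s⟫ = 0 by linarith, mul_zero]

/-- Every point is reached by tubular coordinates with `|r|` the distance to the curve. -/
theorem exists_eq_add_smul_normal (y : Plane) :
    ∃ s r, y = z s + r • normal z s ∧ |r| = Metric.infDist y (range z) := by
  obtain ⟨s, hs⟩ := exists_norm_sub_eq_infDist hz.continuous_curve hz.periodic y
  have h0 : ⟪y - z s, tangent z s⟫ = 0 := hz.inner_sub_deriv_eq_zero fun s' => by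
    rw [hs, ← dist_eq_norm]
    exact Metric.infDist_le_dist_of_mem (mem_range_self s')
  have h1 := eq_inner_smul_add_inner_smul (hz.norm_tangent s) (y - z s)
  rw [h0, zero_smul, zero_add] at h1
  refine ⟨s, ⟪y - z s, perp (tangent z s)⟫, ?_, ?_⟩
  · rw [normal, ← h1]; abel
  · rw [← hs]
    conv_rhs => rw [h1, norm_smul, norm_perp, hz.norm_tangent, mul_one, Real.norm_eq_abs]

theorem tubular_periodic (δ ξ : ℝ) : Function.Periodic (fun s => tubular δ z s ξ) 1 := fun s => by
  simp only [tubular, hz.periodic s, hz.periodic_normal s]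

theorem tubular_sub_int (δ s ξ : ℝ) (n : ℤ) : tubular δ z (s - n) ξ = tubular δ z s ξ := by
  have := (hz.tubular_periodic δ ξ).sub_int_mul_eq (x := s) n
  simpa using this

/-- Subtracting the nearest integer brings the parameter difference into `[-1/2, 1/2]`, where the
lower bound for tubular distances forces both coordinates to agree. -/
theorem tubular_injective {δ s s' ξ ξ' : ℝ} (hδ : 0 < δ)
    (hξ : |δ * ξ| ≤ 1 / (16 * B ^ 6)) (hξ' : |δ * ξ'| ≤ 1 / (16 * B ^ 6))
    (h : tubular δ z s ξ = tubular δ z s' ξ') : ξ = ξ' ∧ ∃ n : ℤ, s' = s + n := by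
  set n := round (s' - s) with hn
  have hr : |s' - s - n| ≤ 1 / 2 := abs_sub_round (s' - s)
  have hle := hz.le_norm_tubular_sub_sq (s := s) hr hξ hξ'
  have e : s + (s' - s - n) = s' - n := by ring
  rw [e, hz.tubular_sub_int, h, sub_self, norm_zero] at hle
  have hB : 0 < (B⁻¹) ^ 2 / 2 := by have := hz.pos; positivity
  have h1 : 0 ≤ (B⁻¹) ^ 2 / 2 * (s' - s - n) ^ 2 := by positivity
  have h2 : 0 ≤ δ ^ 2 * (ξ - ξ') ^ 2 := by positivity
  have h3 : (B⁻¹) ^ 2 / 2 * (s' - s - n) ^ 2 = 0 := by linarith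
  have h4 : δ ^ 2 * (ξ - ξ') ^ 2 = 0 := by linarith
  have h5 : ξ - ξ' = 0 := by simpa [hδ.ne'] using h4
  have h6 : s' - s - n = 0 := by simpa [hz.pos.ne'] using h3
  exact ⟨by linarith, n, by linarith⟩

end CurveBounds

/-- Tubular coordinates `(ξ_*, h)` as a self-map of `ℝ × ℝ`. -/
noncomputable def tubularPair (δ : ℝ) (z : ℝ → Plane) (s : ℝ) (p : ℝ × ℝ) : ℝ × ℝ :=
  (tubular δ z (s + p.2) p.1 0, tubular δ z (s + p.2) p.1 1)

/-- The derivative of `tubularPair`. -/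
noncomputable def tubularPairDeriv (δ : ℝ) (z : ℝ → Plane) (s : ℝ) (p : ℝ × ℝ) :
    ℝ × ℝ →L[ℝ] ℝ × ℝ :=
  (Matrix.toLin (.finTwoProd ℝ) (.finTwoProd ℝ)
    !![δ * normal z (s + p.2) 0,
      length z * (1 - δ * p.1 * curvature z (s + p.2)) * tangent z (s + p.2) 0;
      δ * normal z (s + p.2) 1,
      length z * (1 - δ * p.1 * curvature z (s + p.2)) * tangent z (s + p.2) 1]).toContinuousLinearMap

theorem abs_det_tubularPairDeriv {δ : ℝ} (hδ : 0 < δ) (s : ℝ) {p : ℝ × ℝ}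
    (hJ : 0 ≤ 1 - δ * p.1 * curvature z (s + p.2)) :
    |(tubularPairDeriv δ z s p).det|
      = δ * length z * (1 - δ * p.1 * curvature z (s + p.2)) := by
  have hT : tangent z (s + p.2) 0 * tangent z (s + p.2) 0
      + tangent z (s + p.2) 1 * tangent z (s + p.2) 1 = 1 := by
    rw [← inner_plane, real_inner_self_eq_norm_sq, hz.norm_tangent]; norm_num
  have h1 : (tubularPairDeriv δ z s p).det
      = -(δ * length z * (1 - δ * p.1 * curvature z (s + p.2))) := by
    simp only [tubularPairDeriv, ContinuousLinearMap.det, LinearMap.coe_toContinuousLinearMap,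
      LinearMap.det_toLin, Matrix.det_fin_two_of, normal, perp_apply_zero, perp_apply_one]
    linear_combination (-(δ * length z * (1 - δ * p.1 * curvature z (s + p.2)))) * hT
  rw [h1, abs_neg, abs_of_nonneg]
  have := hz.length_pos
  positivity

theorem hasFDerivAt_tubular (δ s ξ : ℝ) :
    HasFDerivAt (fun p : ℝ × ℝ => tubular δ z p.2 p.1)
      ((ContinuousLinearMap.fst ℝ ℝ ℝ).smulRight (δ • normal z s)
        + (ContinuousLinearMap.snd ℝ ℝ ℝ).smulRight
          ((length z * (1 - δ * ξ * curvature z s)) • tangent z s)) (ξ, s) := by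
  have h1 : HasFDerivAt (fun p : ℝ × ℝ => z p.2) _ (ξ, s) :=
    (hz.hasDerivAt_one s).hasFDerivAt.comp (ξ, s) hasFDerivAt_snd
  have h2 : HasFDerivAt (fun p : ℝ × ℝ => normal z p.2) _ (ξ, s) :=
    HasFDerivAt.comp (g := normal z) (ξ, s) (hz.hasDerivAt_normal s).hasFDerivAt hasFDerivAt_snd
  have h3 : HasFDerivAt (fun p : ℝ × ℝ => δ * p.1) _ (ξ, s) :=
    (hasFDerivAt_fst (𝕜 := ℝ) (p := (ξ, s))).const_mul δ
  have h4 := h1.add (h3.smul h2)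
  refine h4.congr_fderiv ?_
  ext v
  · simp [hz.deriv_eq, smul_smul]
  · simp [hz.deriv_eq, smul_smul]
    ring

theorem hasFDerivAt_tubularPair (δ s : ℝ) (p : ℝ × ℝ) :
    HasFDerivAt (tubularPair δ z s) (tubularPairDeriv δ z s p) p := by
  have h0 := hasFDerivAt_tubular hz δ (s + p.2) p.1
  have h1 : HasFDerivAt (fun p : ℝ × ℝ => (p.1, s + p.2))
      ((ContinuousLinearMap.fst ℝ ℝ ℝ).prod (ContinuousLinearMap.snd ℝ ℝ ℝ)) p :=
    hasFDerivAt_fst.prodMk (hasFDerivAt_snd.const_add s)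
  have h2 := h0.comp p h1
  have h3 := ((EuclideanSpace.proj (0 : Fin 2) : Plane →L[ℝ] ℝ).hasFDerivAt.comp p
    h2).prodMk ((EuclideanSpace.proj (1 : Fin 2) : Plane →L[ℝ] ℝ).hasFDerivAt.comp p h2)
  refine h3.congr_fderiv ?_
  rw [tubularPairDeriv, Matrix.toLin_finTwoProd_toContinuousLinearMap]
  ext <;> simp

omit hz in
theorem boxMeasure_eq_restrict :
    boxMeasure = (volume : Measure (ℝ × ℝ)).restrict
      (Icc (-1 : ℝ) 1 ×ˢ Ioc (-(1 / 2) : ℝ) (1 / 2)) := by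
  rw [boxMeasure, Measure.volume_eq_prod, ← Measure.prod_restrict,
    Measure.restrict_congr_set (Ioc_ae_eq_Icc (μ := (volume : Measure ℝ)) (a := -1) (b := 1))]

omit hz in
theorem integral_plane_eq (F : Plane → ℝ) : ∫ y, F y = ∫ q : ℝ × ℝ, F !₂[q.1, q.2] := by
  have h1 := (PiLp.volume_preserving_toLp (Fin 2)).integral_comp
    (MeasurableEquiv.toLp 2 (Fin 2 → ℝ)).measurableEmbedding F
  have h2 := (volume_preserving_finTwoArrow ℝ).symm.integral_comp
    (MeasurableEquiv.finTwoArrow (α := ℝ)).symm.measurableEmbedding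
    (fun v : Fin 2 → ℝ => F (WithLp.toLp 2 v))
  rw [← h1, ← h2]
  rfl

/-- Integration in tubular coordinates. -/
theorem integral_eq_integral_tubular {δ : ℝ} (hδ : 0 < δ) (hδB : δ ≤ 1 / (16 * B ^ 6)) (s : ℝ)
    (F : Plane → ℝ) (hF : ∀ y, δ < Metric.infDist y (range z) → F y = 0) :
    ∫ y, F y = ∫ p, δ * length z * (1 - δ * p.1 * curvature z (s + p.2))
      * F (tubular δ z (s + p.2) p.1) ∂boxMeasure := by
  set S : Set (ℝ × ℝ) := Icc (-1 : ℝ) 1 ×ˢ Ioc (-(1 / 2) : ℝ) (1 / 2) with hS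
  have hSm : MeasurableSet S := measurableSet_Icc.prod measurableSet_Ioc
  have hmk : ∀ p, (!₂[(tubularPair δ z s p).1, (tubularPair δ z s p).2] : Plane)
      = tubular δ z (s + p.2) p.1 := fun p => plane_ext (by simp [tubularPair])
        (by simp [tubularPair])
  have hsmall : ∀ ξ : ℝ, ξ ∈ Icc (-1 : ℝ) 1 → |δ * ξ| ≤ 1 / (16 * B ^ 6) := fun ξ hξ => by
    rw [abs_mul, abs_of_pos hδ]
    exact (mul_le_of_le_one_right hδ.le (abs_le.2 hξ)).trans hδB
  have hinj : InjOn (tubularPair δ z s) S := by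
    rintro ⟨ξ₁, h₁⟩ hp₁ ⟨ξ₂, h₂⟩ hp₂ heq
    have h := (hmk (ξ₁, h₁)).symm.trans ((congrArg (fun q : ℝ × ℝ => (!₂[q.1, q.2] : Plane))
      heq).trans (hmk (ξ₂, h₂)))
    obtain ⟨h1, n, hn⟩ := hz.tubular_injective hδ (hsmall ξ₁ hp₁.1) (hsmall ξ₂ hp₂.1) h
    -- The interval for `h` is half-open, so two of its points differ by strictly less than one
    -- period.
    have hn0 : n = 0 := by
      have a1 := hp₁.2
      have a2 := hp₂.2
      simp only [mem_Ioc] at a1 a2 hn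
      have b1 : (n : ℝ) < 1 := by linarith
      have b2 : (-1 : ℝ) < n := by linarith
      have c1 : n < 1 := by exact_mod_cast b1
      have c2 : -1 < n := by exact_mod_cast b2
      omega
    rw [hn0] at hn
    simp only [Int.cast_zero, add_zero] at hn
    rw [h1, show h₁ = h₂ by linarith]
  -- The image contains the closed `δ`-neighbourhood of the curve: a nearest point supplies `r` with
  -- `|r| ≤ δ`, and its parameter is moved by a period into the window around `s`. Off the image the
  -- integrand is therefore zero.
  have himage : ∀ q ∉ tubularPair δ z s '' S, F !₂[q.1, q.2] = 0 := by
    intro q hq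
    apply hF
    by_contra hcon
    push Not at hcon
    apply hq
    obtain ⟨s₀, r, hy, hr⟩ := hz.exists_eq_add_smul_normal !₂[q.1, q.2]
    have hper : Function.Periodic (fun s => tubular δ z s (r / δ)) 1 := hz.tubular_periodic δ _
    obtain ⟨s₁, hs₁, hs₁'⟩ := hper.exists_mem_Ioc one_pos s₀ (s + -(1 / 2))
    refine ⟨(r / δ, s₁ - s), ⟨?_, ?_⟩, ?_⟩
    · rw [← hr] at hcon
      refine abs_le.1 ?_
      rw [abs_div, abs_of_pos hδ]
      exact div_le_one_of_le₀ hcon hδ.le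
    · have := hs₁.1
      have := hs₁.2
      constructor <;> simp only <;> linarith
    · have h1 : tubular δ z s₁ (r / δ) = !₂[q.1, q.2] := by
        rw [← hs₁', hy, tubular, mul_div_cancel₀ _ hδ.ne']
      have h2 := hmk (r / δ, s₁ - s)
      simp only [add_sub_cancel] at h2
      rw [h1] at h2
      have e0 := congrArg (fun v : Plane => v 0) h2
      have e1 := congrArg (fun v : Plane => v 1) h2
      simp at e0 e1
      exact Prod.ext e0 e1
  rw [integral_plane_eq, ← setIntegral_eq_integral_of_forall_compl_eq_zero himage,
    integral_image_eq_integral_abs_det_fderiv_smul volume hSm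
      (fun p _ => (hasFDerivAt_tubularPair hz δ s p).hasFDerivWithinAt) hinj,
    boxMeasure_eq_restrict]
  refine setIntegral_congr_fun hSm fun p hp => ?_
  have hJ := hz.half_le_one_sub hδ hδB (abs_le.2 hp.1) (s + p.2)
  simp only [smul_eq_mul]
  rw [abs_det_tubularPairDeriv hz hδ s (by linarith), hmk]

end

/-! ### The profile and the velocity in tubular coordinates -/

section

variable {B : ℝ} {z : ℝ → Plane} (hz : CurveBounds B z) {δ : ℝ} {g : Plane → ℝ}
include hz

theorem contDiff_tubular (δ : ℝ) : ContDiff ℝ 2 (fun p : ℝ × ℝ => tubular δ z p.1 p.2) := by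
  have h1 : ContDiff ℝ 2 (fun p : ℝ × ℝ => z p.1) :=
    (hz.contDiff.of_le (by norm_num)).comp contDiff_fst
  have h2 : ContDiff ℝ 2 (fun p : ℝ × ℝ => normal z p.1) := hz.contDiff_normal.comp contDiff_fst
  unfold tubular
  exact h1.add ((contDiff_const.mul contDiff_snd).smul h2)

omit hz in
theorem dXi_comp_tubular (hg : Differentiable ℝ g) (s ξ : ℝ) :
    dXi (fun s ξ => g (tubular δ z s ξ)) s ξ
      = δ * ⟪gradient g (tubular δ z s ξ), normal z s⟫ := by
  have h1 : HasDerivAt (fun ξ' => tubular δ z s ξ') (δ • normal z s) ξ := by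
    have := (((hasDerivAt_id ξ).const_mul δ).smul_const (normal z s)).const_add (z s)
    rw [mul_one] at this
    exact this
  have h2 : HasDerivAt (fun ξ' => g (tubular δ z s ξ')) _ ξ :=
    (hg (tubular δ z s ξ)).hasFDerivAt.comp_hasDerivAt ξ h1
  rw [dXi, h2.deriv, inner_gradient, map_smul, smul_eq_mul]

theorem hasDerivAt_tubular (s ξ : ℝ) : HasDerivAt (fun s' => tubular δ z s' ξ)
    ((length z * (1 - δ * ξ * curvature z s)) • tangent z s) s := by
  refine ((hz.hasDerivAt_one s).add
    ((hz.hasDerivAt_normal s).const_smul (δ * ξ))).congr_deriv ?_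
  rw [hz.deriv_eq, smul_smul, ← add_smul]
  congr 1; ring

theorem dS_comp_tubular (hg : Differentiable ℝ g) (s ξ : ℝ) :
    dS (fun s ξ => g (tubular δ z s ξ)) s ξ
      = length z * (1 - δ * ξ * curvature z s)
        * ⟪gradient g (tubular δ z s ξ), tangent z s⟫ := by
  have h2 : HasDerivAt (fun s' => g (tubular δ z s' ξ)) _ s :=
    (hg (tubular δ z s ξ)).hasFDerivAt.comp_hasDerivAt s (hasDerivAt_tubular hz s ξ)
  rw [dS, h2.deriv, inner_gradient, map_smul, smul_eq_mul]

/-! ### The velocity as an integral in tubular coordinates -/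

variable {α : ℝ} (hα1 : α < 1) (hδ : 0 < δ) (hδB : δ ≤ 1 / (16 * B ^ 6))
  (hg : ContDiff ℝ 1 g) (hgc : HasCompactSupport g)
  (hg0 : ∀ y, δ < Metric.infDist y (range z) → gradient g y = 0)
include hα1 hδ hδB hg hgc hg0

theorem inner_gradient_rieszPotential_tubular (s ξ : ℝ) (w : Plane) :
    ⟪gradient (rieszPotential α g) (tubular δ z s ξ), w⟫
      = ∫ p, δ * length z * (1 - δ * p.1 * curvature z (s + p.2))
        * ((‖tubular δ z s ξ - tubular δ z (s + p.2) p.1‖ ^ (1 + α))⁻¹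
          * ⟪gradient g (tubular δ z (s + p.2) p.1), w⟫) ∂boxMeasure := by
  rw [inner_gradient_rieszPotential hα1 hg hgc]
  exact integral_eq_integral_tubular hz hδ hδB s
    (fun y => (‖tubular δ z s ξ - y‖ ^ (1 + α))⁻¹ * ⟪gradient g y, w⟫)
    fun y hy => by rw [hg0 y hy, inner_zero_left, mul_zero]

/-- `u·N` is the derivative of the potential in direction `T`. Decomposing `∇g` in the frame at
`s_*`, the Jacobian `δLJ_*` cancels the denominators: `δLJ_*(∇g·T_*) = δ ∂_sΩ_*` and `δLJ_*(∇g·N_*)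
= LJ_* ∂_ξΩ_*`. -/
theorem inner_velocity_normal (s ξ : ℝ) :
    ⟪velocity α g (tubular δ z s ξ), normal z s⟫
      = ∫ p, normalIntegrand α δ z (fun s ξ => g (tubular δ z s ξ)) s ξ p ∂boxMeasure := by
  have hgd : Differentiable ℝ g := hg.differentiable one_ne_zero
  rw [velocity, normal, inner_perp_perp, inner_gradient_rieszPotential_tubular hz hα1 hδ hδB hg hgc
    hg0]
  refine integral_congr_ae (Filter.Eventually.of_forall fun p => ?_)
  simp only [normalIntegrand]
  rw [dXi_comp_tubular hgd, dS_comp_tubular hz hgd,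
    inner_eq_frame (hz.norm_tangent (s + p.2)) (gradient g (tubular δ z (s + p.2) p.1)),
    ← normal, real_inner_comm (tangent z (s + p.2)) (tangent z s)]
  have : ⟪tangent z s, normal z (s + p.2)⟫ = -⟪tangent z (s + p.2), normal z s⟫ := by
    rw [normal, normal, ← inner_perp_left, real_inner_comm]
  rw [this]
  ring

theorem inner_velocity_tangent (s ξ : ℝ) :
    ⟪velocity α g (tubular δ z s ξ), tangent z s⟫
      = -∫ p, tangentIntegrand α δ z (fun s ξ => g (tubular δ z s ξ)) s ξ p ∂boxMeasure := by
  have hgd : Differentiable ℝ g := hg.differentiable one_ne_zero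
  rw [velocity, inner_perp_left, ← normal, inner_gradient_rieszPotential_tubular hz hα1 hδ hδB hg
    hgc hg0]
  congr 1
  refine integral_congr_ae (Filter.Eventually.of_forall fun p => ?_)
  simp only [tangentIntegrand]
  rw [dXi_comp_tubular hgd, dS_comp_tubular hz hgd,
    inner_eq_frame (hz.norm_tangent (s + p.2)) (gradient g (tubular δ z (s + p.2) p.1)),
    ← normal, real_inner_comm (tangent z (s + p.2)) (normal z s)]
  have : ⟪normal z s, normal z (s + p.2)⟫ = ⟪tangent z (s + p.2), tangent z s⟫ := by
    rw [normal, normal, inner_perp_perp, real_inner_comm]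
  rw [this]
  ring

end

/-! ### Bounds for the profile -/

/-- The second derivatives are used only through the Lipschitz dependence of the gradient on `s`, by
the mean value inequality on the convex strip. -/
theorem profileBounds_of_iteratedFDeriv {B : ℝ} {f : ℝ → ℝ → ℝ}
    (hf : ContDiff ℝ 2 (fun p : ℝ × ℝ => f p.1 p.2))
    (hper : ∀ ξ, Function.Periodic (fun s => f s ξ) 1)
    (hb : ∀ s, ∀ ξ ∈ Icc (-1 : ℝ) 1, ∀ k ∈ Finset.Icc 1 2,
      ‖iteratedFDeriv ℝ k (fun p : ℝ × ℝ => f p.1 p.2) (s, ξ)‖ ≤ B)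
    (hmass : ∀ s, f s 1 - f s (-1) = 1) : ProfileBounds B f := by
  set F := fun p : ℝ × ℝ => f p.1 p.2 with hF
  have hd : Differentiable ℝ F := hf.differentiable (by norm_num)
  have hX : ∀ s ξ, HasDerivAt (fun ξ' => f s ξ') (fderiv ℝ F (s, ξ) (0, 1)) ξ := fun s ξ =>
    (hd (s, ξ)).hasFDerivAt.comp_hasDerivAt ξ ((hasDerivAt_const ξ s).prodMk (hasDerivAt_id ξ))
  have hS : ∀ s ξ, HasDerivAt (fun s' => f s' ξ) (fderiv ℝ F (s, ξ) (1, 0)) s := fun s ξ =>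
    (hd (s, ξ)).hasFDerivAt.comp_hasDerivAt (f := fun s' => (s', ξ)) s
      ((hasDerivAt_id s).prodMk (hasDerivAt_const s ξ))
  have eX : ∀ s ξ, dXi f s ξ = fderiv ℝ F (s, ξ) (0, 1) := fun s ξ => (hX s ξ).deriv
  have eS : ∀ s ξ, dS f s ξ = fderiv ℝ F (s, ξ) (1, 0) := fun s ξ => (hS s ξ).deriv
  have hcF : Continuous (fderiv ℝ F) := hf.continuous_fderiv (by norm_num)
  have n1 : ‖((0 : ℝ), (1 : ℝ))‖ ≤ 1 := by simp [Prod.norm_def]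
  have n2 : ‖((1 : ℝ), (0 : ℝ))‖ ≤ 1 := by simp [Prod.norm_def]
  have hb1 : ∀ s ξ, |ξ| ≤ 1 → ‖fderiv ℝ F (s, ξ)‖ ≤ B := fun s ξ hξ => by
    have := hb s ξ (abs_le.1 hξ) 1 (by simp)
    rwa [norm_iteratedFDeriv_one] at this
  have hb2 : ∀ s ξ, |ξ| ≤ 1 → ‖fderiv ℝ (fderiv ℝ F) (s, ξ)‖ ≤ B := fun s ξ hξ => by
    have := hb s ξ (abs_le.1 hξ) 2 (by simp)
    rwa [← norm_iteratedFDeriv_fderiv (n := 1), norm_iteratedFDeriv_one] at this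
  have hd2 : Differentiable ℝ (fderiv ℝ F) :=
    (hf.fderiv_right (m := 1) (by norm_num)).differentiable one_ne_zero
  have hlip : ∀ s h ξ, |ξ| ≤ 1 → ‖fderiv ℝ F (s + h, ξ) - fderiv ℝ F (s, ξ)‖ ≤ B * |h| := by
    intro s h ξ hξ
    have hconv : Convex ℝ ((univ : Set ℝ) ×ˢ Icc (-1 : ℝ) 1) := convex_univ.prod (convex_Icc _ _)
    have := hconv.norm_image_sub_le_of_norm_fderiv_le (𝕜 := ℝ) (f := fderiv ℝ F) (C := B)
      (fun x _ => hd2 x) (fun x hx => hb2 x.1 x.2 (abs_le.2 hx.2))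
      (x := (s, ξ)) (y := (s + h, ξ)) ⟨trivial, abs_le.1 hξ⟩ ⟨trivial, abs_le.1 hξ⟩
    refine this.trans_eq ?_
    simp [Prod.norm_def]
  have happ : ∀ (A : ℝ × ℝ →L[ℝ] ℝ) (v : ℝ × ℝ) (C : ℝ), ‖v‖ ≤ 1 → ‖A‖ ≤ C → |A v| ≤ C :=
    fun A v C hv hA => (A.le_opNorm v).trans
      ((mul_le_of_le_one_right (norm_nonneg _) hv).trans hA)
  have cX : Continuous fun p : ℝ × ℝ => dXi f p.1 p.2 := by
    simp only [eX]; exact hcF.clm_apply continuous_const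
  refine ⟨cX, ?_, hper, ?_, ?_, ?_, ?_, ?_⟩
  · simp only [eS]; exact hcF.clm_apply continuous_const
  · intro s ξ hξ; rw [eX]; exact happ _ _ _ n1 (hb1 s ξ hξ)
  · intro s ξ hξ; rw [eS]; exact happ _ _ _ n2 (hb1 s ξ hξ)
  · intro s h ξ hξ
    rw [eX, eX, ← sub_apply]; exact happ _ _ _ n1 (hlip s h ξ hξ)
  · intro s h ξ hξ
    rw [eS, eS, ← sub_apply]; exact happ _ _ _ n2 (hlip s h ξ hξ)
  · intro s
    refine (intervalIntegral.integral_eq_sub_of_hasDerivAt (f := fun ξ => f s ξ) (fun ξ _ => ?_)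
      (Continuous.intervalIntegrable (cX.comp (f := fun ξ : ℝ => (s, ξ)) (by fun_prop)) _ _)).trans
      (hmass s)
    exact (hX s ξ).congr_deriv (eX s ξ).symm

/-! ### The collar of the boundary curve -/

/-- Otherwise the open set `A` and the open complement of its closure would separate `S`. -/
theorem inter_frontier_nonempty_of_isPreconnected {X : Type*} [TopologicalSpace X] {S A : Set X}
    (hS : IsPreconnected S) (hA : IsOpen A) (h1 : (S ∩ A).Nonempty) (h2 : (S ∩ Aᶜ).Nonempty) :
    (S ∩ frontier A).Nonempty := by
  by_contra hcon
  have hnot : ∀ x ∈ S, x ∉ A → x ∈ (closure A)ᶜ := fun x hx hxA hxc =>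
    hcon ⟨x, hx, hA.frontier_eq ▸ ⟨hxc, hxA⟩⟩
  obtain ⟨y, hy, hyA⟩ := h2
  obtain ⟨x, -, hxA, hxc⟩ := hS A (closure A)ᶜ hA isClosed_closure.isOpen_compl
    (fun x hx => (em (x ∈ A)).imp id (hnot x hx)) h1 ⟨y, hy, hnot y hy hyA⟩
  exact hxc (subset_closure hxA)

section

variable {B : ℝ} {z : ℝ → Plane} (hz : CurveBounds B z)
include hz

theorem abs_le_norm_add_smul_normal_sub {r : ℝ} (hr : |r| ≤ 1 / (16 * B ^ 6)) (s s' : ℝ) :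
    |r| ≤ ‖z s + r • normal z s - z s'‖ := by
  set n := round (s' - s) with hn
  have hh : |s' - s - n| ≤ 1 / 2 := abs_sub_round (s' - s)
  have hB := hz.pos
  have hle := hz.le_norm_tubular_sub_sq (δ := 1) (s := s) (ξ := r) (ξ' := 0) hh
    (by rwa [one_mul]) (by rw [mul_zero, abs_zero]; positivity)
  rw [show s + (s' - s - n) = s' - n by ring, hz.tubular_sub_int] at hle
  simp only [tubular, one_mul, one_pow, sub_zero, zero_smul, add_zero] at hle
  have h1 : 0 ≤ (B⁻¹) ^ 2 / 2 * (s' - s - n) ^ 2 := by positivity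
  have h2 : r ^ 2 ≤ ‖z s + r • normal z s - z s'‖ ^ 2 := by linarith
  exact abs_le_of_sq_le_sq h2 (norm_nonneg _)

theorem abs_le_infDist_range {r : ℝ} (hr : |r| ≤ 1 / (16 * B ^ 6)) (s : ℝ) :
    |r| ≤ Metric.infDist (z s + r • normal z s) (range z) := by
  rw [Metric.le_infDist (range_nonempty z)]
  rintro _ ⟨s', rfl⟩
  rw [dist_eq_norm]
  exact abs_le_norm_add_smul_normal_sub hz hr s s'

theorem add_smul_normal_notMem_range {r : ℝ} (hr : |r| ≤ 1 / (16 * B ^ 6)) (hr0 : r ≠ 0) (s : ℝ) :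
    z s + r • normal z s ∉ range z := fun h => by
  have h1 := abs_le_infDist_range hz hr s
  rw [Metric.infDist_zero_of_mem h] at h1
  exact hr0 (abs_nonpos_iff.1 h1)

variable {A : Set Plane} (hA : IsBoundaryCurve z A)
include hA

/-- Orientation places the beginning of the normal segment in `A`. The segment does not meet the
curve within the strip radius, so it cannot leave `A`. -/
theorem add_smul_normal_mem {r : ℝ} (hr0 : 0 < r) (hr : r ≤ 1 / (16 * B ^ 6)) (s : ℝ) :
    z s + r • normal z s ∈ A := by
  by_contra hcon
  set γ : ℝ → Plane := fun r => z s + r • normal z s with hγ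
  have hpre : IsPreconnected (γ '' Ioc 0 (1 / (16 * B ^ 6))) :=
    isPreconnected_Ioc.image γ (by fun_prop)
  have hpos : 0 < 1 / (16 * B ^ 6) := hr0.trans_le hr
  obtain ⟨r₁, h1, h2⟩ := ((hA.oriented s).and (Ioo_mem_nhdsGT hpos)).exists
  obtain ⟨_, ⟨r₂, hr₂, rfl⟩, h3⟩ := inter_frontier_nonempty_of_isPreconnected hpre
    hA.isOpen
    ⟨γ r₁, mem_image_of_mem γ ⟨h2.1, h2.2.le⟩, h1⟩ ⟨γ r, mem_image_of_mem γ ⟨hr0, hr⟩, hcon⟩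
  rw [hA.frontier_eq] at h3
  exact add_smul_normal_notMem_range hz (by rw [abs_of_pos hr₂.1]; exact hr₂.2) hr₂.1.ne' s h3

/-- A global argument: the outer collar is connected and disjoint from the frontier, so one of its
points in `A` would put all of it in `A`. With the inner collar, `closure A` would then contain a
neighbourhood of the curve; being clopen and nonempty it would be the whole plane, against
boundedness. -/
theorem add_smul_normal_notMem {r : ℝ} (hr0 : r < 0) (hr : -r ≤ 1 / (16 * B ^ 6)) (s : ℝ) :
    z s + r • normal z s ∉ A := by
  intro hmem
  set ρ := 1 / (16 * B ^ 6) with hρ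
  have hpos : 0 < ρ := by linarith
  set γ : ℝ × ℝ → Plane := fun p => z p.1 + p.2 • normal z p.1 with hγ
  have hcz := hz.continuous_curve
  have hcn := hz.continuous_normal
  have hpre : IsPreconnected (γ '' (univ ×ˢ Ico (-ρ) 0)) :=
    (isPreconnected_univ.prod isPreconnected_Ico).image γ (by fun_prop)
  have hsub : ∀ s' r', r' < 0 → -r' ≤ ρ → z s' + r' • normal z s' ∈ A := by
    intro s' r' hr0' hr'
    by_contra hcon
    obtain ⟨_, ⟨⟨s₂, r₂⟩, ⟨-, hr₂⟩, rfl⟩, h3⟩ := inter_frontier_nonempty_of_isPreconnected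
      hpre hA.isOpen
      ⟨γ (s, r), mem_image_of_mem γ ⟨trivial, by linarith, hr0⟩, hmem⟩
      ⟨γ (s', r'), mem_image_of_mem γ ⟨trivial, by linarith, hr0'⟩, hcon⟩
    rw [hA.frontier_eq] at h3
    exact add_smul_normal_notMem_range hz
      (by rw [abs_of_neg hr₂.2]; linarith [hr₂.1]) hr₂.2.ne s₂ h3
  have hopen : IsOpen (closure A) := by
    rw [isOpen_iff_mem_nhds]
    intro y hy
    by_cases hyA : y ∈ A
    · exact mem_of_superset (hA.isOpen.mem_nhds hyA) subset_closure
    · have hyf : y ∈ range z := by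
        rw [← hA.frontier_eq, hA.isOpen.frontier_eq]; exact ⟨hy, hyA⟩
      refine mem_of_superset (Metric.ball_mem_nhds y hpos) fun x hx => ?_
      obtain ⟨s₁, r₁, rfl, h2⟩ := hz.exists_eq_add_smul_normal x
      have h3 : |r₁| < ρ := h2 ▸ (Metric.infDist_le_dist_of_mem hyf).trans_lt hx
      rcases lt_trichotomy r₁ 0 with h | h | h
      · rw [abs_of_neg h] at h3
        exact subset_closure (hsub s₁ r₁ h h3.le)
      · rw [h, zero_smul, add_zero]
        exact frontier_subset_closure (hA.frontier_eq ▸ mem_range_self s₁)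
      · rw [abs_of_pos h] at h3
        exact subset_closure (add_smul_normal_mem hz hA h h3.le s₁)
  have huniv : closure A = univ := IsClopen.eq_univ ⟨isClosed_closure, hopen⟩ ⟨_, subset_closure hmem⟩
  exact NormedSpace.unbounded_univ ℝ Plane (huniv ▸ hA.isBounded.closure)

/-! ### Functions which are one inside and zero outside -/

variable {g : Plane → ℝ} {w : ℝ}

/-- At distance exactly `δ` the strict inequality defining the inner region may fail when `w = δ`.
The value is therefore obtained by continuity as `r` decreases to `δ`. -/
theorem apply_tubular_one (hg : Continuous g) (hin : ∀ x ∈ inRegion A w, g x = 1) {δ : ℝ}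
    (hδ : 0 < δ) (hw : w ≤ δ) (hδB : δ < 1 / (16 * B ^ 6)) (s : ℝ) : g (tubular δ z s 1) = 1 := by
  have hc : Continuous fun r : ℝ => g (z s + r • normal z s) := by fun_prop
  have h1 : Tendsto (fun r : ℝ => g (z s + r • normal z s)) (𝓝[>] δ) (𝓝 (g (tubular δ z s 1))) := by
    rw [tubular, mul_one]
    exact (hc.tendsto δ).mono_left nhdsWithin_le_nhds
  refine tendsto_nhds_unique h1 (tendsto_const_nhds.congr' ?_)
  filter_upwards [Ioo_mem_nhdsGT hδB] with r hr
  have hr0 := hδ.trans hr.1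
  have h2 := abs_le_infDist_range hz (r := r) (by rw [abs_of_pos hr0]; exact hr.2.le) s
  rw [abs_of_pos hr0] at h2
  refine (hin _ ⟨add_smul_normal_mem hz hA hr0 hr.2.le s, ?_⟩).symm
  rw [hA.frontier_eq]
  linarith [hr.1]

omit hz hA in
theorem mem_outRegion {x : Plane} (hx : x ∉ A) (h : w < Metric.infDist x (frontier A)) :
    x ∈ outRegion A w := by
  rintro (h1 | h1)
  · exact hx h1.1
  · exact absurd h1 (not_le.2 h)

theorem apply_tubular_neg_one (hg : Continuous g) (hout : ∀ x ∈ outRegion A w, g x = 0) {δ : ℝ}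
    (hδ : 0 < δ) (hw : w ≤ δ) (hδB : δ < 1 / (16 * B ^ 6)) (s : ℝ) :
    g (tubular δ z s (-1)) = 0 := by
  have hc : Continuous fun r : ℝ => g (z s + (-r) • normal z s) := by fun_prop
  have h1 : Tendsto (fun r : ℝ => g (z s + (-r) • normal z s)) (𝓝[>] δ)
      (𝓝 (g (tubular δ z s (-1)))) := by
    rw [tubular, mul_neg_one]
    exact (hc.tendsto δ).mono_left nhdsWithin_le_nhds
  refine tendsto_nhds_unique h1 (tendsto_const_nhds.congr' ?_)
  filter_upwards [Ioo_mem_nhdsGT hδB] with r hr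
  have hr0 := hδ.trans hr.1
  have h2 := abs_le_infDist_range hz (r := -r) (by rw [abs_neg, abs_of_pos hr0]; exact hr.2.le) s
  rw [abs_neg, abs_of_pos hr0] at h2
  refine (hout _ (mem_outRegion (add_smul_normal_notMem hz hA (neg_lt_zero.2 hr0)
    (by rw [neg_neg]; exact hr.2.le) s) ?_)).symm
  rw [hA.frontier_eq]
  linarith [hr.1]

omit hz in
-- Outside the transition region the function is locally constant; points outside `A` are kept away
-- from its closure because they are off the frontier.
theorem gradient_eq_zero_of_lt_infDist (hin : ∀ x ∈ inRegion A w, g x = 1)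
    (hout : ∀ x ∈ outRegion A w, g x = 0) (hw : 0 ≤ w) {y : Plane}
    (hy : w < Metric.infDist y (range z)) : gradient g y = 0 := by
  have hev : ∀ᶠ x in 𝓝 y, w < Metric.infDist x (frontier A) := by
    rw [hA.frontier_eq]
    exact (Metric.continuous_infDist_pt _).continuousAt.eventually (lt_mem_nhds hy)
  have hconst : ∃ k : ℝ, g =ᶠ[𝓝 y] fun _ => k := by
    by_cases hyA : y ∈ A
    · refine ⟨1, ?_⟩
      filter_upwards [hev, hA.isOpen.mem_nhds hyA] with x hx hxA using hin x ⟨hxA, hx⟩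
    · have hyc : y ∉ closure A := fun hc => by
        have : y ∈ frontier A := by rw [hA.isOpen.frontier_eq]; exact ⟨hc, hyA⟩
        rw [hA.frontier_eq] at this
        rw [Metric.infDist_zero_of_mem this] at hy
        linarith
      refine ⟨0, ?_⟩
      filter_upwards [hev, isClosed_closure.isOpen_compl.mem_nhds hyc] with x hx hxA using
        hout x (mem_outRegion (fun h => hxA (subset_closure h)) hx)
  obtain ⟨k, hk⟩ := hconst
  rw [gradient, hk.fderiv_eq, fderiv_const_apply, map_zero]

theorem hasCompactSupport_of_eq_zero (hout : ∀ x ∈ outRegion A w, g x = 0) :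
    HasCompactSupport g := by
  obtain ⟨R, hR⟩ := hA.isBounded.closure.subset_closedBall 0
  refine HasCompactSupport.of_support_subset_isCompact
    (isCompact_closedBall (0 : Plane) (R + |w|)) fun y hy => ?_
  rw [mem_closedBall_zero_iff]
  by_cases hyA : y ∈ A
  · have := mem_closedBall_zero_iff.1 (hR (subset_closure hyA))
    linarith [abs_nonneg w]
  · have hle : Metric.infDist y (range z) ≤ w := by
      by_contra hcon
      exact hy (hout y (mem_outRegion hyA (by rw [hA.frontier_eq]; exact not_le.1 hcon)))
    obtain ⟨s, hs⟩ := exists_norm_sub_eq_infDist hz.continuous_curve hz.periodic y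
    have h1 := mem_closedBall_zero_iff.1
      (hR (frontier_subset_closure (hA.frontier_eq ▸ mem_range_self s)))
    have h2 := norm_le_norm_add_norm_sub' y (z s)
    linarith [le_abs_self w]

end

/-! ### The equation at a fixed time -/

/-- Decomposition in the frame at `s`. The normal part has size `δ⁻¹` times the defect of the front
equation, giving `ηB`. The tangential part costs `O(δ)`, from the rotation of the frame and from
replacing `LJ` by `L`; the rest is `abs_approxOperator_sub_le`. -/
theorem abs_transport_add_approxOperator_le {B α δ η k ξ : ℝ} {z v : ℝ → Plane} {g : Plane → ℝ}
    (hz : CurveBounds B z)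
    (hf : ProfileBounds B fun s ξ => g (tubular δ z s ξ)) (hα0 : 0 < α) (hα1 : α < 1)
    (hδ : 0 < δ) (hδB : δ ≤ 1 / (16 * B ^ 6)) (hg : ContDiff ℝ 1 g) (hgc : HasCompactSupport g)
    (hg0 : ∀ y, δ < Metric.infDist y (range z) → gradient g y = 0) (hξ : |ξ| ≤ 1) {s : ℝ}
    (hv : ‖v s‖ ≤ B) (hk : |k| ≤ B ^ 2)
    (hfront : |⟪v s, normal z s⟫ + ⟪frontOperator α z s, normal z s⟫| ≤ η * δ) :
    |⟪gradient g (tubular δ z s ξ), v s + (δ * ξ * k) • tangent z s⟫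
        - ⟪velocity α g (tubular δ z s ξ), gradient g (tubular δ z s ξ)⟫
        + approxOperator α δ z v (fun s ξ => g (tubular δ z s ξ)) s ξ|
      ≤ 4 * B ^ 6 * δ + η * B + remainderConst α B * δ ^ (1 - (1 + α) / 2) := by
  have hgd : Differentiable ℝ g := hg.differentiable one_ne_zero
  have core := abs_approxOperator_sub_le hz hf hα0 hα1 hξ hδ hδB v (s := s)
  rw [← inner_velocity_normal hz hα1 hδ hδB hg hgc hg0] at core
  have htan := inner_velocity_tangent hz hα1 hδ hδB hg hgc hg0 s ξ
  have hX := dXi_comp_tubular (z := z) (δ := δ) hgd s ξ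
  have hS := dS_comp_tubular hz (δ := δ) hgd s ξ
  have hXb := hf.dXi_le s ξ hξ
  have hSb := hf.dS_le s ξ hξ
  set f : ℝ → ℝ → ℝ := fun s ξ => g (tubular δ z s ξ) with hfdef
  set X := dXi f s ξ
  set S := dS f s ξ
  set x := tubular δ z s ξ
  set J := 1 - δ * ξ * curvature z s with hJdef
  set τ := ∫ p, tangentIntegrand α δ z f s ξ p ∂boxMeasure
  set u := velocity α g x
  have hJ : 1 / 2 ≤ J := hz.half_le_one_sub hδ hδB hξ s
  have hJ0 : 0 < J := by linarith
  have hL := hz.length_pos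
  have hB := hz.pos
  have e1 : ⟪gradient g x, normal z s⟫ = δ⁻¹ * X := by rw [hX]; field_simp
  have e2 : ⟪gradient g x, tangent z s⟫ = S / (length z * J) := by rw [hS]; field_simp
  have e3 := inner_eq_frame (hz.norm_tangent s) (gradient g x) (v s)
  have e4 := inner_eq_frame (hz.norm_tangent s) u (gradient g x)
  rw [← normal, e1, e2] at e3 e4
  rw [htan] at e4
  have hLJ : |S / (length z * J)| ≤ 2 * B ^ 2 := by
    rw [abs_div, abs_of_pos (mul_pos hL hJ0), div_le_iff₀ (mul_pos hL hJ0)]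
    refine hSb.trans ?_
    have h1 : 1 ≤ B * length z := by
      have := mul_le_mul_of_nonneg_left hz.le_length hB.le
      rwa [mul_inv_cancel₀ hB.ne'] at this
    have h2 : B * 1 ≤ B * (B * length z) := by gcongr
    nlinarith [mul_le_mul_of_nonneg_left hJ (by positivity : 0 ≤ 2 * B ^ 2 * length z)]
  have hvT : |⟪v s, tangent z s⟫| ≤ B := by
    refine (abs_real_inner_le_norm _ _).trans ?_
    rwa [hz.norm_tangent, mul_one]
  have b1 : |δ * ξ * (⟪v s, tangent z s⟫ * curvature z s + k) * (S / (length z * J))|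
      ≤ 4 * B ^ 6 * δ := by
    have h1 : |⟪v s, tangent z s⟫ * curvature z s + k| ≤ 2 * B ^ 4 := by
      refine (abs_add_le _ _).trans ?_
      rw [abs_mul]
      have h2 : |⟪v s, tangent z s⟫| * |curvature z s| ≤ B * B ^ 3 :=
        mul_le_mul hvT (hz.abs_curvature_le s) (abs_nonneg _) hB.le
      have h3 : B ^ 2 ≤ B ^ 4 := pow_le_pow_right₀ hz.one_le (by norm_num)
      nlinarith
    rw [abs_mul, abs_mul, abs_mul, abs_of_pos hδ]
    calc δ * |ξ| * |⟪v s, tangent z s⟫ * curvature z s + k| * |S / (length z * J)|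
        ≤ δ * 1 * (2 * B ^ 4) * (2 * B ^ 2) := by gcongr
      _ = 4 * B ^ 6 * δ := by ring
  have b2 : |(⟪v s, normal z s⟫ + ⟪frontOperator α z s, normal z s⟫) * (δ⁻¹ * X)| ≤ η * B := by
    rw [abs_mul, abs_mul, abs_of_pos (inv_pos.2 hδ)]
    have hη : 0 ≤ η * δ := (abs_nonneg _).trans hfront
    calc _ ≤ η * δ * (δ⁻¹ * B) := by gcongr
      _ = η * B := by field_simp
  have hsplit : ⟪gradient g x, v s + (δ * ξ * k) • tangent z s⟫ - ⟪u, gradient g x⟫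
        + approxOperator α δ z v f s ξ
      = δ * ξ * (⟪v s, tangent z s⟫ * curvature z s + k) * (S / (length z * J))
        + (⟪v s, normal z s⟫ + ⟪frontOperator α z s, normal z s⟫) * (δ⁻¹ * X)
        + (approxOperator α δ z v f s ξ + ⟪v s, tangent z s⟫ / length z * S
          - (⟪frontOperator α z s, normal z s⟫ + ⟪u, normal z s⟫) * (δ⁻¹ * X)
          + τ * (S / (length z * J))) := by
    have e5 : ⟪v s, tangent z s⟫ / length z * S
        = ⟪v s, tangent z s⟫ * (1 - δ * ξ * curvature z s) * (S / (length z * J)) := by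
      rw [← hJdef]; field_simp
    rw [inner_add_right, inner_smul_right, e2, e3, e4, e5]
    ring
  rw [hsplit]
  refine (abs_add_le _ _).trans (add_le_add ((abs_add_le _ _).trans (add_le_add b1 b2)) core)

/-! ### The time derivative of the profile -/

/-- The normal of a moving curve rotates with the angular velocity of the tangent. -/
theorem exists_hasDerivAt_perp_normalize {w : ℝ → Plane} {w' : Plane} {t : ℝ}
    (hw : HasDerivAt w w' t) (h0 : w t ≠ 0) :
    ∃ k : ℝ, |k| ≤ ‖w t‖⁻¹ * ‖w'‖ ∧
      HasDerivAt (fun t' => perp (‖w t'‖⁻¹ • w t')) (k • ‖w t‖⁻¹ • w t) t := by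
  have hn : ‖w t‖ ≠ 0 := norm_ne_zero_iff.2 h0
  have hd : DifferentiableAt ℝ (fun t' => ‖w t'‖⁻¹) t :=
    (hw.differentiableAt.norm ℝ h0).inv hn
  set r := deriv (fun t' => ‖w t'‖⁻¹) t
  have h1 := hd.hasDerivAt.smul hw
  have h2 := perpL.hasFDerivAt.comp_hasDerivAt t h1
  set e : ℝ → Plane := fun t' => ‖w t'‖⁻¹ • w t' with he
  set e' : Plane := ‖w t‖⁻¹ • w' + r • w t with he'
  have hone : ‖e t‖ = 1 := by rw [he]; simp [norm_smul, hn]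
  have hperp : ⟪e', e t⟫ = 0 := by
    have h3 : HasDerivAt (fun t' => ‖e t'‖ ^ 2) (2 * ⟪e t, e'⟫) t := h1.norm_sq
    have h4 : (fun t' => ‖e t'‖ ^ 2) =ᶠ[𝓝 t] fun _ => 1 := by
      filter_upwards [hw.continuousAt.eventually_ne h0] with t' ht'
      simp [he, norm_smul, ht']
    have h5 := h3.unique ((hasDerivAt_const t (1 : ℝ)).congr_of_eventuallyEq h4)
    rw [real_inner_comm]; linarith
  have hk : ⟪perp e', e t⟫ = -(‖w t‖⁻¹ * ⟪w', perp (e t)⟫) := by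
    rw [inner_perp_left, he', inner_add_left, inner_smul_left, inner_smul_left, he]
    simp only [perp_smul, inner_smul_right, inner_perp_self]
    simp
  refine ⟨⟪perp e', e t⟫, ?_, ?_⟩
  · rw [hk, abs_neg, abs_mul, abs_of_nonneg (by positivity)]
    refine mul_le_mul_of_nonneg_left ((abs_real_inner_le_norm _ _).trans ?_) (by positivity)
    rw [norm_perp, hone, mul_one]
  · refine h2.congr_deriv ?_
    rw [perpL_apply]
    have := eq_inner_smul_add_inner_smul hone (perp e')
    rwa [inner_perp_perp, hperp, zero_smul, add_zero] at this

/-- Chain rule along the moving coordinate point, whose velocity is `z_τ + δξN_τ`. As `N` stays a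
unit vector, `N_τ = kT` for a rotation rate `k` with `|k| ≤ |z_{sτ}|/L`. -/
theorem exists_deriv_inTubular_eq {α T M c C δ Cz : ℝ} {θ : Plane → ℝ → ℝ} {A : ℝ → Set Plane}
    {z : ℝ → ℝ → Plane} (hθ : IsAlmostSharpFront α T C δ Cz θ A z)
    (hreg : IsRegularFront T M c z (inTubular δ θ z)) {t : ℝ} (ht : t ∈ Ioo 0 T) {s : ℝ}
    (h0 : 0 < length fun s' => z s' t) (ξ : ℝ) :
    ∃ k : ℝ, |k| ≤ (length fun s' => z s' t)⁻¹ * M ∧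
      deriv (fun t' => inTubular δ θ z s ξ t') t
        = ⟪gradient (fun y => θ y t) (tubular δ (fun s' => z s' t) s ξ),
            deriv (fun t' => z s t') t + (δ * ξ * k) • tangent (fun s' => z s' t) s⟫
          - ⟪velocity α (fun y => θ y t) (tubular δ (fun s' => z s' t) s ξ),
              gradient (fun y => θ y t) (tubular δ (fun s' => z s' t) s ξ)⟫ := by
  have hnhds : ∀ᶠ t' in 𝓝 t, t' ∈ Ioo 0 T := isOpen_Ioo.mem_nhds ht
  have hslice : ∀ {E : Type} [NormedAddCommGroup E] [NormedSpace ℝ E] {F : ℝ × ℝ → E},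
      ContDiffOn ℝ 1 F (univ ×ˢ Ioo 0 T) →
        HasDerivAt (fun t' => F (s, t')) (deriv (fun t' => F (s, t')) t) t := by
    intro E _ _ F hF
    have h1 : DifferentiableAt ℝ F (s, t) :=
      (hF.contDiffAt ((isOpen_univ.prod isOpen_Ioo).mem_nhds ⟨trivial, ht⟩)).differentiableAt
        one_ne_zero
    exact (h1.comp t ((differentiableAt_const s).prodMk differentiableAt_id)).hasDerivAt
  have hv := hslice hreg.curve_time
  have hw := hslice hreg.tangent_time
  simp only at hv hw
  -- Replacing the length by the pointwise speed writes the normal as a normalised `z_s^⊥`; the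
  -- length, an integral, need not be differentiated in time.
  have hspeed : ∀ t' ∈ Ioo 0 T, ‖deriv (fun s' => z s' t') s‖ = length fun s' => z s' t' :=
    fun t' ht' => (hθ.curve t' ht').uniformSpeed s
  obtain ⟨k, hk, hn⟩ := exists_hasDerivAt_perp_normalize hw
    (by rw [← norm_pos_iff, hspeed t ht]; exact h0)
  rw [hspeed t ht] at hk hn
  refine ⟨k, hk.trans (by gcongr; exact hreg.tangent_time_bound t ht s), ?_⟩
  set x := tubular δ (fun s' => z s' t) s ξ with hx
  set g : Plane → ℝ := fun y => θ y t with hg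
  have hcurve : HasDerivAt (fun t' => tubular δ (fun s' => z s' t') s ξ)
      (deriv (fun t' => z s t') t + (δ * ξ * k) • tangent (fun s' => z s' t) s) t := by
    have h1 := hv.add (hn.const_smul (δ * ξ))
    rw [smul_smul] at h1
    refine h1.congr_of_eventuallyEq ?_
    filter_upwards [hnhds] with t' ht'
    simp [tubular, normal, tangent, hspeed t' ht']
  have hD := ((hθ.solution.contDiffOn.contDiffAt (x := (x, t))
    ((isOpen_univ.prod isOpen_Ioo).mem_nhds ⟨mem_univ x, ht⟩)).differentiableAt
      one_ne_zero).hasFDerivAt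
  set D := fderiv ℝ (fun p : Plane × ℝ => θ p.1 p.2) (x, t)
  have htot : HasDerivAt (fun t' => inTubular δ θ z s ξ t') _ t :=
    hD.comp_hasDerivAt (f := fun t' => (tubular δ (fun s' => z s' t') s ξ, t')) t
      (hcurve.prodMk (hasDerivAt_id t))
  have htime : HasDerivAt (fun t' => θ x t') (D (0, 1)) t :=
    hD.comp_hasDerivAt (f := fun t' => (x, t')) t ((hasDerivAt_const t x).prodMk (hasDerivAt_id t))
  have hspace : HasFDerivAt g (D.comp (ContinuousLinearMap.inl ℝ Plane ℝ)) x :=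
    HasFDerivAt.comp (f := fun y => (y, t)) x hD (hasFDerivAt_prodMk_left x t)
  have heq := hθ.solution.equation t ht x
  rw [htime.deriv] at heq
  rw [htot.deriv, inner_gradient, hspace.fderiv, ContinuousLinearMap.comp_apply,
    ContinuousLinearMap.inl_apply]
  set y := deriv (fun t' => z s t') t + (δ * ξ * k) • tangent (fun s' => z s' t) s
  have hsum : D (y, 1) = D (y, 0) + D (0, 1) := by rw [← map_add]; simp
  rw [hsum]
  linarith

/-! ### Uniform bounds for the curves -/

theorem curveBounds_of_isRegularFront {T M c : ℝ} (hc : 0 < c) {z : ℝ → ℝ → Plane}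
    {Ω : ℝ → ℝ → ℝ → ℝ} (hreg : IsRegularFront T M c z Ω) {t : ℝ} (ht : t ∈ Ioo 0 T)
    {A : Set Plane} (hA : IsBoundaryCurve (fun s => z s t) A) :
    CurveBounds (1 + |M| + 2 / c) fun s => z s t := by
  set B := 1 + |M| + 2 / c with hB
  have hc2 : 0 < 2 / c := by positivity
  have hM : M ≤ B := by linarith [le_abs_self M]
  have hB1 : 1 ≤ B := by linarith [abs_nonneg M]
  have hB0 : 0 < B := by linarith
  have hBc : B⁻¹ ≤ c / 2 := by
    rw [inv_le_comm₀ hB0 (by positivity), inv_div]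
    linarith [abs_nonneg M]
  have hchord : ∀ s h, |h| ≤ 1 / 2 → B⁻¹ * |h| ≤ ‖z s t - z (s + h) t‖ := by
    intro s h hh
    refine le_trans ?_ (hreg.chord_arc t ht s (s + h))
    have h1 := two_div_pi_mul_le_abs_rsin (h := s - (s + h)) (by simpa using hh)
    rw [sub_add_cancel_left, abs_neg] at h1
    rw [sub_add_cancel_left]
    have h2 : 1 / 2 ≤ 2 / Real.pi := by
      rw [div_le_div_iff₀ two_pos Real.pi_pos]; linarith [Real.pi_le_four]
    calc B⁻¹ * |h| ≤ c / 2 * |h| := by gcongr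
      _ = c * (1 / 2 * |h|) := by ring
      _ ≤ c * (2 / Real.pi * |h|) := by gcongr
      _ ≤ _ := by gcongr
  have hdiff : Differentiable ℝ fun s => z s t := hA.contDiff.differentiable (by norm_num)
  refine ⟨hB1, hreg.curve_contDiff t ht, hA.periodic, hA.uniformSpeed, ?_, fun s => ?_,
    fun s => ?_, fun s => ?_, hchord⟩
  -- Lower bound for the length: half a period apart, two points are at distance at least `B⁻¹/2` by
  -- the chord-arc bound and at most `L/2` by the speed.
  · have h1 := hchord 0 (1 / 2) (by norm_num)
    have h2 := convex_univ.norm_image_sub_le_of_norm_deriv_le (𝕜 := ℝ) (f := fun s => z s t)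
      (C := length fun s => z s t) (fun s _ => hdiff s) (fun s _ => (hA.uniformSpeed s).le)
      (mem_univ (0 + 1 / 2)) (mem_univ 0)
    have h3 := h1.trans h2
    norm_num [abs_of_pos] at h3
    linarith
  · have := hreg.curve_bound t ht s 1 (by simp)
    rw [iteratedDeriv_one] at this
    exact this.trans hM
  · exact (hreg.curve_bound t ht s 2 (by simp)).trans hM
  · exact (hreg.curve_bound t ht s 3 (by simp)).trans hM

/-- The approximate equation for a single almost-sharp front, with an explicit remainder. -/
theorem abs_deriv_inTubular_add_approxOperator_le {α T B C M c δ η Cz : ℝ} (hα0 : 0 < α)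
    (hα1 : α < 1) (hδ : 0 < δ) (hδB : δ < 1 / (16 * B ^ 6)) (hMB : M ≤ B) {θ : Plane → ℝ → ℝ}
    {A : ℝ → Set Plane} {z : ℝ → ℝ → Plane} (hθ : IsAlmostSharpFront α T C δ Cz θ A z)
    (hCz : Cz ≤ 1) (hreg : IsRegularFront T M c z (inTubular δ θ z)) {t : ℝ} (ht : t ∈ Ioo 0 T)
    (hz : CurveBounds B fun s => z s t) {s ξ : ℝ} (hξ : |ξ| ≤ 1)
    (hfront : |⟪deriv (fun t' => z s t') t, normal (fun s' => z s' t) s⟫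
      + ⟪frontOperator α (fun s' => z s' t) s, normal (fun s' => z s' t) s⟫| ≤ η * δ) :
    |deriv (fun t' => inTubular δ θ z s ξ t') t
        + approxOperator α δ (fun s' => z s' t) (fun s' => deriv (fun t' => z s' t') t)
            (fun s' ξ' => inTubular δ θ z s' ξ' t) s ξ|
      ≤ 4 * B ^ 6 * δ + η * B + remainderConst α B * δ ^ (1 - (1 + α) / 2) := by
  have hA := hθ.curve t ht
  have hone := hθ.eq_one t ht
  have hzero := hθ.eq_zero t ht
  have hw : Cz * δ ≤ δ := mul_le_of_le_one_left hδ.le hCz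
  have hw0 : 0 ≤ Cz * δ := (mul_pos hθ.width_pos hδ).le
  have hprof := hreg.profile_bound t ht
  have hg : ContDiff ℝ 2 fun y => θ y t := hθ.contDiff t ht
  obtain ⟨k, hk, hderiv⟩ := exists_deriv_inTubular_eq hθ hreg ht (s := s) hz.length_pos ξ
  have hv := hreg.curve_time_bound t ht s
  rw [hderiv]
  simp only [inTubular] at hprof ⊢
  set g : Plane → ℝ := fun y => θ y t
  set ζ : ℝ → Plane := fun s' => z s' t
  have hf : ProfileBounds B fun s' ξ' => g (tubular δ ζ s' ξ') := by
    refine profileBounds_of_iteratedFDeriv (hg.comp (contDiff_tubular hz δ))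
      (fun ξ' s' => congrArg g (hz.tubular_periodic δ ξ' s'))
      (fun s' ξ' hξ' k hk => (hprof s' ξ' hξ' k hk).trans hMB) fun s' => ?_
    rw [apply_tubular_one hz hA hg.continuous hone hδ hw hδB s',
      apply_tubular_neg_one hz hA hg.continuous hzero hδ hw hδB s', sub_zero]
  have hkB : |k| ≤ B ^ 2 := by
    refine hk.trans ?_
    rw [sq]
    exact mul_le_mul hz.inv_length_le hMB ((norm_nonneg _).trans hv) hz.pos.le
  exact abs_transport_add_approxOperator_le (v := fun s' => deriv (fun t' => z s' t') t) hz hf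
    hα0 hα1 hδ hδB.le (hg.of_le (by norm_num)) (hasCompactSupport_of_eq_zero hz hA hzero)
    (fun y hy => gradient_eq_zero_of_lt_infDist hA hone hzero hw0 (hw.trans_lt hy)) hξ
    (hv.trans hMB) hkB hfront

end SingularSQG

open SingularSQG
theorem mainTheorem3 (α T δ₀ C M c : ℝ) (hα0 : 0 < α) (hα1 : α < 1) (hT : 0 < T) (hδ₀ : 0 < δ₀)
    (hc : 0 < c)
    (θ : ℝ → Plane → ℝ → ℝ) (A : ℝ → ℝ → Set Plane) (z : ℝ → ℝ → ℝ → Plane) (Cz : ℝ → ℝ)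
    (hASF : ∀ δ ∈ Ioo 0 δ₀, IsAlmostSharpFront α T C δ (Cz δ) (θ δ) (A δ) (z δ))
    (hCz : ∀ δ ∈ Ioo 0 δ₀, Cz δ ≤ 1)
    (hreg : ∀ δ ∈ Ioo 0 δ₀, IsRegularFront T M c (z δ) (inTubular δ (θ δ) (z δ)))
    (hfront : ∀ η > 0, ∀ᶠ δ in 𝓝[>] (0 : ℝ), ∀ t ∈ Ioo 0 T, ∀ s,
      |⟪deriv (fun t' => z δ s t') t, normal (fun s' => z δ s' t) s⟫
        + ⟪frontOperator α (fun s' => z δ s' t) s, normal (fun s' => z δ s' t) s⟫| ≤ η * δ) :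
    ∀ ε > 0, ∀ᶠ δ in 𝓝[>] (0 : ℝ), ∀ t ∈ Ioo 0 T, ∀ s, ∀ ξ ∈ Icc (-1 : ℝ) 1,
      |deriv (fun t' => inTubular δ (θ δ) (z δ) s ξ t') t
        + approxOperator α δ (fun s' => z δ s' t) (fun s' => deriv (fun t' => z δ s' t') t)
            (fun s' ξ' => inTubular δ (θ δ) (z δ) s' ξ' t) s ξ| ≤ ε := by
  intro ε hε
  set B := 1 + |M| + 2 / c with hB
  have hB0 : 0 < B := by positivity
  have hMB : M ≤ B := by
    have : 0 < 2 / c := by positivity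
    linarith [le_abs_self M]
  have ha : 0 < 1 - (1 + α) / 2 := by linarith
  have hsmall : ∀ᶠ δ in 𝓝[>] (0 : ℝ),
      4 * B ^ 6 * δ + remainderConst α B * δ ^ (1 - (1 + α) / 2) < ε / 2 := by
    have h1 : Continuous fun δ : ℝ =>
        4 * B ^ 6 * δ + remainderConst α B * δ ^ (1 - (1 + α) / 2) :=
      (continuous_const.mul continuous_id).add
        (continuous_const.mul (Real.continuous_rpow_const ha.le))
    have h2 := h1.tendsto 0
    rw [Real.zero_rpow ha.ne', mul_zero, mul_zero, add_zero] at h2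
    exact (h2.mono_left nhdsWithin_le_nhds).eventually (gt_mem_nhds (by linarith))
  -- The defect of the front equation enters with the factor `B`, so `η = ε/(2B)` uses half of `ε`;
  -- the powers of `δ` use the other half. The last condition keeps `δ` below the tubular radius.
  filter_upwards [hsmall, hfront (ε / (2 * B)) (by positivity), Ioo_mem_nhdsGT hδ₀,
    Ioo_mem_nhdsGT (show 0 < 1 / (16 * B ^ 6) by positivity)] with δ h1 h2 hδ hδB t ht s ξ hξ
  refine (abs_deriv_inTubular_add_approxOperator_le hα0 hα1 hδ.1 hδB.2 hMB (hASF δ hδ) (hCz δ hδ)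
    (hreg δ hδ) ht (curveBounds_of_isRegularFront hc (hreg δ hδ) ht ((hASF δ hδ).curve t ht))
    (abs_le.2 hξ) (h2 t ht s)).trans ?_
  have e : ε / (2 * B) * B = ε / 2 := by field_simp
  rw [e]
  linarith
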